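/- Let $n\ge 1$ and let $\mathscr F$ be the Fourier transform on $\mathbb R^n$, normalized so that $\sqrt{-\Delta}$ has symbol $|\xi|$. Let $\Phi:\mathbb R^n\to[0,1]$ be smooth and radial with $\operatorname{supp}\Phi\subseteq\{|\xi|\le 2\}$ and $\Phi(\xi)=1$ for $|\xi|\le 1$, put $\psi(\xi)=\Phi(\xi)-\Phi(2\xi)$, $P_{\le 0}f=\mathscr F^{-1}\Phi\,\mathscr F f$, $\triangle_kf=\mathscr F^{-1}\psi(2^{-k}\cdot)\mathscr F f$, and let $B^s_{p,2}$ be the space of tempered distributions $f$ with $$\|f\|_{B^s_{p,2}}=\Big(\|P_{\le 0}f\|_{L^p}^2+\sum_{k=1}^\infty 2^{2ks}\|\triangle_kf\|_{L^p}^2\Big)^{1/2}<\infty .$$ Let $H^s=(I-\Delta)^{-s/2}L^2(\mathbb R^n)$. For $\phi:(0,\infty)\to\mathbb R$ smooth put $$U(t)=e^{it\phi(\sqrt{-\Delta})}=\mathscr F^{-1}e^{it\phi(|\xi|)}\mathscr F,\qquad \mathcal A f(t)=\int_0^tU(t-\tau)f(\tau)\,d\tau .$$ For real numbers $\theta_1\le\theta_2$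 put $k(t)=|t|^{-\theta_1}$ if $|t|\le 1$ and $k(t)=|t|^{-\theta_2}$ if $|t|>1$, and let $E(\theta_1,\theta_2)$ be the set of all $q$ such that one of the following holds: (a) $0<\theta_1=\theta_2<1$ and $q=2/\theta_1$; (b) $\theta_1<\theta_2$, $0<\theta_1<1$ and $q=2/\theta_1$; (c) $\theta_1<\theta_2$, $0<\theta_2<1$ and $q=2/\theta_2$; (d) $\theta_1<\theta_2$, $2\le q\le\infty$ and $\theta_1<2/q<\theta_2$. Let $2\le p\le\infty$, $1/p+1/p'=1$, $\alpha\in\mathbb R$, $\theta_1\le\theta_2$, $K>0$, and suppose that $$\|U(t)f\|_{B^\alpha_{p,2}}\le K\,k(t)\,\|f\|_{B^0_{p',2}}\qquad\text{for all } t\ne 0 \text{ and all } f\in B^0_{p',2}.$$ Let $q\in E(\theta_1,\theta_2)$, $1/q+1/q'=1$, $\eta\in\mathbb R$. Then there is a constant $C>0$, depending only on $n,\Phi,p,\alpha,\theta_1,\theta_2,K,q,\eta$ (in particular not on $T$), such that for every $T>0$: $$\|U(t)h\|_{L^q(-T,T;B^{\eta+\alpha/2}_{p,2})}\le C\|h\|_{H^\eta}\qquad\text{for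 all } h\in H^\eta,$$ $$\|\mathcal Af\|_{L^q(-T,T;B^{\eta+\alpha}_{p,2})}\le C\|f\|_{L^{q'}(-T,T;B^\eta_{p',2})}\quad\text{and}\quad \|\mathcal Af\|_{L^\infty(-T,T;H^{\eta+\alpha/2})}\le C\|f\|_{L^{q'}(-T,T;B^\eta_{p',2})}$$ for all $f\in L^{q'}(-T,T;B^\eta_{p',2})$, and $$\|\mathcal Af\|_{L^q(-T,T;B^{\eta+\alpha/2}_{p,2})}\le C\|f\|_{L^1(-T,T;H^\eta)}\qquad\text{for all } f\in L^1(-T,T;H^\eta).$$ Here the integral that defines $\mathcal Af(t)$, $t\in(-T,T)$, exists as an integral in the space of tempered distributions. -/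

import Mathlib

open MeasureTheory Set Filter Topology
open scoped ENNReal NNReal SchwartzMap FourierTransform ContDiff

noncomputable section

namespace AbstractStrichartz

/-- The space `ℝⁿ` with its Euclidean norm. -/
abbrev Rn (n : ℕ) : Type := EuclideanSpace ℝ (Fin n)

/-! ### Function spaces on `ℝⁿ` -/

/-- The `L^p` norm of a tempered distribution: the `L^p` norm of the function that represents it
(unique up to null sets), and `∞` if no function in `L^p` represents it. -/
def distLpNorm {n : ℕ} (p : ℝ≥0∞) (f : 𝓢'(Rn n, ℂ)) : ℝ≥0∞ :=
  ⨅ (g : Rn n → ℂ) (_ : MemLp g p volume)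
    (_ : ∀ χ : 𝓢(Rn n, ℂ), f χ = ∫ x, χ x * g x), eLpNorm g p volume

/-- The operator `ℱ⁻¹ m(ξ) ℱ`, where `ξ` is the frequency variable for which `√(-Δ)` has the
symbol `|ξ|`. Mathlib's Fourier transform has the kernel `exp(-2πi⟨x, ξ⟩)`, hence the `2π`. -/
def freqMultiplier {n : ℕ} (m : Rn n → ℂ) (f : 𝓢'(Rn n, ℂ)) : 𝓢'(Rn n, ℂ) :=
  TemperedDistribution.fourierMultiplierCLM ℂ (fun ξ => m ((2 * Real.pi) • ξ)) f

/-- The cutoffs from which a Littlewood-Paley decomposition is built: smooth radial functions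
with values in `[0, 1]`, supported in `|ξ| ≤ 2` and equal to `1` for `|ξ| ≤ 1`. -/
structure IsCutoff {n : ℕ} (Φ : Rn n → ℝ) : Prop where
  smooth : ContDiff ℝ ∞ Φ
  mem_Icc : ∀ ξ, Φ ξ ∈ Icc (0 : ℝ) 1
  radial : ∀ ξ ζ, ‖ξ‖ = ‖ζ‖ → Φ ξ = Φ ζ
  support_subset : tsupport Φ ⊆ Metric.closedBall 0 2
  eq_one : ∀ ξ, ‖ξ‖ ≤ 1 → Φ ξ = 1

/-- The low frequency projector `P_{≤ 0}`. -/
def lowProj {n : ℕ} (Φ : Rn n → ℝ) (f : 𝓢'(Rn n, ℂ)) : 𝓢'(Rn n, ℂ) :=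
  freqMultiplier (fun ξ => (Φ ξ : ℂ)) f

/-- The Littlewood-Paley projector `Δ_k`, with symbol `ψ(2^{-k} ξ)`, `ψ(ξ) = Φ(ξ) - Φ(2ξ)`. -/
def dyadicProj {n : ℕ} (Φ : Rn n → ℝ) (k : ℕ) (f : 𝓢'(Rn n, ℂ)) : 𝓢'(Rn n, ℂ) :=
  freqMultiplier (fun ξ => ((Φ (((2 : ℝ) ^ k)⁻¹ • ξ) -
    Φ ((2 : ℝ) • (((2 : ℝ) ^ k)⁻¹ • ξ)) : ℝ) : ℂ)) f

/-- The norm of the inhomogeneous Besov space `B^s_{p,2}` (with value `∞` outside the space):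
`(‖P_{≤0} f‖_p² + ∑_{k ≥ 1} 2^{2ks} ‖Δ_k f‖_p²)^{1/2}`. -/
def besovNorm {n : ℕ} (Φ : Rn n → ℝ) (s : ℝ) (p : ℝ≥0∞) (f : 𝓢'(Rn n, ℂ)) : ℝ≥0∞ :=
  (distLpNorm p (lowProj Φ f) ^ 2 +
    ∑' k : ℕ, ENNReal.ofReal ((2 : ℝ) ^ (2 * ((k : ℝ) + 1) * s)) *
      distLpNorm p (dyadicProj Φ (k + 1) f) ^ 2) ^ (1 / 2 : ℝ)

/-- The norm of `H^s = (I - Δ)^{-s/2} L²` (with value `∞` outside the space). -/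
def sobolevNorm {n : ℕ} (s : ℝ) (f : 𝓢'(Rn n, ℂ)) : ℝ≥0∞ :=
  distLpNorm 2 (freqMultiplier (fun ξ => (((1 + ‖ξ‖ ^ 2) ^ (s / 2) : ℝ) : ℂ)) f)

/-! ### Space-time norms

A subspace `X` of the tempered distributions is given by its extended norm `N`, which is finite
exactly on `X`. -/

/-- `u` is strongly (Bochner) measurable on `(-T, T)` with values in `X`: it is almost everywhere
the limit, in the norm of `X`, of a sequence of `X`-valued simple functions. -/
def StronglyMeas {n : ℕ} (T : ℝ) (N : 𝓢'(Rn n, ℂ) → ℝ≥0∞) (u : ℝ → 𝓢'(Rn n, ℂ)) : Prop :=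
  ∃ s : ℕ → SimpleFunc ℝ (𝓢'(Rn n, ℂ)), (∀ j t, N (s j t) < ⊤) ∧
    ∀ᵐ t ∂(volume.restrict (Ioo (-T) T)), Tendsto (fun j => N (s j t - u t)) atTop (𝓝 0)

/-- The norm of `L^q(-T, T; X)`. It is `∞` if `u` is not strongly measurable with values
in `X`. -/
def spaceTimeNorm {n : ℕ} (q : ℝ≥0∞) (T : ℝ) (N : 𝓢'(Rn n, ℂ) → ℝ≥0∞)
    (u : ℝ → 𝓢'(Rn n, ℂ)) : ℝ≥0∞ :=
  ⨅ _ : StronglyMeas T N u, eLpNorm (fun t => N (u t)) q (volume.restrict (Ioo (-T) T))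

/-! ### The propagator `U(t) = exp(it φ(√(-Δ)))` and the Duhamel operator -/

/-- The Fourier transform of the tempered distribution `f` is the function `g`. -/
def HasFourierDensity {n : ℕ} (f : 𝓢'(Rn n, ℂ)) (g : Rn n → ℂ) : Prop :=
  ∀ χ : 𝓢(Rn n, ℂ), Integrable (fun ξ => χ ξ * g ξ) volume ∧ (𝓕 f) χ = ∫ ξ, χ ξ * g ξ

/-- `v = ℱ⁻¹ exp(it φ(|ξ|)) ℱ f`, for an `f` whose Fourier transform is a function. -/
def IsPropagated {n : ℕ} (φ : ℝ → ℝ) (t : ℝ) (f v : 𝓢'(Rn n, ℂ)) : Prop :=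
  ∃ g : Rn n → ℂ, HasFourierDensity f g ∧
    HasFourierDensity v
      (fun ξ => Complex.exp (Complex.I * (t * φ (2 * Real.pi * ‖ξ‖) : ℝ)) * g ξ)

open Classical in
/-- `U(t) f = ℱ⁻¹ exp(it φ(|ξ|)) ℱ f`. The symbol need not be smooth at the origin or at infinity,
so this is not defined for every tempered distribution; it is defined if the Fourier transform of
`f` is a function of moderate growth, in particular for `f ∈ H^s` and, as `B^s_{r,2}` embeds into
a Sobolev space `H^σ` for `1 ≤ r ≤ 2`, for `f ∈ B^s_{r,2}` with these `r`. (The value `0` on the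
remaining distributions plays no role.) -/
def propagator {n : ℕ} (φ : ℝ → ℝ) (t : ℝ) (f : 𝓢'(Rn n, ℂ)) : 𝓢'(Rn n, ℂ) :=
  if h : ∃ v, IsPropagated φ t f v then h.choose else 0

/-- `u(t) = (𝒜 f)(t) = ∫₀ᵗ U(t - τ) f(τ) dτ` for `t ∈ (-T, T)`, the integral being an integral in
the space of tempered distributions. On `(-T, T)` this determines `u`. -/
def IsDuhamel {n : ℕ} (φ : ℝ → ℝ) (T : ℝ) (f u : ℝ → 𝓢'(Rn n, ℂ)) : Prop :=
  ∀ t ∈ Ioo (-T) T, ∀ χ : 𝓢(Rn n, ℂ),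
    IntervalIntegrable (fun τ => propagator φ (t - τ) (f τ) χ) volume 0 t ∧
      u t χ = ∫ τ in (0 : ℝ)..t, propagator φ (t - τ) (f τ) χ

/-! ### The decay rate and the admissible exponents -/

/-- `k(t) = |t|^{-θ₁}` for `|t| ≤ 1` and `|t|^{-θ₂}` for `|t| > 1`. -/
def decayRate (θ₁ θ₂ : ℝ) (t : ℝ) : ℝ :=
  if |t| ≤ 1 then |t| ^ (-θ₁) else |t| ^ (-θ₂)

/-- `q ∈ E(θ₁, θ₂)`. -/
def InE (θ₁ θ₂ : ℝ) (q : ℝ≥0∞) : Prop :=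
  (0 < θ₁ ∧ θ₁ = θ₂ ∧ θ₂ < 1 ∧ q = ENNReal.ofReal (2 / θ₁)) ∨
  (θ₁ < θ₂ ∧ 0 < θ₁ ∧ θ₁ < 1 ∧ q = ENNReal.ofReal (2 / θ₁)) ∨
  (θ₁ < θ₂ ∧ 0 < θ₂ ∧ θ₂ < 1 ∧ q = ENNReal.ofReal (2 / θ₂)) ∨
  (θ₁ < θ₂ ∧ 2 ≤ q ∧ θ₁ < (2 / q).toReal ∧ (2 / q).toReal < θ₂)

/-- The decay estimate `‖U(t) f‖_{B^α_{p,2}} ≤ K k(t) ‖f‖_{B^0_{p',2}}` for all `t ≠ 0` and all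
`f ∈ B^0_{p',2}`. -/
def DecayEstimate {n : ℕ} (Φ : Rn n → ℝ) (φ : ℝ → ℝ) (p p' : ℝ≥0∞) (α θ₁ θ₂ K : ℝ) : Prop :=
  ∀ t : ℝ, t ≠ 0 → ∀ f : 𝓢'(Rn n, ℂ), besovNorm Φ 0 p' f < ⊤ →
    besovNorm Φ α p (propagator φ t f) ≤
      ENNReal.ofReal (K * decayRate θ₁ θ₂ t) * besovNorm Φ 0 p' f

end AbstractStrichartz

end

/-! The proof is the `TT*` method, run on one Littlewood-Paley block at a time, with bounds whose
dependence on the block allows the blocks to be summed.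

Since `U(t)` commutes with the projectors, the decay hypothesis tested on data in the single block
`k` bounds `U(t)` from `L^{p'}` to `L^p` on that block, with norm at most a constant times `2^{-kα}
k(t)` (`exists_lpn_prop_le`). For `q ∈ E(θ₁, θ₂)` the form `∬ f(s) g(t) k(t - s) ds dt` is bounded
on `L^{q'} × L^{q'}` (`exists_lintegral_decayRate_le`): the kernel is bounded if `q = ∞`, integrable
if `q = 2`, and otherwise dominated by `|t|^{-2/q}`, where the Hardy-Littlewood-Sobolev inequality
applies.

The two facts meet in `‖∫ U(-s) F(s) ds‖² = ∬ ⟨F(t), U(t - s) F(s)⟩ ds dt`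
(`enorm_integral_prop_sq_le`). By duality this gives the homogeneous estimate
(`eLpNorm_lpn_prop_le`); the square root explains the gain `α/2`. Applied to a forcing cut off to
`[0, t]` it gives the energy bound (`enorm_duhamel_sq_le`). The `L^q` bound for the Duhamel integral
uses no cancellation: norms are taken inside, the interval is enlarged to the line, and the positive
form does the rest (`eLpNorm_lpn_duhamel_le`). A forcing in `L¹(H^η)` produces a superposition of
free evolutions (`eLpNorm_lpn_duhamel_le_lintegral`). As `q' ≤ 2 ≤ q`, Minkowski's inequality
exchanges `ℓ²` over the blocks with the time norms in the directions needed
(`eLpNorm_sqrt_tsum_sq_le`, `tsum_eLpNorm_sq_le`). The forcing is extended by zero and time runs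
over the whole line, so no constant sees `T`.

The remaining work makes these norms meaningful. Every distribution that occurs is written as `ofL2
n s a` with `a ∈ L²`; the dual Besov space embeds into such a Sobolev space
(`exists_ofL2_of_besovNorm_lt_top`), so the Duhamel integral is a Bochner integral in `L²`. The
`L^p` norms are reached only through `L²` pairings (`lpn_le_of_forall_inner_le`), which includes `p
= ∞`. Strong measurability in Besov spaces comes from a countable approximating family
(`exists_seq_besovNorm_sub_le`). -/

noncomputable section

namespace AbstractStrichartz

/-! ### Hölder's inequality and its converse for nonnegative functions -/

section Scalar

variable {α : Type*} [MeasurableSpace α] {μ : Measure α}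

theorem toReal_holderConjugate (p p' : ℝ≥0∞) [hpp : p.HolderConjugate p'] (h1 : p ≠ 1)
    (ht : p ≠ ⊤) : p.toReal.HolderConjugate p'.toReal ∧ p' ≠ 1 ∧ p' ≠ ⊤ := by
  have hp'1 : p' ≠ 1 := by
    rintro rfl
    exact ht (ENNReal.HolderConjugate.unique 1 p ⊤)
  have hp't : p' ≠ ⊤ := by
    rintro rfl
    exact h1 (ENNReal.HolderConjugate.unique ⊤ p 1)
  have e1 : 1 ≤ p := ENNReal.HolderTriple.le p p' 1
  have e2 : 1 ≤ p' := ENNReal.HolderTriple.le p' p 1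
  have h := (ENNReal.HolderTriple.toReal_iff (p := p) (q := p') (r := 1)
    (ENNReal.toReal_pos (by positivity) ht) (ENNReal.toReal_pos (by positivity) hp't)).2 hpp
  exact ⟨by simpa using h, hp'1, hp't⟩

theorem lintegral_mul_le_eLpNorm_mul_eLpNorm (p p' : ℝ≥0∞) [hpp : p.HolderConjugate p']
    {f g : α → ℝ≥0∞} (hf : AEMeasurable f μ) (hg : AEMeasurable g μ) :
    ∫⁻ x, f x * g x ∂μ ≤ eLpNorm f p μ * eLpNorm g p' μ := by
  -- Both endpoint pairs reduce to this bound, one of them after exchanging the factors.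
  have key : ∀ {f g : α → ℝ≥0∞}, AEMeasurable f μ →
      ∫⁻ x, f x * g x ∂μ ≤ eLpNorm f 1 μ * eLpNorm g ⊤ μ := by
    intro f g hf
    rw [eLpNorm_one_eq_lintegral_enorm, eLpNorm_exponent_top]
    simp only [enorm_eq_self]
    rw [← lintegral_mul_const'' _ hf]
    apply lintegral_mono_ae
    filter_upwards [enorm_ae_le_eLpNormEssSup g μ] with x hx
    gcongr
    simpa using hx
  rcases eq_or_ne p 1 with rfl | hp1
  · have : p' = ⊤ := (ENNReal.HolderConjugate.unique 1 p' ⊤)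
    subst this
    exact key hf
  rcases eq_or_ne p ⊤ with rfl | hpt
  · have : p' = 1 := (ENNReal.HolderConjugate.unique ⊤ p' 1)
    subst this
    simp_rw [mul_comm (f _)]
    rw [mul_comm]
    exact key hg
  obtain ⟨hr, hp'1, hp't⟩ := toReal_holderConjugate p p' hp1 hpt
  have h1 : 1 ≤ p := ENNReal.HolderTriple.le p p' 1
  have h2 : 1 ≤ p' := ENNReal.HolderTriple.le p' p 1
  rw [eLpNorm_eq_lintegral_rpow_enorm_toReal (by positivity) hpt,
    eLpNorm_eq_lintegral_rpow_enorm_toReal (by positivity) hp't]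
  simpa using ENNReal.lintegral_mul_le_Lp_mul_Lq μ hr hf hg

/-- Converse of Hölder's inequality, without assuming the norm finite. For `p = ∞` the testers are
indicators of pieces of `{f > M}`; for `p < ∞` they are the Hölder extremizers of truncations of
`f`. Testers that are bounded with support of finite measure suffice, and later these can be turned
into elements of `L²` or into integrable functions of time. -/
theorem eLpNorm_le_of_forall_lintegral_mul_le [SigmaFinite μ] (p p' : ℝ≥0∞)
    [hpp : p.HolderConjugate p'] {f : α → ℝ≥0∞} (hf : Measurable f) (M : ℝ≥0∞)
    (h : ∀ w : α → ℝ≥0∞, Measurable w → (∃ R : ℝ≥0, ∀ x, w x ≤ R) → μ (Function.support w) < ⊤ →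
      ∫⁻ x, f x * w x ∂μ ≤ M * eLpNorm w p' μ) :
    eLpNorm f p μ ≤ M := by
  rcases eq_or_ne M ⊤ with rfl | hM
  · exact le_top
  have hSm := measurableSet_spanningSets μ
  have hSf := measure_spanningSets_lt_top μ
  rcases eq_or_ne p ⊤ with rfl | hpt
  · have : p' = 1 := (ENNReal.HolderConjugate.unique ⊤ p' 1)
    subst this
    rw [eLpNorm_exponent_top]
    apply eLpNormEssSup_le_of_ae_enorm_bound
    simp only [enorm_eq_self]
    have hA : MeasurableSet {x | M < f x} := measurableSet_lt measurable_const hf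
    have : μ {x | M < f x} = 0 := by
      refine (Measure.forall_measure_inter_isCountablySpanning_eq_zero
        (isCountablySpanning_spanningSets μ)).1 ?_
      rintro _ ⟨n, rfl⟩
      by_contra hne
      set A := {x | M < f x} ∩ spanningSets μ n
      have hAm : MeasurableSet A := hA.inter (hSm n)
      have hAf : μ A < ⊤ := (measure_mono inter_subset_right).trans_lt (hSf n)
      have h1 := h (A.indicator 1) (measurable_one.indicator hAm)
        ⟨1, fun x => by by_cases hx : x ∈ A <;> simp [hx]⟩
        ((measure_mono (by simp)).trans_lt hAf)
      have h2 : ∫⁻ x, f x * A.indicator 1 x ∂μ = ∫⁻ x in A, f x ∂μ := by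
        rw [← lintegral_indicator hAm]
        congr 1 with x
        by_cases hx : x ∈ A <;> simp [hx]
      have h3 : eLpNorm (A.indicator (1 : α → ℝ≥0∞)) 1 μ = μ A := by
        rw [eLpNorm_one_eq_lintegral_enorm]
        simp [lintegral_indicator_one hAm]
      rw [h2, h3] at h1
      have h4 : ∫⁻ x in A, M ∂μ < ∫⁻ x in A, f x ∂μ := by
        refine setLIntegral_strict_mono hAm hne hf ?_ ?_
        · simpa using ENNReal.mul_ne_top hM hAf.ne
        · exact ae_of_all _ fun x hx => hx.1
      simp only [lintegral_const, Measure.restrict_apply, MeasurableSet.univ, univ_inter] at h4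
      exact absurd h1 (not_le.2 h4)
    filter_upwards [measure_eq_zero_iff_ae_notMem.1 this] with x hx
    simpa using hx
  have hp1 : 1 ≤ p := ENNReal.HolderTriple.le p p' 1
  have hp0 : p ≠ 0 := by positivity
  set r := p.toReal
  have hr1 : 1 ≤ r := by
    rw [← ENNReal.toReal_one]; exact ENNReal.toReal_mono hpt hp1
  -- Truncation in height and in support makes the integral of `fn n ^ r` finite, so that powers of
  -- it can be cancelled.
  let fn : ℕ → α → ℝ≥0∞ := fun n => (spanningSets μ n).indicator fun x => min (f x) n
  have hfnm : ∀ n, Measurable (fn n) := fun n =>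
    (hf.min measurable_const).indicator (hSm n)
  have hfn_le : ∀ n x, fn n x ≤ f x := fun n x => by
    by_cases hx : x ∈ spanningSets μ n <;> simp [fn, hx]
  have hfn_n : ∀ n x, fn n x ≤ n := fun n x => by
    by_cases hx : x ∈ spanningSets μ n <;> simp [fn, hx]
  have hmono : ∀ x, Monotone fun n => fn n x := by
    intro x m n hmn
    by_cases hx : x ∈ spanningSets μ m
    · have hx' := monotone_spanningSets μ hmn hx
      simp only [fn, hx, hx', indicator_of_mem]
      gcongr
    · simp [fn, hx]
  have hlim : ∀ x, Tendsto (fun n => fn n x) atTop (𝓝 (f x)) := by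
    intro x
    have : Tendsto (fun n : ℕ => min (f x) n) atTop (𝓝 (min (f x) ⊤)) :=
      tendsto_const_nhds.min ENNReal.tendsto_nat_nhds_top
    rw [min_top_right] at this
    refine this.congr' ?_
    filter_upwards [eventually_mem_spanningSets μ x] with n hn
    simp [fn, hn]
  have hI : ∀ n, ∫⁻ x, fn n x ^ r ∂μ < ⊤ := by
    intro n
    have : ∀ x, fn n x ^ r ≤ (spanningSets μ n).indicator (fun _ => (n : ℝ≥0∞) ^ r) x := by
      intro x
      by_cases hx : x ∈ spanningSets μ n
      · simp only [hx, indicator_of_mem]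
        exact ENNReal.rpow_le_rpow (hfn_n n x) (by linarith)
      · simp [fn, hx, ENNReal.zero_rpow_of_pos (by linarith : 0 < r)]
    refine (lintegral_mono this).trans_lt ?_
    rw [lintegral_indicator_const (hSm n)]
    exact ENNReal.mul_lt_top (ENNReal.rpow_lt_top_of_nonneg (by linarith) (by simp)) (hSf n)
  have hbd : ∀ n, (∫⁻ x, fn n x ^ r ∂μ) ≤ M ^ r := by
    intro n
    -- The indicator is needed for `r = 1`, where `0 ^ 0 = 1` would destroy the support condition.
    set w : α → ℝ≥0∞ := (spanningSets μ n).indicator fun x => fn n x ^ (r - 1) with hw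
    have hwm : Measurable w := ((hfnm n).pow_const _).indicator (hSm n)
    have hwb : ∀ x, w x ≤ ((n : ℝ≥0) ^ (r - 1) : ℝ≥0) := by
      intro x
      by_cases hx : x ∈ spanningSets μ n
      · simp only [hw, hx, indicator_of_mem]
        rw [ENNReal.coe_rpow_of_nonneg _ (by linarith)]
        exact ENNReal.rpow_le_rpow (by simpa using hfn_n n x) (by linarith)
      · simp [hw, hx]
    have h1 := h w hwm ⟨_, hwb⟩ ((measure_mono support_indicator_subset).trans_lt (hSf n))
    have h2 : ∫⁻ x, fn n x ^ r ∂μ ≤ ∫⁻ x, f x * w x ∂μ := by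
      apply lintegral_mono
      intro x
      by_cases hx : x ∈ spanningSets μ n
      · simp only [hw, hx, indicator_of_mem]
        calc fn n x ^ r = fn n x ^ (1 + (r - 1)) := by ring_nf
          _ = fn n x * fn n x ^ (r - 1) := by
            rw [ENNReal.rpow_add_of_nonneg _ _ zero_le_one (by linarith), ENNReal.rpow_one]
          _ ≤ _ := by gcongr; exact hfn_le n x
      · simp [fn, hx, ENNReal.zero_rpow_of_pos (by linarith : 0 < r)]
    rcases eq_or_ne p 1 with rfl | hp1'
    · have : p' = ⊤ := (ENNReal.HolderConjugate.unique 1 p' ⊤)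
      subst this
      have hr : r = 1 := by simp [r]
      refine (h2.trans h1).trans ?_
      rw [hr, ENNReal.rpow_one]
      calc M * eLpNorm w ⊤ μ ≤ M * 1 := by
            gcongr
            rw [eLpNorm_exponent_top]
            refine eLpNormEssSup_le_of_ae_enorm_bound (ae_of_all _ fun x => ?_)
            have := hwb x
            rw [hr] at this
            simpa using this
        _ = M := mul_one _
    obtain ⟨hrr, hp'1, hp't⟩ := toReal_holderConjugate p p' hp1' hpt
    have hp'1 : 1 ≤ p' := ENNReal.HolderTriple.le p' p 1
    set r' := p'.toReal
    have h3 : eLpNorm w p' μ = (∫⁻ x, fn n x ^ r ∂μ) ^ (1 / r') := by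
      rw [eLpNorm_eq_lintegral_rpow_enorm_toReal (by positivity) hp't]
      congr 1
      apply lintegral_congr
      intro x
      by_cases hx : x ∈ spanningSets μ n
      · simp only [hw, hx, indicator_of_mem, enorm_eq_self]
        rw [← ENNReal.rpow_mul, hrr.sub_one_mul_conj]
      · simp only [hw, hx, fn, not_false_eq_true, indicator_of_notMem, enorm_zero]
        rw [ENNReal.zero_rpow_of_pos hrr.symm.pos, ENNReal.zero_rpow_of_pos hrr.pos]
    set I := ∫⁻ x, fn n x ^ r ∂μ
    have h4 : I ≤ M * I ^ (1 / r') := by rw [← h3]; exact h2.trans h1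
    rcases eq_or_ne I 0 with h0 | h0
    · rw [h0]; exact zero_le
    have h5 : I = I ^ (1 / r) * I ^ (1 / r') := by
      rw [← ENNReal.rpow_add _ _ h0 (hI n).ne]
      rw [one_div, one_div, hrr.inv_add_inv_eq_one, ENNReal.rpow_one]
    have h6 : I ^ (1 / r) ≤ M := by
      have h7 : I ^ (1 / r') ≠ 0 := (ENNReal.rpow_pos (pos_iff_ne_zero.2 h0) (hI n).ne).ne'
      have h8 : I ^ (1 / r') ≠ ⊤ :=
        ENNReal.rpow_ne_top_of_nonneg (by have := hrr.symm.pos; positivity) (hI n).ne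
      exact (ENNReal.mul_le_mul_iff_left h7 h8).1 (h5 ▸ h4)
    calc I = (I ^ (1 / r)) ^ r := by
          rw [← ENNReal.rpow_mul, one_div, inv_mul_cancel₀ hrr.ne_zero, ENNReal.rpow_one]
      _ ≤ M ^ r := ENNReal.rpow_le_rpow h6 hrr.nonneg
  have hlimI := lintegral_tendsto_of_tendsto_of_monotone (μ := μ)
    (f := fun n x => fn n x ^ r) (F := fun x => f x ^ r)
    (fun n => ((hfnm n).pow_const r).aemeasurable)
    (ae_of_all _ fun x m n hmn => ENNReal.rpow_le_rpow (hmono x hmn) (by linarith))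
    (ae_of_all _ fun x => ((ENNReal.continuous_rpow_const).tendsto _).comp (hlim x))
  have := le_of_tendsto' hlimI hbd
  rw [eLpNorm_eq_lintegral_rpow_enorm_toReal hp0 hpt]
  simp only [enorm_eq_self]
  rw [one_div, ENNReal.rpow_inv_le_iff (by linarith)]
  exact this

end Scalar

/-! ### Minkowski's inequality between `ℓ²` and `L^q`, and measurable selection -/

section Scalar

variable {α : Type*} [MeasurableSpace α] {μ : Measure α}

/-- Interpolation in its crudest form: `|f|^p ≤ |f|^r ‖f‖_∞^{p-r}`, after which both norms are
replaced by their sum. -/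
theorem eLpNorm_le_add_eLpNorm_top {E : Type*} [NormedAddCommGroup E] (f : α → E) {p r : ℝ≥0∞}
    (hr : 1 ≤ r) (hrp : r ≤ p) :
    eLpNorm f p μ ≤ eLpNorm f r μ + eLpNorm f ⊤ μ := by
  rcases eq_or_ne p ⊤ with rfl | hpt
  · exact le_add_self
  have hrt : r ≠ ⊤ := ne_top_of_le_ne_top hpt hrp
  rcases eq_or_ne (eLpNorm f ⊤ μ) ⊤ with hS | hS
  · simp [hS]
  have hr0 : r ≠ 0 := by positivity
  have hp0 : p ≠ 0 := (lt_of_lt_of_le (pos_iff_ne_zero.2 hr0) hrp).ne'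
  have hr1 : 0 < r.toReal := ENNReal.toReal_pos hr0 hrt
  have hrp' : r.toReal ≤ p.toReal := ENNReal.toReal_mono hpt hrp
  set S := eLpNorm f ⊤ μ
  have hS' : ∀ᵐ x ∂μ, ‖f x‖ₑ ≤ S := by
    simpa [S, eLpNorm_exponent_top] using enorm_ae_le_eLpNormEssSup f μ
  have h1 : ∫⁻ x, ‖f x‖ₑ ^ p.toReal ∂μ ≤
      (∫⁻ x, ‖f x‖ₑ ^ r.toReal ∂μ) * S ^ (p.toReal - r.toReal) := by
    rw [← lintegral_mul_const' _ _
      (ENNReal.rpow_ne_top_of_nonneg (by linarith) hS)]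
    apply lintegral_mono_ae
    filter_upwards [hS'] with x hx
    calc ‖f x‖ₑ ^ p.toReal = ‖f x‖ₑ ^ (r.toReal + (p.toReal - r.toReal)) := by ring_nf
      _ = ‖f x‖ₑ ^ r.toReal * ‖f x‖ₑ ^ (p.toReal - r.toReal) :=
        ENNReal.rpow_add_of_nonneg _ _ hr1.le (by linarith)
      _ ≤ _ := by gcongr
  set N := eLpNorm f r μ with hN
  have h2 : ∫⁻ x, ‖f x‖ₑ ^ r.toReal ∂μ = N ^ r.toReal := by
    rw [hN, eLpNorm_eq_lintegral_rpow_enorm_toReal hr0 hrt, ← ENNReal.rpow_mul,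
      one_div, inv_mul_cancel₀ hr1.ne', ENNReal.rpow_one]
  rw [eLpNorm_eq_lintegral_rpow_enorm_toReal hp0 hpt, one_div,
    ENNReal.rpow_inv_le_iff (by linarith)]
  refine h1.trans ?_
  rw [h2]
  calc N ^ r.toReal * S ^ (p.toReal - r.toReal)
      ≤ (N + S) ^ r.toReal * (N + S) ^ (p.toReal - r.toReal) := by
        refine mul_le_mul' (ENNReal.rpow_le_rpow le_self_add hr1.le)
          (ENNReal.rpow_le_rpow le_add_self (by linarith))
    _ = (N + S) ^ p.toReal := by
        rw [← ENNReal.rpow_add_of_nonneg _ _ hr1.le (by linarith)]; ring_nf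

/-- Minkowski's inequality between `ℓ²` and `L^q`, `q ≥ 2`. -/
theorem eLpNorm_sqrt_tsum_sq_le [SigmaFinite μ] {q : ℝ≥0∞} (hq : 2 ≤ q) {b : ℕ → α → ℝ≥0∞}
    (hb : ∀ k, Measurable (b k)) :
    eLpNorm (fun t => (∑' k, b k t ^ 2) ^ (1 / 2 : ℝ)) q μ ^ 2 ≤
      ∑' k, eLpNorm (b k) q μ ^ 2 := by
  -- Squaring turns the claim into the triangle inequality for series in `L^{q/2}`, where `q / 2 ≥
  -- 1`. Against a tester, sum and integral can be exchanged.
  have e : ∀ f : α → ℝ≥0∞, eLpNorm (fun x => f x ^ 2) (q / 2) μ = eLpNorm f q μ ^ 2 := by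
    intro f
    have h := eLpNorm_enorm_rpow (μ := μ) (p := q / 2) f (q := 2) two_pos
    simp only [enorm_eq_self, ENNReal.ofReal_ofNat] at h
    rw [ENNReal.div_mul_cancel (by simp) (by simp)] at h
    simpa [ENNReal.rpow_two] using h
  rw [← e]
  have e2 : ∀ x : ℝ≥0∞, (x ^ (1 / 2 : ℝ)) ^ 2 = x := by
    intro x
    rw [← ENNReal.rpow_two, ← ENNReal.rpow_mul]; norm_num
  simp only [e2, ← e]
  have hq1 : 1 ≤ q / 2 := by
    rw [ENNReal.le_div_iff_mul_le (by simp) (by simp)]; simpa using hq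
  have := ENNReal.HolderConjugate.inv_one_sub_inv' hq1
  refine eLpNorm_le_of_forall_lintegral_mul_le (q / 2) (1 - (q / 2)⁻¹)⁻¹
    (Measurable.tsum fun k => (hb k).pow_const 2) _ ?_
  intro w hw _ _
  simp_rw [← ENNReal.tsum_mul_right]
  rw [lintegral_tsum fun k => by have := hb k; fun_prop]
  exact ENNReal.tsum_le_tsum fun k =>
    lintegral_mul_le_eLpNorm_mul_eLpNorm _ _ ((hb k).pow_const 2).aemeasurable hw.aemeasurable

/-- Minkowski's inequality between `ℓ^r` and `L¹`. -/
theorem tsum_lintegral_rpow_le {r : ℝ} (hr : 1 ≤ r) {c : ℕ → α → ℝ≥0∞}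
    (hc : ∀ k, AEMeasurable (c k) μ) :
    (∑' k, (∫⁻ x, c k x ∂μ) ^ r) ^ (1 / r) ≤ ∫⁻ x, (∑' k, c k x ^ r) ^ (1 / r) ∂μ := by
  have hr0 : 0 < r := by linarith
  rcases eq_or_lt_of_le hr with rfl | hr1
  · simp [lintegral_tsum hc]
  set F := ∫⁻ x, (∑' k, c k x ^ r) ^ (1 / r) ∂μ
  have hcF : ∀ k, ∫⁻ x, c k x ∂μ ≤ F := fun k => by
    apply lintegral_mono
    intro x
    calc c k x = (c k x ^ r) ^ (1 / r) := by
          rw [← ENNReal.rpow_mul, mul_one_div_cancel hr0.ne', ENNReal.rpow_one]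
      _ ≤ _ := ENNReal.rpow_le_rpow (ENNReal.le_tsum k) (by positivity)
  rcases eq_or_ne F ⊤ with hF | hF
  · rw [hF]; exact le_top
  rw [one_div, ENNReal.rpow_inv_le_iff hr0, ENNReal.tsum_eq_iSup_sum]
  -- For a finite partial sum, `S` is finite and its powers can be cancelled at the end.
  refine iSup_le fun s => ?_
  set β : ℕ → ℝ≥0∞ := fun k => ∫⁻ x, c k x ∂μ
  have hβ : ∀ k, β k ≠ ⊤ := fun k => ne_top_of_le_ne_top hF (hcF k)
  set S := ∑ k ∈ s, β k ^ r
  have hconj := Real.HolderConjugate.conjExponent hr1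
  set r' := r.conjExponent
  -- The sequence `β` is paired with its own extremizer `β ^ (r - 1)`, and Hölder's inequality in
  -- `k` is used under the integral.
  have hS : S ≤ S ^ (1 / r') * F := by
    calc S = ∑ k ∈ s, ∫⁻ x, β k ^ (r - 1) * c k x ∂μ := by
          refine Finset.sum_congr rfl fun k _ => ?_
          rw [lintegral_const_mul'' _ (hc k)]
          calc β k ^ r = β k ^ ((r - 1) + 1) := by ring_nf
            _ = _ := by rw [ENNReal.rpow_add_of_nonneg _ _ (by linarith) zero_le_one,
                          ENNReal.rpow_one]
      _ = ∫⁻ x, ∑ k ∈ s, β k ^ (r - 1) * c k x ∂μ :=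
          (lintegral_finsetSum' _ fun k _ => (hc k).const_mul _).symm
      _ ≤ ∫⁻ x, S ^ (1 / r') * (∑' k, c k x ^ r) ^ (1 / r) ∂μ := by
          apply lintegral_mono
          intro x
          refine (ENNReal.inner_le_Lp_mul_Lq s _ _ hconj.symm).trans ?_
          refine mul_le_mul' (ENNReal.rpow_le_rpow
            (le_of_eq (Finset.sum_congr rfl fun k _ => ?_)) (by have := hconj.symm.pos; positivity))
            (ENNReal.rpow_le_rpow (ENNReal.sum_le_tsum _) (by positivity))
          rw [← ENNReal.rpow_mul, hconj.sub_one_mul_conj]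
      _ = _ := lintegral_const_mul' _ _ (ENNReal.rpow_ne_top_of_nonneg
          (by have := hconj.symm.pos; positivity)
          (ENNReal.sum_ne_top.2 fun k _ => ENNReal.rpow_ne_top_of_nonneg hr0.le (hβ k)))
  have hSt : S ≠ ⊤ := ENNReal.sum_ne_top.2 fun k _ => ENNReal.rpow_ne_top_of_nonneg hr0.le (hβ k)
  rcases eq_or_ne S 0 with h0 | h0
  · rw [h0]; exact zero_le
  have h7 : S ^ (1 / r') ≠ 0 := (ENNReal.rpow_pos (pos_iff_ne_zero.2 h0) hSt).ne'
  have h8 : S ^ (1 / r') ≠ ⊤ :=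
    ENNReal.rpow_ne_top_of_nonneg (by have := hconj.symm.pos; positivity) hSt
  have h5 : S = S ^ (1 / r') * S ^ (1 / r) := by
    rw [← ENNReal.rpow_add _ _ h0 hSt, one_div, one_div, add_comm, hconj.inv_add_inv_eq_one,
      ENNReal.rpow_one]
  have h6 : S ^ (1 / r) ≤ F := by
    refine (ENNReal.mul_le_mul_iff_right h7 h8).1 ?_
    rw [← h5]; exact hS
  rw [one_div, ENNReal.rpow_inv_le_iff hr0] at h6
  exact h6

/-- Minkowski's inequality between `ℓ²` and `L^q`, `1 ≤ q ≤ 2`. -/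
theorem tsum_eLpNorm_sq_le {q : ℝ≥0∞} (hq1 : 1 ≤ q) (hq : q ≤ 2) {b : ℕ → α → ℝ≥0∞}
    (hb : ∀ k, AEMeasurable (b k) μ) :
    ∑' k, eLpNorm (b k) q μ ^ 2 ≤
      eLpNorm (fun t => (∑' k, b k t ^ 2) ^ (1 / 2 : ℝ)) q μ ^ 2 := by
  have hqt : q ≠ ⊤ := ne_top_of_le_ne_top (by simp) hq
  have hq0 : q ≠ 0 := by positivity
  have h1 : 1 ≤ q.toReal := by
    rw [← ENNReal.toReal_one]; exact ENNReal.toReal_mono hqt hq1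
  have h2 : q.toReal ≤ 2 := by
    simpa using ENNReal.toReal_mono (by simp) hq
  have hq00 : q.toReal ≠ 0 := by positivity
  have key := tsum_lintegral_rpow_le (μ := μ) (r := 2 / q.toReal)
    (by rw [le_div_iff₀ (by linarith)]; linarith) (c := fun k x => b k x ^ q.toReal)
    (fun k => (hb k).pow_const _)
  simp_rw [eLpNorm_eq_lintegral_rpow_enorm_toReal hq0 hqt, enorm_eq_self]
  simp_rw [← ENNReal.rpow_two, ← ENNReal.rpow_mul] at key ⊢
  have e1 : q.toReal * (2 / q.toReal) = 2 := by field_simp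
  have e2 : 1 / (2 / q.toReal) = 1 / 2 * q.toReal := by field_simp
  have e3 : 1 / q.toReal * 2 = 2 / q.toReal := by field_simp
  rw [e1, e2] at key
  rw [e3]
  calc _ = ((∑' k, (∫⁻ x, b k x ^ q.toReal ∂μ) ^ (2 / q.toReal)) ^ (1 / 2 * q.toReal)) ^
        (2 / q.toReal) := by
        rw [← ENNReal.rpow_mul]
        have : 1 / 2 * q.toReal * (2 / q.toReal) = 1 := by field_simp
        rw [this, ENNReal.rpow_one]
    _ ≤ _ := ENNReal.rpow_le_rpow key (by positivity)

/-- Measurable selection of a maximizer among the first `m + 1` members of a sequence. -/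
theorem exists_simpleFunc_forall_le {β : Type*} [LinearOrder β] [TopologicalSpace β]
    [OrderClosedTopology β] [SecondCountableTopology β] [MeasurableSpace β]
    [OpensMeasurableSpace β] {F : ℕ → α → β} (hF : ∀ i, Measurable (F i)) (m : ℕ) :
    ∃ s : SimpleFunc α ℕ, ∀ t, ∀ i ≤ m, F i t ≤ F (s t) t := by
  induction m with
  | zero => exact ⟨SimpleFunc.const α 0, fun t i hi => by simp [Nat.le_zero.1 hi]⟩
  | succ m ih =>
    obtain ⟨s, hs⟩ := ih
    have hsm : Measurable fun t => F (s t) t :=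
      measurable_from_prod_countable_right (f := fun x : ℕ × α => F x.1 x.2) (fun i => hF i)
        |>.comp (s.measurable.prodMk measurable_id)
    have hA : MeasurableSet {t | F (s t) t < F (m + 1) t} := measurableSet_lt hsm (hF _)
    refine ⟨SimpleFunc.piecewise _ hA (SimpleFunc.const α (m + 1)) s, fun t i hi => ?_⟩
    by_cases ht : F (s t) t < F (m + 1) t
    · have : (SimpleFunc.piecewise _ hA (SimpleFunc.const α (m + 1)) s) t = m + 1 := by
        simp [SimpleFunc.piecewise_apply, ht]
      rw [this]
      rcases Nat.le_succ_iff.1 hi with h | rfl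
      · exact (hs t i h).trans ht.le
      · rfl
    · have : (SimpleFunc.piecewise _ hA (SimpleFunc.const α (m + 1)) s) t = s t := by
        simp [SimpleFunc.piecewise_apply, ht]
      rw [this]
      rcases Nat.le_succ_iff.1 hi with h | rfl
      · exact hs t i h
      · exact not_lt.1 ht

end Scalar

/-! ### The decay rate as a convolution kernel -/

section Kernel

theorem lintegral_comp_abs (F : ℝ → ℝ≥0∞) :
    ∫⁻ x : ℝ, F |x| = 2 * ∫⁻ x in Ioi (0 : ℝ), F x := by
  have h1 : ∫⁻ x : ℝ, F |x| = (∫⁻ x in Ioi (0 : ℝ), F |x|) + ∫⁻ x in (Ioi (0 : ℝ))ᶜ, F |x| :=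
    (lintegral_add_compl _ measurableSet_Ioi).symm
  have h2 : ∫⁻ x in Ioi (0 : ℝ), F |x| = ∫⁻ x in Ioi (0 : ℝ), F x :=
    setLIntegral_congr_fun measurableSet_Ioi fun x hx => by simp [abs_of_pos (show 0 < x from hx)]
  have h3 : ∫⁻ x in (Ioi (0 : ℝ))ᶜ, F |x| = ∫⁻ x in Ioi (0 : ℝ), F x := by
    rw [compl_Ioi, ← setLIntegral_congr (Iio_ae_eq_Iic (a := (0 : ℝ))),
      ← lintegral_indicator measurableSet_Iio, ← lintegral_indicator measurableSet_Ioi,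
      ← lintegral_neg_eq_self]
    congr 1 with x
    by_cases hx : 0 < x
    · simp [hx, abs_of_pos hx]
    · simp [hx]
  rw [h1, h2, h3, two_mul]

theorem lintegral_abs_rpow_lt {R θ : ℝ} (hR : 0 < R) (hθ : θ < 1) :
    ∫⁻ x : ℝ, (if |x| < R then ENNReal.ofReal (|x| ^ (-θ)) else 0) =
      ENNReal.ofReal (2 / (1 - θ) * R ^ (1 - θ)) := by
  rw [lintegral_comp_abs fun x => if x < R then ENNReal.ofReal (x ^ (-θ)) else 0]
  have : ∫⁻ x in Ioi (0 : ℝ), (if x < R then ENNReal.ofReal (x ^ (-θ)) else 0) =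
      ∫⁻ x in Ioc (0 : ℝ) R, ENNReal.ofReal (x ^ (-θ)) := by
    rw [← setLIntegral_congr (Ioo_ae_eq_Ioc (a := (0 : ℝ)) (b := R)),
      ← lintegral_indicator measurableSet_Ioi, ← lintegral_indicator measurableSet_Ioo]
    congr 1 with x
    by_cases h1 : 0 < x <;> by_cases h2 : x < R <;> simp [h1, h2]
  rw [this, ← ofReal_integral_eq_lintegral_ofReal]
  · rw [← intervalIntegral.integral_of_le hR.le, integral_rpow (Or.inl (by linarith)),
      Real.zero_rpow (by linarith), show (2 : ℝ≥0∞) = ENNReal.ofReal 2 by simp,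
      ← ENNReal.ofReal_mul (by norm_num)]
    congr 1
    rw [show -θ + 1 = 1 - θ by ring]
    ring
  · exact (intervalIntegral.intervalIntegrable_rpow' (by linarith)).1
  · filter_upwards [ae_restrict_mem measurableSet_Ioc] with x hx
    exact Real.rpow_nonneg hx.1.le _

theorem lintegral_abs_rpow_ge {R a : ℝ} (hR : 0 < R) (ha : 1 < a) :
    ∫⁻ x : ℝ, (if R ≤ |x| then ENNReal.ofReal (|x| ^ (-a)) else 0) =
      ENNReal.ofReal (2 / (a - 1) * R ^ (1 - a)) := by
  rw [lintegral_comp_abs fun x => if R ≤ x then ENNReal.ofReal (x ^ (-a)) else 0]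
  have : ∫⁻ x in Ioi (0 : ℝ), (if R ≤ x then ENNReal.ofReal (x ^ (-a)) else 0) =
      ∫⁻ x in Ioi R, ENNReal.ofReal (x ^ (-a)) := by
    rw [setLIntegral_congr (Ioi_ae_eq_Ici (a := R)),
      ← lintegral_indicator measurableSet_Ioi, ← lintegral_indicator measurableSet_Ici]
    congr 1 with x
    by_cases h2 : R ≤ x
    · simp [h2, hR.trans_le h2]
    · simp [h2]
  rw [this, ← ofReal_integral_eq_lintegral_ofReal]
  · rw [integral_Ioi_rpow_of_lt (by linarith) hR, show (2 : ℝ≥0∞) = ENNReal.ofReal 2 by simp,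
      ← ENNReal.ofReal_mul (by norm_num)]
    congr 1
    rw [show -a + 1 = 1 - a by ring, show 1 - a = -(a - 1) by ring]
    have : a - 1 ≠ 0 := by linarith
    field_simp
  · exact integrableOn_Ioi_rpow_of_lt (by linarith) hR
  · filter_upwards [ae_restrict_mem measurableSet_Ioi] with x hx
    exact Real.rpow_nonneg (hR.trans hx).le _

theorem measurable_decayRate (θ₁ θ₂ : ℝ) : Measurable (decayRate θ₁ θ₂) :=
  Measurable.ite (measurableSet_le (by fun_prop) measurable_const) (by fun_prop) (by fun_prop)

theorem decayRate_neg (θ₁ θ₂ t : ℝ) : decayRate θ₁ θ₂ (-t) = decayRate θ₁ θ₂ t := by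
  simp [decayRate]

theorem decayRate_pos (θ₁ θ₂ : ℝ) {t : ℝ} (ht : t ≠ 0) : 0 < decayRate θ₁ θ₂ t := by
  have := abs_pos.2 ht
  unfold decayRate
  split_ifs <;> positivity

/-- The power `|t|^{-θ}` grows with `θ` for `|t| ≤ 1` and decreases with `θ` for `|t| > 1`. -/
theorem decayRate_le {θ₁ θ₂ θ : ℝ} (h1 : θ₁ ≤ θ) (h2 : θ ≤ θ₂) {t : ℝ} (ht : t ≠ 0) :
    decayRate θ₁ θ₂ t ≤ |t| ^ (-θ) := by
  have := abs_pos.2 ht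
  unfold decayRate
  split_ifs with h
  · exact Real.rpow_le_rpow_of_exponent_ge this h (by linarith)
  · exact Real.rpow_le_rpow_of_exponent_le (not_le.1 h).le (by linarith)

/-- The conditions are regrouped by the property of the kernel that they yield: bounded, integrable,
or dominated by a single power with exponent `θ = 2 / q` in `(0, 1)`. The open range of `q`
contributes to all three. -/
theorem InE.cases {θ₁ θ₂ : ℝ} {q : ℝ≥0∞} (h : InE θ₁ θ₂ q) :
    (q = ⊤ ∧ θ₁ ≤ 0 ∧ 0 ≤ θ₂) ∨ (q = 2 ∧ θ₁ < 1 ∧ 1 < θ₂) ∨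
      ∃ θ, 0 < θ ∧ θ < 1 ∧ q = ENNReal.ofReal (2 / θ) ∧ θ₁ ≤ θ ∧ θ ≤ θ₂ := by
  rcases h with ⟨h0, h1, h2, h3⟩ | ⟨h1, h0, h2, h3⟩ | ⟨h1, h0, h2, h3⟩ | ⟨h0, hq, h1, h2⟩
  · exact Or.inr (Or.inr ⟨θ₁, h0, by linarith, h3, le_rfl, h1.le⟩)
  · exact Or.inr (Or.inr ⟨θ₁, h0, h2, h3, le_rfl, h1.le⟩)
  · exact Or.inr (Or.inr ⟨θ₂, h0, h2, h3, h1.le, le_rfl⟩)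
  · rcases eq_or_ne q ⊤ with rfl | hqt
    · simp only [ENNReal.div_top, ENNReal.toReal_zero] at h1 h2
      exact Or.inl ⟨rfl, h1.le, h2.le⟩
    have hqr : 2 ≤ q.toReal := by simpa using ENNReal.toReal_mono hqt hq
    rw [ENNReal.toReal_div, ENNReal.toReal_ofNat] at h1 h2
    rcases eq_or_lt_of_le hqr with h | h
    · rw [← h] at h1 h2
      refine Or.inr (Or.inl ⟨?_, by linarith, by linarith⟩)
      rw [← ENNReal.ofReal_toReal hqt, ← h]; simp
    · refine Or.inr (Or.inr ⟨2 / q.toReal, by positivity, ?_, ?_, h1.le, h2.le⟩)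
      · rw [div_lt_one (by linarith)]; exact h
      · rw [div_div_cancel₀ (by norm_num), ENNReal.ofReal_toReal hqt]

theorem InE.two_le {θ₁ θ₂ : ℝ} {q : ℝ≥0∞} (h : InE θ₁ θ₂ q) : 2 ≤ q := by
  rcases h.cases with ⟨rfl, -⟩ | ⟨rfl, -⟩ | ⟨θ, h0, h1, rfl, -⟩
  · simp
  · exact le_rfl
  · rw [show (2 : ℝ≥0∞) = ENNReal.ofReal 2 by simp]
    apply ENNReal.ofReal_le_ofReal
    rw [le_div_iff₀ h0]; linarith

/-- The integral is split at a distance `R` from `t`. Near `t` the minimum is at most `b` and the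
kernel is integrable; far from `t` the minimum is at most `f`, and Hölder's inequality meets the
kernel in `L^{2/θ}`, where its power `|x|^{-2}` is integrable. -/
theorem lintegral_min_mul_rpow_le {θ : ℝ} (hθ0 : 0 < θ) (hθ1 : θ < 1) :
    ∃ C : ℝ≥0, ∀ f : ℝ → ℝ≥0∞, Measurable f → eLpNorm f (ENNReal.ofReal (2 / (2 - θ))) volume ≤ 1 →
      ∀ (t : ℝ) (b : ℝ≥0∞), ∫⁻ s, min (f s) b * ENNReal.ofReal (|t - s| ^ (-θ)) ≤
        C * b ^ (θ / (2 - θ)) := by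
  refine ⟨(2 / (1 - θ)).toNNReal + (2 : ℝ≥0) ^ (θ / 2), fun f hf hfn t b => ?_⟩
  have h2θ : 0 < 2 - θ := by linarith
  rcases eq_or_ne b 0 with rfl | hb0
  · simp
  rcases eq_or_ne b ⊤ with rfl | hbt
  · rw [ENNReal.top_rpow_of_pos (by positivity), ENNReal.mul_top]
    · exact le_top
    · have : (0 : ℝ≥0) < 2 ^ (θ / 2) := by positivity
      simp
  lift b to ℝ≥0 using hbt
  have hb : 0 < (b : ℝ) := by
    have : b ≠ 0 := by simpa using hb0
    positivity
  -- This radius balances the near part `b R^{1-θ}` and the far part `R^{-θ/2}`: both equal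
  -- `b^{θ/(2-θ)}`.
  set R : ℝ := (b : ℝ) ^ (-(2 / (2 - θ)))
  have hR : 0 < R := by positivity
  have hconj : Real.HolderConjugate (2 / (2 - θ)) (2 / θ) := by
    rw [Real.holderConjugate_iff]
    refine ⟨by rw [lt_div_iff₀ h2θ]; linarith, by field_simp; ring⟩
  have hsplit : ∀ s, min (f s) b * ENNReal.ofReal (|t - s| ^ (-θ)) ≤
      b * (if |t - s| < R then ENNReal.ofReal (|t - s| ^ (-θ)) else 0) +
      f s * (if R ≤ |t - s| then ENNReal.ofReal (|t - s| ^ (-θ)) else 0) := by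
    intro s
    rcases lt_or_ge |t - s| R with h | h
    · simp only [h, if_true, not_le.2 h, if_false, mul_zero, add_zero]
      gcongr
      exact min_le_right _ _
    · simp only [h, if_true, not_lt.2 h, if_false, mul_zero, zero_add]
      gcongr
      exact min_le_left _ _
  have hm1 : Measurable fun x : ℝ => if |x| < R then ENNReal.ofReal (|x| ^ (-θ)) else 0 :=
    Measurable.ite (measurableSet_lt (by fun_prop) measurable_const) (by fun_prop) measurable_const
  have hm2 : Measurable fun x : ℝ => if R ≤ |x| then ENNReal.ofReal (|x| ^ (-θ)) else 0 :=
    Measurable.ite (measurableSet_le measurable_const (by fun_prop)) (by fun_prop) measurable_const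
  have hnear : ∫⁻ s, b * (if |t - s| < R then ENNReal.ofReal (|t - s| ^ (-θ)) else 0) =
      b * ENNReal.ofReal (2 / (1 - θ) * R ^ (1 - θ)) := by
    rw [lintegral_const_mul' _ _ (by simp), lintegral_sub_left_eq_self
      (fun x : ℝ => if |x| < R then ENNReal.ofReal (|x| ^ (-θ)) else 0) t,
      lintegral_abs_rpow_lt hR hθ1]
  have hfar : ∫⁻ s, f s * (if R ≤ |t - s| then ENNReal.ofReal (|t - s| ^ (-θ)) else 0) ≤
      ENNReal.ofReal (2 * R⁻¹) ^ (θ / 2) := by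
    refine (ENNReal.lintegral_mul_le_Lp_mul_Lq volume hconj hf.aemeasurable
      (hm2.comp (measurable_const.sub measurable_id)).aemeasurable).trans ?_
    rw [← one_mul (ENNReal.ofReal (2 * R⁻¹) ^ (θ / 2))]
    refine mul_le_mul' ?_ ?_
    · rw [eLpNorm_eq_lintegral_rpow_enorm_toReal (by simp [h2θ]) (by simp),
        ENNReal.toReal_ofReal (by positivity)] at hfn
      simpa using hfn
    · have h5 : ∀ s, (if R ≤ |t - s| then ENNReal.ofReal (|t - s| ^ (-θ)) else 0) ^ (2 / θ) =
          (fun x : ℝ => if R ≤ |x| then ENNReal.ofReal (|x| ^ (-(2 : ℝ))) else 0) (t - s) := by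
        intro s
        simp only
        split_ifs with h
        · have : 0 < |t - s| := hR.trans_le h
          rw [ENNReal.ofReal_rpow_of_pos (by positivity), ← Real.rpow_mul this.le]
          congr 2; field_simp
        · exact ENNReal.zero_rpow_of_pos (by positivity)
      have h6 : ∀ s, (((fun x : ℝ => if R ≤ |x| then ENNReal.ofReal (|x| ^ (-θ)) else 0) ∘
          ((fun _ => t) - id)) s) ^ (2 / θ) =
          (fun x : ℝ => if R ≤ |x| then ENNReal.ofReal (|x| ^ (-(2 : ℝ))) else 0) (t - s) := h5
      simp only [h6]
      rw [lintegral_sub_left_eq_self (fun x : ℝ =>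
        if R ≤ |x| then ENNReal.ofReal (|x| ^ (-(2 : ℝ))) else 0) t,
        lintegral_abs_rpow_ge hR (by norm_num), one_div_div]
      apply le_of_eq
      congr 2
      norm_num [Real.rpow_neg_one]
  calc _ ≤ ∫⁻ s, (b * (if |t - s| < R then ENNReal.ofReal (|t - s| ^ (-θ)) else 0) +
        f s * (if R ≤ |t - s| then ENNReal.ofReal (|t - s| ^ (-θ)) else 0)) :=
        lintegral_mono hsplit
    _ = _ := lintegral_add_right _ (hf.mul (hm2.comp (measurable_const.sub measurable_id)))
    _ ≤ b * ENNReal.ofReal (2 / (1 - θ) * R ^ (1 - θ)) + ENNReal.ofReal (2 * R⁻¹) ^ (θ / 2) := by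
        rw [hnear]; gcongr
    _ = _ := by
        rw [ENNReal.ofReal_mul (by positivity), ENNReal.ofReal_mul (by norm_num)]
        rw [ENNReal.mul_rpow_of_nonneg _ _ (by positivity),
          ENNReal.ofReal_rpow_of_pos (by positivity : 0 < R⁻¹)]
        have e1 : (b : ℝ≥0∞) * ENNReal.ofReal (R ^ (1 - θ)) = (b : ℝ≥0∞) ^ (θ / (2 - θ)) := by
          rw [← ENNReal.ofReal_coe_nnreal, ← ENNReal.ofReal_mul hb.le,
            ENNReal.ofReal_rpow_of_pos hb]
          congr 1
          nth_rewrite 1 [← Real.rpow_one (b : ℝ)]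
          rw [← Real.rpow_mul hb.le, ← Real.rpow_add hb]
          congr 1; field_simp; ring
        have e2 : ENNReal.ofReal (R⁻¹ ^ (θ / 2)) = (b : ℝ≥0∞) ^ (θ / (2 - θ)) := by
          rw [← ENNReal.ofReal_coe_nnreal, ENNReal.ofReal_rpow_of_pos hb]
          congr 1
          rw [← Real.rpow_neg hb.le, ← Real.rpow_mul hb.le]
          congr 1; field_simp
        rw [e2, mul_left_comm, e1, ENNReal.coe_add, add_mul,
          ENNReal.coe_rpow_of_nonneg _ (by positivity)]
        simp [ENNReal.ofReal]

/-- The one-dimensional Hardy-Littlewood-Sobolev inequality for dual exponents. -/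
theorem lintegral_lintegral_mul_rpow_le {θ : ℝ} (hθ0 : 0 < θ) (hθ1 : θ < 1) :
    ∃ C : ℝ≥0, ∀ f g : ℝ → ℝ≥0∞, Measurable f → Measurable g →
      eLpNorm f (ENNReal.ofReal (2 / (2 - θ))) volume ≤ 1 →
      eLpNorm g (ENNReal.ofReal (2 / (2 - θ))) volume ≤ 1 →
      ∫⁻ t, ∫⁻ s, f s * g t * ENNReal.ofReal (|t - s| ^ (-θ)) ≤ C := by
  obtain ⟨C, hC⟩ := lintegral_min_mul_rpow_le hθ0 hθ1
  have h2θ : 0 < 2 - θ := by linarith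
  refine ⟨C + C, fun f g hf hg hfn hgn => ?_⟩
  have hker : Measurable fun z : ℝ × ℝ => ENNReal.ofReal (|z.1 - z.2| ^ (-θ)) := by fun_prop
  -- With `b = g t` the inner integral is at most `C g(t)^{θ/(2-θ)}`, and `1 + θ/(2-θ) = 2/(2-θ)` is
  -- exactly the exponent of the space.
  have key : ∀ f g : ℝ → ℝ≥0∞, Measurable f → Measurable g →
      eLpNorm f (ENNReal.ofReal (2 / (2 - θ))) volume ≤ 1 →
      eLpNorm g (ENNReal.ofReal (2 / (2 - θ))) volume ≤ 1 →
      ∫⁻ t, ∫⁻ s, g t * (min (f s) (g t) * ENNReal.ofReal (|t - s| ^ (-θ))) ≤ C := by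
    intro f g hf hg hfn hgn
    calc ∫⁻ t, ∫⁻ s, g t * (min (f s) (g t) * ENNReal.ofReal (|t - s| ^ (-θ)))
        ≤ ∫⁻ t, g t * (C * g t ^ (θ / (2 - θ))) := by
          apply lintegral_mono
          intro t
          simp only
          rw [lintegral_const_mul _ (by fun_prop)]
          gcongr
          exact hC f hf hfn t (g t)
      _ = C * ∫⁻ t, g t ^ (2 / (2 - θ)) := by
          rw [← lintegral_const_mul' _ _ (by simp)]
          congr 1 with t
          have : 2 / (2 - θ) = 1 + θ / (2 - θ) := by field_simp; ring
          rw [this, ENNReal.rpow_add_of_nonneg _ _ zero_le_one (by positivity), ENNReal.rpow_one]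
          ring
      _ ≤ C * 1 := by
          gcongr
          rw [eLpNorm_eq_lintegral_rpow_enorm_toReal (by simp [h2θ]) (by simp),
            ENNReal.toReal_ofReal (by positivity), one_div, ENNReal.rpow_inv_le_iff (by positivity),
            ENNReal.one_rpow] at hgn
          simpa using hgn
      _ = C := mul_one _
  -- A product is the larger factor times the minimum. According to which factor is larger, one of
  -- the two terms already equals the left side.
  have hpt : ∀ t s, f s * g t * ENNReal.ofReal (|t - s| ^ (-θ)) ≤
      g t * (min (f s) (g t) * ENNReal.ofReal (|t - s| ^ (-θ))) +
      f s * (min (g t) (f s) * ENNReal.ofReal (|s - t| ^ (-θ))) := by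
    intro t s
    rw [abs_sub_comm s t]
    rcases le_total (f s) (g t) with h | h
    · rw [min_eq_left h]
      exact le_trans (le_of_eq (by ring)) le_self_add
    · rw [min_eq_left h]
      exact le_trans (le_of_eq (by ring)) le_add_self
  calc _ ≤ ∫⁻ t, ∫⁻ s, (g t * (min (f s) (g t) * ENNReal.ofReal (|t - s| ^ (-θ))) +
        f s * (min (g t) (f s) * ENNReal.ofReal (|s - t| ^ (-θ)))) :=
        lintegral_mono fun t => lintegral_mono fun s => hpt t s
    _ = (∫⁻ t, ∫⁻ s, g t * (min (f s) (g t) * ENNReal.ofReal (|t - s| ^ (-θ)))) +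
        ∫⁻ t, ∫⁻ s, f s * (min (g t) (f s) * ENNReal.ofReal (|s - t| ^ (-θ))) := by
        rw [← lintegral_add_left]
        · congr 1 with t
          rw [lintegral_add_left (by fun_prop)]
        · refine Measurable.lintegral_prod_right' (f := fun z : ℝ × ℝ =>
            g z.1 * (min (f z.2) (g z.1) * ENNReal.ofReal (|z.1 - z.2| ^ (-θ)))) ?_
          fun_prop
    _ ≤ C + C := by
        refine add_le_add (key f g hf hg hfn hgn) ?_
        rw [lintegral_lintegral_swap (by fun_prop)]
        exact key g f hg hf hgn hfn
    _ = _ := by push_cast; rfl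

theorem lintegral_decayRate_lt_top {θ₁ θ₂ : ℝ} (h1 : θ₁ < 1) (h2 : 1 < θ₂) :
    ∫⁻ t, ENNReal.ofReal (decayRate θ₁ θ₂ t) < ⊤ := by
  -- The radius `2` only serves to include `|t| = 1` in a strict inequality.
  have : ∀ t, ENNReal.ofReal (decayRate θ₁ θ₂ t) ≤
      (if |t| < 2 then ENNReal.ofReal (|t| ^ (-θ₁)) else 0) +
        (if 1 ≤ |t| then ENNReal.ofReal (|t| ^ (-θ₂)) else 0) := by
    intro t
    unfold decayRate
    split_ifs with h3 h4 h5 h6 h7 h8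
    all_goals first | exact le_self_add | exact le_add_self | (exfalso; linarith)
  refine (lintegral_mono this).trans_lt ?_
  rw [lintegral_add_left (Measurable.ite (measurableSet_lt (by fun_prop) measurable_const)
    (by fun_prop) measurable_const), lintegral_abs_rpow_lt two_pos h1,
    lintegral_abs_rpow_ge one_pos h2]
  exact ENNReal.add_lt_top.2 ⟨ENNReal.ofReal_lt_top, ENNReal.ofReal_lt_top⟩

/-- Homogeneity. The condition `C ≠ 0` makes the right side infinite when one norm is infinite and
the other is not zero. -/
theorem lintegral_lintegral_mul_le_of_normalized {r : ℝ≥0∞} (hr : r ≠ 0) {κ : ℝ → ℝ≥0∞}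
    {C : ℝ≥0} (hC : C ≠ 0)
    (h : ∀ f g : ℝ → ℝ≥0∞, Measurable f → Measurable g → eLpNorm f r volume ≤ 1 →
      eLpNorm g r volume ≤ 1 → ∫⁻ t, ∫⁻ s, f s * g t * κ (t - s) ≤ C)
    {f g : ℝ → ℝ≥0∞} (hf : Measurable f) (hg : Measurable g) :
    ∫⁻ t, ∫⁻ s, f s * g t * κ (t - s) ≤ C * eLpNorm f r volume * eLpNorm g r volume := by
  rcases eq_or_ne (eLpNorm f r volume) 0 with hf0 | hf0
  · rw [eLpNorm_eq_zero_iff hf.aestronglyMeasurable hr] at hf0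
    have : ∀ t, ∫⁻ s, f s * g t * κ (t - s) = 0 := fun t => by
      rw [← lintegral_zero (α := ℝ) (μ := volume)]
      apply lintegral_congr_ae
      filter_upwards [hf0] with s hs
      simp [hs]
    simp [this]
  rcases eq_or_ne (eLpNorm g r volume) 0 with hg0 | hg0
  · rw [eLpNorm_eq_zero_iff hg.aestronglyMeasurable hr] at hg0
    have : ∫⁻ t, ∫⁻ s, f s * g t * κ (t - s) = 0 := by
      rw [← lintegral_zero (α := ℝ) (μ := volume)]
      apply lintegral_congr_ae
      filter_upwards [hg0] with s hs
      simp [hs]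
    simp [this]
  have hC' : (C : ℝ≥0∞) ≠ 0 := by simpa using hC
  rcases eq_or_ne (eLpNorm f r volume) ⊤ with hft | hft
  · rw [hft, ENNReal.mul_top hC', ENNReal.top_mul hg0]; exact le_top
  rcases eq_or_ne (eLpNorm g r volume) ⊤ with hgt | hgt
  · rw [hgt, ENNReal.mul_top (mul_ne_zero hC' hf0)]; exact le_top
  set a := eLpNorm f r volume
  set b := eLpNorm g r volume
  have hnorm : ∀ (f : ℝ → ℝ≥0∞), Measurable f → eLpNorm f r volume ≠ 0 → eLpNorm f r volume ≠ ⊤ →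
      eLpNorm (fun x => (eLpNorm f r volume)⁻¹ * f x) r volume ≤ 1 := by
    intro f hf h0 ht
    refine (eLpNorm_le_mul_eLpNorm_of_ae_le_mul'' (c := (eLpNorm f r volume)⁻¹) r
      hf.aestronglyMeasurable (ae_of_all _ fun x => ?_)).trans ?_
    · simp
    · rw [ENNReal.inv_mul_cancel h0 ht]
  have := h (fun x => a⁻¹ * f x) (fun x => b⁻¹ * g x) (hf.const_mul _) (hg.const_mul _)
    (hnorm f hf hf0 hft) (hnorm g hg hg0 hgt)
  have e : ∀ t s, f s * g t * κ (t - s) =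
      (a * b) * (a⁻¹ * f s * (b⁻¹ * g t) * κ (t - s)) := by
    intro t s
    calc f s * g t * κ (t - s) = (a * a⁻¹) * (b * b⁻¹) * (f s * g t * κ (t - s)) := by
          rw [ENNReal.mul_inv_cancel hf0 hft, ENNReal.mul_inv_cancel hg0 hgt]; simp
      _ = _ := by ring
  simp_rw [e]
  have hab : a * b ≠ ⊤ := ENNReal.mul_ne_top hft hgt
  simp_rw [lintegral_const_mul' _ _ hab]
  exact (mul_le_mul_right this (a * b)).trans (le_of_eq (by ring))

/-- Boundedness of the bilinear form with kernel `decayRate` for admissible exponents. -/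
theorem exists_lintegral_decayRate_le {θ₁ θ₂ : ℝ} {q q' : ℝ≥0∞} (hq : InE θ₁ θ₂ q)
    [hqq : q.HolderConjugate q'] :
    ∃ C : ℝ≥0, ∀ f g : ℝ → ℝ≥0∞, Measurable f → Measurable g →
      ∫⁻ t, ∫⁻ s, f s * g t * ENNReal.ofReal (decayRate θ₁ θ₂ (t - s)) ≤
        C * eLpNorm f q' volume * eLpNorm g q' volume := by
  have hq'1 : 1 ≤ q' := ENNReal.HolderTriple.le q' q 1
  suffices ∃ C : ℝ≥0, ∀ f g : ℝ → ℝ≥0∞, Measurable f → Measurable g →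
      eLpNorm f q' volume ≤ 1 → eLpNorm g q' volume ≤ 1 →
      ∫⁻ t, ∫⁻ s, f s * g t * ENNReal.ofReal (decayRate θ₁ θ₂ (t - s)) ≤ C by
    obtain ⟨C, hC⟩ := this
    -- The summand `1` provides the nonzero constant that the rescaling requires.
    refine ⟨C + 1, fun f g hf hg => ?_⟩
    refine lintegral_lintegral_mul_le_of_normalized (by positivity) (by positivity)
      (κ := fun x => ENNReal.ofReal (decayRate θ₁ θ₂ x))
      (fun f g hf hg hfn hgn => (hC f g hf hg hfn hgn).trans ?_) hf hg
    push_cast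
    exact le_self_add
  rcases hq.cases with ⟨rfl, h1, h2⟩ | ⟨rfl, h1, h2⟩ | ⟨θ, h0, h1, rfl, h2, h3⟩
  · have : q' = 1 := (ENNReal.HolderConjugate.unique ⊤ q' 1)
    subst this
    refine ⟨1, fun f g hf hg hfn hgn => ?_⟩
    rw [eLpNorm_one_eq_lintegral_enorm] at hfn hgn
    simp only [enorm_eq_self] at hfn hgn
    have hk : ∀ t, ENNReal.ofReal (decayRate θ₁ θ₂ t) ≤ 1 := by
      intro t
      rw [← ENNReal.ofReal_one]
      apply ENNReal.ofReal_le_ofReal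
      unfold decayRate
      split_ifs with h
      · exact Real.rpow_le_one (abs_nonneg _) h (by linarith)
      · exact Real.rpow_le_one_of_one_le_of_nonpos (not_le.1 h).le (by linarith)
    calc _ ≤ ∫⁻ t, ∫⁻ s, f s * g t :=
          lintegral_mono fun t => lintegral_mono fun s => mul_le_of_le_one_right' (hk _)
      _ = (∫⁻ s, f s) * ∫⁻ t, g t := by
          simp_rw [lintegral_mul_const _ hf]
          rw [lintegral_const_mul _ hg]
      _ ≤ 1 * 1 := mul_le_mul' hfn hgn
      _ = _ := by simp
  · have : q' = 2 := (ENNReal.HolderConjugate.unique 2 q' 2)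
    subst this
    have hk := lintegral_decayRate_lt_top h1 h2
    set κ : ℝ → ℝ≥0∞ := fun t => ENNReal.ofReal (decayRate θ₁ θ₂ t)
    have hκm : Measurable κ := (measurable_decayRate θ₁ θ₂).ennreal_ofReal
    have hκn : ∀ x y, κ (x - y) = κ (y - x) := fun x y => by
      simp only [κ]; rw [← decayRate_neg, neg_sub]
    set A := ∫⁻ t, κ t
    refine ⟨(A + A).toNNReal, fun f g hf hg hfn hgn => ?_⟩
    rw [ENNReal.coe_toNNReal (by simp [hk.ne])]
    have h2n : ∀ f : ℝ → ℝ≥0∞, eLpNorm f 2 volume ≤ 1 → ∫⁻ s, f s ^ 2 ≤ 1 := by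
      intro f hf
      rw [eLpNorm_eq_lintegral_rpow_enorm_toReal (by simp) (by simp), one_div,
        ENNReal.rpow_inv_le_iff (by simp), ENNReal.one_rpow] at hf
      simpa using hf
    -- This replaces Young's convolution inequality: each square is integrated against an integrable
    -- kernel in the other variable.
    have hpt : ∀ a b : ℝ≥0∞, a * b ≤ a ^ 2 + b ^ 2 := by
      intro a b
      rcases le_total a b with h | h
      · calc a * b ≤ b * b := by gcongr
          _ ≤ _ := by rw [← sq]; exact le_add_self
      · calc a * b ≤ a * a := by gcongr
          _ ≤ _ := by rw [← sq]; exact le_self_add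
    have key : ∀ g : ℝ → ℝ≥0∞, Measurable g → eLpNorm g 2 volume ≤ 1 →
        ∫⁻ t, ∫⁻ s, g t ^ 2 * κ (t - s) ≤ A := by
      intro g hg hgn
      calc _ = ∫⁻ t, g t ^ 2 * A := by
            congr 1 with t
            rw [lintegral_const_mul _ (by fun_prop : Measurable fun s => κ (t - s)), lintegral_sub_left_eq_self κ t]
        _ = (∫⁻ t, g t ^ 2) * A := lintegral_mul_const _ (by fun_prop)
        _ ≤ 1 * A := by gcongr; exact h2n g hgn
        _ = A := one_mul _
    have hm : ∀ g : ℝ → ℝ≥0∞, Measurable g →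
        Measurable fun z : ℝ × ℝ => g z.2 ^ 2 * κ (z.1 - z.2) := fun g hg =>
      ((hg.comp measurable_snd).pow_const 2).mul (hκm.comp (by fun_prop))
    calc _ ≤ ∫⁻ t, ∫⁻ s, (f s ^ 2 * κ (t - s) + g t ^ 2 * κ (t - s)) := by
          refine lintegral_mono fun t => lintegral_mono fun s => ?_
          simp only
          rw [← add_mul]
          gcongr
          exact hpt _ _
      _ = (∫⁻ t, ∫⁻ s, f s ^ 2 * κ (t - s)) + ∫⁻ t, ∫⁻ s, g t ^ 2 * κ (t - s) := by
          rw [← lintegral_add_left]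
          · congr 1 with t
            rw [lintegral_add_left]
            exact (hm f hf).comp (measurable_const.prodMk measurable_id)
          · exact Measurable.lintegral_prod_right' (f := fun z : ℝ × ℝ => f z.2 ^ 2 * κ (z.1 - z.2)) (hm f hf)
      _ ≤ A + A := by
          refine add_le_add ?_ (key g hg hgn)
          rw [lintegral_lintegral_swap (hm f hf).aemeasurable]
          simp_rw [fun x y => hκn x y]
          exact key f hf hfn
  · have h2θ : 0 < 2 - θ := by linarith
    have : q' = ENNReal.ofReal (2 / (2 - θ)) := by
      have hr : Real.HolderConjugate (2 / θ) (2 / (2 - θ)) := by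
        rw [Real.holderConjugate_iff]
        refine ⟨by rw [lt_div_iff₀ h0]; linarith, by field_simp; ring⟩
      have := hr.ennrealOfReal
      exact ENNReal.HolderConjugate.unique (ENNReal.ofReal (2 / θ)) _ _
    subst this
    obtain ⟨C, hC⟩ := lintegral_lintegral_mul_rpow_le h0 h1
    refine ⟨C, fun f g hf hg hfn hgn => le_trans ?_ (hC f g hf hg hfn hgn)⟩
    refine lintegral_mono fun t => lintegral_mono_ae ?_
    have : ∀ᵐ s : ℝ, s ≠ t := by simp [ae_iff]
    filter_upwards [this] with s hs
    gcongr
    exact decayRate_le h2 h3 (sub_ne_zero.2 hs.symm)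

end Kernel

/-- `L²` functions of the frequency variable. -/
abbrev L2 (n : ℕ) : Type := Lp (α := Rn n) ℂ 2 volume

/-! ### Bounded multipliers on `L²` of the frequency variable -/

section Multiplication

variable {n : ℕ}

/-- Bounded measurable symbols. -/
structure IsSymbol (m : Rn n → ℂ) : Prop where
  measurable : Measurable m
  bounded : ∃ C : ℝ, ∀ ξ, ‖m ξ‖ ≤ C

theorem IsSymbol.memLp_mul {m : Rn n → ℂ} (h : IsSymbol m) (a : L2 n) :
    MemLp (fun ξ => m ξ * a ξ) 2 volume := by
  obtain ⟨C, hC⟩ := h.bounded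
  refine MemLp.of_le_mul (c := C) (Lp.memLp a)
    (h.measurable.aestronglyMeasurable.mul (Lp.aestronglyMeasurable a)) (ae_of_all _ fun ξ => ?_)
  rw [norm_mul]
  gcongr
  exact hC ξ

theorem IsSymbol.mul {m₁ m₂ : Rn n → ℂ} (h₁ : IsSymbol m₁) (h₂ : IsSymbol m₂) :
    IsSymbol fun ξ => m₁ ξ * m₂ ξ := by
  obtain ⟨C₁, hC₁⟩ := h₁.bounded
  obtain ⟨C₂, hC₂⟩ := h₂.bounded
  refine ⟨h₁.measurable.mul h₂.measurable, C₁ * C₂, fun ξ => ?_⟩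
  rw [norm_mul]
  exact mul_le_mul (hC₁ ξ) (hC₂ ξ) (norm_nonneg _) ((norm_nonneg _).trans (hC₁ ξ))

theorem IsSymbol.add {m₁ m₂ : Rn n → ℂ} (h₁ : IsSymbol m₁) (h₂ : IsSymbol m₂) :
    IsSymbol fun ξ => m₁ ξ + m₂ ξ := by
  obtain ⟨C₁, hC₁⟩ := h₁.bounded
  obtain ⟨C₂, hC₂⟩ := h₂.bounded
  exact ⟨h₁.measurable.add h₂.measurable, C₁ + C₂, fun ξ =>
    (norm_add_le _ _).trans (add_le_add (hC₁ ξ) (hC₂ ξ))⟩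

theorem IsSymbol.sub {m₁ m₂ : Rn n → ℂ} (h₁ : IsSymbol m₁) (h₂ : IsSymbol m₂) :
    IsSymbol fun ξ => m₁ ξ - m₂ ξ := by
  obtain ⟨C₁, hC₁⟩ := h₁.bounded
  obtain ⟨C₂, hC₂⟩ := h₂.bounded
  exact ⟨h₁.measurable.sub h₂.measurable, C₁ + C₂, fun ξ =>
    (norm_sub_le _ _).trans (add_le_add (hC₁ ξ) (hC₂ ξ))⟩

theorem IsSymbol.conj {m : Rn n → ℂ} (h : IsSymbol m) :
    IsSymbol fun ξ => (starRingEnd ℂ) (m ξ) := by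
  obtain ⟨C, hC⟩ := h.bounded
  exact ⟨Complex.continuous_conj.measurable.comp h.measurable, C, fun ξ => by simpa using hC ξ⟩

theorem IsSymbol.const (c : ℂ) : IsSymbol fun _ : Rn n => c :=
  ⟨measurable_const, ‖c‖, fun _ => le_rfl⟩

open Classical in
/-- Multiplication by a bounded measurable symbol (and `0` if `m` is not of this kind). -/
def mulOp (m : Rn n → ℂ) : L2 n →L[ℂ] L2 n :=
  if h : IsSymbol m then
    LinearMap.mkContinuous
      { toFun := fun a => (h.memLp_mul a).toLp _
        map_add' := fun a b => by
          rw [← MemLp.toLp_add (h.memLp_mul a) (h.memLp_mul b), MemLp.toLp_eq_toLp_iff]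
          filter_upwards [Lp.coeFn_add a b] with ξ hξ
          change m ξ * (a + b : L2 n) ξ = m ξ * a ξ + m ξ * b ξ
          rw [hξ, Pi.add_apply, mul_add]
        map_smul' := fun c a => by
          rw [RingHom.id_apply, ← MemLp.toLp_const_smul c (h.memLp_mul a), MemLp.toLp_eq_toLp_iff]
          filter_upwards [Lp.coeFn_smul c a] with ξ hξ
          change m ξ * (c • a : L2 n) ξ = c * (m ξ * a ξ)
          rw [hξ, Pi.smul_apply, smul_eq_mul, mul_left_comm] }
      h.bounded.choose fun a => by
        refine Lp.norm_le_mul_norm_of_ae_le_mul ?_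
        filter_upwards [MemLp.coeFn_toLp (h.memLp_mul a)] with ξ hξ
        simp only [LinearMap.coe_mk, AddHom.coe_mk]
        rw [hξ, norm_mul]
        gcongr
        exact h.bounded.choose_spec ξ
  else 0

theorem coeFn_mulOp {m : Rn n → ℂ} (h : IsSymbol m) (a : L2 n) :
    mulOp m a =ᵐ[volume] fun ξ => m ξ * a ξ := by
  rw [mulOp, dif_pos h]
  exact MemLp.coeFn_toLp (h.memLp_mul a)

theorem norm_mulOp_le {m : Rn n → ℂ} (h : IsSymbol m) {C : ℝ} (hC : ∀ ξ, ‖m ξ‖ ≤ C) (a : L2 n) :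
    ‖mulOp m a‖ ≤ C * ‖a‖ := by
  refine Lp.norm_le_mul_norm_of_ae_le_mul ?_
  filter_upwards [coeFn_mulOp h a] with ξ hξ
  rw [hξ, norm_mul]
  gcongr
  exact hC ξ

theorem mulOp_mulOp {m₁ m₂ : Rn n → ℂ} (h₁ : IsSymbol m₁) (h₂ : IsSymbol m₂) (a : L2 n) :
    mulOp m₁ (mulOp m₂ a) = mulOp (fun ξ => m₁ ξ * m₂ ξ) a := by
  apply Lp.ext
  filter_upwards [coeFn_mulOp h₁ (mulOp m₂ a), coeFn_mulOp h₂ a, coeFn_mulOp (h₁.mul h₂) a]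
    with ξ e₁ e₂ e₃
  rw [e₁, e₂, e₃, mul_assoc]

theorem mulOp_comm {m₁ m₂ : Rn n → ℂ} (h₁ : IsSymbol m₁) (h₂ : IsSymbol m₂) (a : L2 n) :
    mulOp m₁ (mulOp m₂ a) = mulOp m₂ (mulOp m₁ a) := by
  rw [mulOp_mulOp h₁ h₂, mulOp_mulOp h₂ h₁]
  simp_rw [mul_comm]

theorem mulOp_one (a : L2 n) : mulOp (fun _ => 1) a = a := by
  apply Lp.ext
  filter_upwards [coeFn_mulOp (IsSymbol.const 1) a] with ξ e
  rw [e, one_mul]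

theorem mulOp_zero (a : L2 n) : mulOp (fun _ => 0) a = 0 := by
  apply Lp.ext
  filter_upwards [coeFn_mulOp (IsSymbol.const 0) a, Lp.coeFn_zero ℂ 2 (volume : Measure (Rn n))]
    with ξ e e'
  rw [e, zero_mul, e']; rfl

theorem mulOp_add {m₁ m₂ : Rn n → ℂ} (h₁ : IsSymbol m₁) (h₂ : IsSymbol m₂) (a : L2 n) :
    mulOp (fun ξ => m₁ ξ + m₂ ξ) a = mulOp m₁ a + mulOp m₂ a := by
  apply Lp.ext
  filter_upwards [coeFn_mulOp h₁ a, coeFn_mulOp h₂ a, coeFn_mulOp (h₁.add h₂) a,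
    Lp.coeFn_add (mulOp m₁ a) (mulOp m₂ a)] with ξ e₁ e₂ e₃ e₄
  rw [e₃, e₄, Pi.add_apply, e₁, e₂, add_mul]

theorem mulOp_sub {m₁ m₂ : Rn n → ℂ} (h₁ : IsSymbol m₁) (h₂ : IsSymbol m₂) (a : L2 n) :
    mulOp (fun ξ => m₁ ξ - m₂ ξ) a = mulOp m₁ a - mulOp m₂ a := by
  apply Lp.ext
  filter_upwards [coeFn_mulOp h₁ a, coeFn_mulOp h₂ a, coeFn_mulOp (h₁.sub h₂) a,
    Lp.coeFn_sub (mulOp m₁ a) (mulOp m₂ a)] with ξ e₁ e₂ e₃ e₄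
  rw [e₃, e₄, Pi.sub_apply, e₁, e₂, sub_mul]

theorem inner_mulOp {m : Rn n → ℂ} (h : IsSymbol m) (g a : L2 n) :
    inner ℂ g (mulOp m a) = inner ℂ (mulOp (fun ξ => (starRingEnd ℂ) (m ξ)) g) a := by
  rw [L2.inner_def, L2.inner_def]
  apply integral_congr_ae
  filter_upwards [coeFn_mulOp h a, coeFn_mulOp h.conj g] with ξ e₁ e₂
  rw [e₁, e₂]
  simp only [RCLike.inner_apply, map_mul, RingHomCompTriple.comp_apply, RingHom.id_apply]
  ring

end Multiplication

/-! ### Physical `L^p` norms of frequency-side functions, through duality -/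

section PhysicalNorm

variable {n : ℕ}

/-- The `L^p` norm in the physical variable of a function given on the frequency side. -/
def lpn (p : ℝ≥0∞) (a : L2 n) : ℝ≥0∞ := eLpNorm (𝓕⁻ a : L2 n) p volume

theorem lpn_two (a : L2 n) : lpn 2 a = ‖a‖ₑ := by
  rw [lpn, ← Lp.enorm_def, ← ofReal_norm, ← ofReal_norm, ← Lp.norm_fourier_eq (𝓕⁻ a),
    FourierTransform.fourier_fourierInv_eq]

theorem lpn_zero (p : ℝ≥0∞) : lpn p (0 : L2 n) = 0 := by
  rw [lpn, FourierTransform.fourierInv_zero, eLpNorm_congr_ae (Lp.coeFn_zero ℂ 2 volume)]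
  exact eLpNorm_zero

theorem lpn_add_le {p : ℝ≥0∞} (hp : 1 ≤ p) (a b : L2 n) : lpn p (a + b) ≤ lpn p a + lpn p b := by
  rw [lpn, FourierTransform.fourierInv_add, eLpNorm_congr_ae (Lp.coeFn_add _ _)]
  exact eLpNorm_add_le (Lp.aestronglyMeasurable _) (Lp.aestronglyMeasurable _) hp

theorem lpn_smul (p : ℝ≥0∞) (c : ℂ) (a : L2 n) : lpn p (c • a) = ‖c‖ₑ * lpn p a := by
  rw [lpn, FourierTransform.fourierInv_smul, eLpNorm_congr_ae (Lp.coeFn_smul _ _)]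
  exact eLpNorm_const_smul _ _ _ _

theorem lpn_sum_le {ι : Type*} {p : ℝ≥0∞} (hp : 1 ≤ p) (s : Finset ι) (a : ι → L2 n) :
    lpn p (∑ i ∈ s, a i) ≤ ∑ i ∈ s, lpn p (a i) := by
  classical
  induction s using Finset.induction_on with
  | empty => simp [lpn_zero]
  | insert i s hi ih =>
    rw [Finset.sum_insert hi, Finset.sum_insert hi]
    exact (lpn_add_le hp _ _).trans (by gcongr)

theorem lpn_neg (p : ℝ≥0∞) (a : L2 n) : lpn p (-a) = lpn p a := by
  rw [← neg_one_smul ℂ a, lpn_smul]; simp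

theorem inner_fourierInv (g a : L2 n) : inner ℂ (𝓕⁻ g) (𝓕⁻ a) = inner ℂ g a := by
  rw [← Lp.inner_fourier_eq, FourierTransform.fourier_fourierInv_eq,
    FourierTransform.fourier_fourierInv_eq]

/-- Parseval's identity moves the pairing to the physical side, where Hölder's inequality applies.
-/
theorem enorm_inner_le_lpn_mul_lpn (p p' : ℝ≥0∞) [p.HolderConjugate p'] (g a : L2 n) :
    ‖inner ℂ g a‖ₑ ≤ lpn p' g * lpn p a := by
  rw [← inner_fourierInv, L2.inner_def, mul_comm]
  refine (enorm_integral_le_lintegral_enorm _).trans ?_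
  have := lintegral_mul_le_eLpNorm_mul_eLpNorm (μ := volume) p p'
    (Lp.aestronglyMeasurable (𝓕⁻ a)).enorm (Lp.aestronglyMeasurable (𝓕⁻ g)).enorm
  simp only [eLpNorm_enorm] at this
  simpa [RCLike.inner_apply, enorm_mul, lpn] using this

/-- A scalar tester `w` is multiplied by the phase of `v = 𝓕⁻ a`. The product is bounded with
support of finite measure, hence in every `L^r`; in particular its Fourier transform is an
admissible `g`. -/
theorem lpn_le_of_forall_inner_le (p p' : ℝ≥0∞) [p.HolderConjugate p'] (a : L2 n) (M : ℝ≥0∞)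
    (h : ∀ g : L2 n, lpn p' g ≠ ⊤ → ‖inner ℂ g a‖ₑ ≤ M * lpn p' g) : lpn p a ≤ M := by
  set v : L2 n := 𝓕⁻ a with hv
  have hvm : Measurable v := (Lp.stronglyMeasurable v).measurable
  rw [lpn, ← hv, ← eLpNorm_enorm]
  refine eLpNorm_le_of_forall_lintegral_mul_le p p' hvm.enorm M fun w hw hR hfin => ?_
  obtain ⟨R, hR⟩ := hR
  set u : Rn n → ℂ := fun x => ((w x).toReal : ℂ) * (v x / ‖v x‖) with hu
  have hun : ∀ x, ‖u x‖ₑ ≤ w x := fun x => by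
    have : ‖v x / ‖v x‖‖ₑ ≤ 1 := by
      rw [← ofReal_norm, ← ENNReal.ofReal_one]
      apply ENNReal.ofReal_le_ofReal
      rw [norm_div, Complex.norm_real, norm_norm]
      exact div_self_le_one _
    calc ‖u x‖ₑ ≤ ‖((w x).toReal : ℂ)‖ₑ * 1 := by rw [hu]; simp only [enorm_mul]; gcongr
      _ = w x := by
        rw [mul_one, ← ofReal_norm, Complex.norm_real, Real.norm_of_nonneg ENNReal.toReal_nonneg,
          ENNReal.ofReal_toReal (ne_top_of_le_ne_top ENNReal.coe_ne_top (hR x))]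
  have hum : Measurable u := by
    have h1 := Complex.measurable_ofReal.comp hw.ennreal_toReal
    have h2 := Complex.measurable_ofReal.comp hvm.norm
    exact h1.mul (hvm.div h2)
  have hnorm : ∀ r, eLpNorm u r volume ≤ eLpNorm w r volume := fun r =>
    eLpNorm_mono_enorm fun x => by simpa using hun x
  have hmem : ∀ r, MemLp u r volume := by
    intro r
    have : MemLp u r (volume.restrict (Function.support w)) := by
      have : IsFiniteMeasure ((volume : Measure (Rn n)).restrict (Function.support w)) :=
        ⟨by simpa using hfin⟩
      refine MemLp.of_bound hum.aestronglyMeasurable R (ae_of_all _ fun x => ?_)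
      have := (hun x).trans (hR x)
      rwa [enorm_le_coe, ← NNReal.coe_le_coe, coe_nnnorm] at this
    rw [← memLp_indicator_iff_restrict (measurableSet_support hw)] at this
    have e : (Function.support w).indicator u = u := by
      funext x
      by_cases hx : x ∈ Function.support w
      · rw [indicator_of_mem hx]
      · rw [indicator_of_notMem hx, hu]
        simp [Function.notMem_support.1 hx]
    rwa [e] at this
  set g : L2 n := 𝓕 ((hmem 2).toLp u)
  have hg : 𝓕⁻ g = (hmem 2).toLp u := FourierTransform.fourierInv_fourier_eq _
  have hgn : lpn p' g = eLpNorm u p' volume := by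
    rw [lpn, hg]; exact eLpNorm_congr_ae (MemLp.coeFn_toLp _)
  have := h g (by rw [hgn]; exact (hmem p').2.ne)
  have e : ‖inner ℂ g a‖ₑ = ∫⁻ x, ‖v x‖ₑ * w x := by
    rw [← inner_fourierInv, hg, L2.inner_def]
    have : ∀ᵐ x, inner ℂ ((hmem 2).toLp u x) ((𝓕⁻ a : L2 n) x) =
        ((‖v x‖ * (w x).toReal : ℝ) : ℂ) := by
      filter_upwards [MemLp.coeFn_toLp (hmem 2)] with x hx
      rw [hx, ← hv, hu]
      simp only [RCLike.inner_apply, map_mul, map_div₀, Complex.conj_ofReal]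
      rcases eq_or_ne (v x) 0 with h0 | h0
      · simp [h0]
      · have h1 : (‖v x‖ : ℂ) ≠ 0 := by simpa using h0
        have h2 : v x * (starRingEnd ℂ) (v x) = (‖v x‖ : ℂ) ^ 2 := Complex.mul_conj' _
        push_cast
        field_simp
        linear_combination ((w x).toReal : ℂ) * h2
    rw [integral_congr_ae this, integral_complex_ofReal, ← ofReal_norm, Complex.norm_real,
      Real.norm_of_nonneg (by positivity), ofReal_integral_eq_lintegral_ofReal]
    · congr 1 with x
      rw [ENNReal.ofReal_mul (norm_nonneg _), ofReal_norm, 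
          ENNReal.ofReal_toReal (ne_top_of_le_ne_top ENNReal.coe_ne_top (hR x))]
    · have h3 := (L2.integrable_inner (𝕜 := ℂ) ((hmem 2).toLp u) (𝓕⁻ a : L2 n)).congr this
      simpa using h3.re
    · exact ae_of_all _ fun x => by positivity
  rw [e, hgn] at this
  exact this.trans (by gcongr; exact hnorm p')

/-- The `L^p` norm is the supremum of countably many continuous functions on `L²`. -/
theorem exists_seq_lpn_eq_iSup (n : ℕ) (p p' : ℝ≥0∞) [p.HolderConjugate p'] :
    ∃ g : ℕ → L2 n, (∀ i, lpn p' (g i) ≤ 1) ∧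
      ∀ a : L2 n, lpn p a = ⨆ i, ‖inner ℂ (g i) a‖ₑ := by
  have : Fact ((2 : ℝ≥0∞) ≠ ⊤) := ⟨by simp⟩
  -- The unit ball of `L^{p'}` is given the topology of `L²`, in which it is separable for every
  -- `p'`. Density in that topology is enough because the pairings are continuous on `L²`.
  set S : Set (L2 n) := {g | lpn p' g ≤ 1}
  have : Nonempty S := ⟨0, by simp [S, lpn_zero]⟩
  refine ⟨fun i => TopologicalSpace.denseSeq S i, fun i => (TopologicalSpace.denseSeq S i).2,
    fun a => le_antisymm ?_ ?_⟩
  · refine lpn_le_of_forall_inner_le p p' a _ fun g hg => ?_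
    have hS : ∀ g ∈ S, ‖inner ℂ g a‖ₑ ≤ ⨆ i, ‖inner ℂ (TopologicalSpace.denseSeq S i : L2 n) a‖ₑ := by
      intro g hg
      have hc : IsClosed {g : S | ‖inner ℂ (g : L2 n) a‖ₑ ≤
          ⨆ i, ‖inner ℂ (TopologicalSpace.denseSeq S i : L2 n) a‖ₑ} :=
        isClosed_le (by fun_prop) continuous_const
      have : (univ : Set S) ⊆ {g : S | ‖inner ℂ (g : L2 n) a‖ₑ ≤
          ⨆ i, ‖inner ℂ (TopologicalSpace.denseSeq S i : L2 n) a‖ₑ} := by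
        rw [← (TopologicalSpace.denseRange_denseSeq S).closure_range]
        refine hc.closure_subset_iff.2 ?_
        rintro _ ⟨i, rfl⟩
        exact le_iSup (fun i => ‖inner ℂ (TopologicalSpace.denseSeq S i : L2 n) a‖ₑ) i
      exact this (mem_univ ⟨g, hg⟩)
    -- A tester of norm zero cannot be normalized, but then its inverse transform vanishes almost
    -- everywhere.
    rcases eq_or_ne (lpn p' g) 0 with h0 | h0
    · have := enorm_inner_le_lpn_mul_lpn 2 2 (0 : L2 n) a
      have hp' : p' ≠ 0 := by
        have := ENNReal.HolderTriple.le p' p 1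
        positivity
      rw [lpn, eLpNorm_eq_zero_iff (Lp.aestronglyMeasurable _) hp'] at h0
      have hg0 : lpn 2 g = 0 := by
        rw [lpn, eLpNorm_eq_zero_iff (Lp.aestronglyMeasurable _) (by simp)]
        exact h0
      have := enorm_inner_le_lpn_mul_lpn 2 2 g a
      rw [hg0, zero_mul] at this
      exact this.trans zero_le
    set c := (lpn p' g).toReal
    have hc : 0 < c := ENNReal.toReal_pos h0 hg
    have hcg : lpn p' g = ‖(c : ℂ)‖ₑ := by
      rw [← ofReal_norm, Complex.norm_real, Real.norm_of_nonneg hc.le, ENNReal.ofReal_toReal hg]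
    have hmem : ((c⁻¹ : ℝ) : ℂ) • g ∈ S := by
      simp only [S, mem_ofPred_eq, lpn_smul, hcg, ← enorm_mul]
      rw [← Complex.ofReal_mul, inv_mul_cancel₀ hc.ne']
      simp
    have := hS _ hmem
    calc ‖inner ℂ g a‖ₑ = ‖inner ℂ (((c⁻¹ : ℝ) : ℂ) • g) a‖ₑ * ‖(c : ℂ)‖ₑ := by
          rw [inner_smul_left, Complex.conj_ofReal, ← enorm_mul, mul_right_comm,
            ← Complex.ofReal_mul, inv_mul_cancel₀ hc.ne']
          simp
      _ ≤ _ := by rw [hcg]; gcongr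
  · refine iSup_le fun i => ?_
    refine (enorm_inner_le_lpn_mul_lpn p p' _ a).trans ?_
    exact mul_le_of_le_one_left' (TopologicalSpace.denseSeq S i).2

theorem measurable_lpn (p p' : ℝ≥0∞) [p.HolderConjugate p'] :
    Measurable[borel (L2 n)] (lpn (n := n) p) := by
  borelize (L2 n)
  obtain ⟨g, -, hg⟩ := exists_seq_lpn_eq_iSup n p p'
  rw [show lpn (n := n) p = fun a => ⨆ i, ‖inner ℂ (g i) a‖ₑ from funext hg]
  refine Measurable.iSup fun i => ?_
  have : Continuous fun a : L2 n => ‖inner ℂ (g i) a‖ₑ := by fun_prop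
  exact this.measurable

end PhysicalNorm

/-! ### Schwartz multipliers on `L^p` -/

section KernelBound

variable {n : ℕ}

theorem _root_.SchwartzMap.isSymbol (m : 𝓢(Rn n, ℂ)) : IsSymbol (m : Rn n → ℂ) :=
  ⟨m.continuous.measurable, _, fun ξ => m.norm_le_seminorm ℝ ξ⟩

/-- The symbol of the translation by `y`. -/
def charSymbol (y ξ : Rn n) : ℂ := (Real.fourierChar (-(inner ℝ y ξ)) : ℂ)

theorem isSymbol_charSymbol (y : Rn n) : IsSymbol (charSymbol y) :=
  ⟨by
    have : Continuous (charSymbol y) := by unfold charSymbol; fun_prop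
    exact this.measurable, 1, fun ξ => (Circle.norm_coe _).le⟩

theorem measurePreserving_sub_const (y : Rn n) :
    MeasurePreserving (fun x : Rn n => x - y) volume volume :=
  measurePreserving_sub_right volume y

/-- Both sides are continuous on `L²`, so it is enough to compute the Fourier integral of a
translated Schwartz function. -/
theorem mulOp_charSymbol (y : Rn n) (a : L2 n) :
    mulOp (charSymbol y) a =
      𝓕 (Lp.compMeasurePreserving (fun x : Rn n => x - y) (measurePreserving_sub_const y)
        (𝓕⁻ a : L2 n)) := by
  suffices ∀ v : L2 n, mulOp (charSymbol y) (𝓕 v) =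
      𝓕 (Lp.compMeasurePreserving (fun x : Rn n => x - y) (measurePreserving_sub_const y) v) by
    have h := this (𝓕⁻ a)
    rwa [FourierTransform.fourier_fourierInv_eq] at h
  intro v
  refine DenseRange.induction_on (p := fun v : L2 n => mulOp (charSymbol y) (𝓕 v) =
      𝓕 (Lp.compMeasurePreserving (fun x : Rn n => x - y) (measurePreserving_sub_const y) v))
    (SchwartzMap.denseRange_toLpCLM (p := 2) ENNReal.ofNat_ne_top) v ?_ ?_
  · apply isClosed_eq
    · exact (mulOp (charSymbol y)).continuous.comp
        (Lp.fourierTransformₗᵢ (Rn n) ℂ).continuous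
    · exact (Lp.fourierTransformₗᵢ (Rn n) ℂ).continuous.comp
        (Lp.isometry_compMeasurePreserving (measurePreserving_sub_const y)).continuous
  · intro χ
    rw [SchwartzMap.toLpCLM_apply, SchwartzMap.toLp_fourier_eq]
    have e : Lp.compMeasurePreserving (fun x : Rn n => x - y) (measurePreserving_sub_const y)
        (χ.toLp 2) = (χ.compSubConstCLM ℂ y).toLp 2 := by
      apply Lp.ext
      filter_upwards [Lp.coeFn_compMeasurePreserving (χ.toLp 2) (measurePreserving_sub_const y),
        (χ.compSubConstCLM ℂ y).coeFn_toLp 2,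
        (measurePreserving_sub_const y).quasiMeasurePreserving.ae_eq_comp (χ.coeFn_toLp 2)]
        with x h₁ h₂ h₃
      rw [h₁, h₂, h₃]
      simp
    rw [e, SchwartzMap.toLp_fourier_eq]
    apply Lp.ext
    filter_upwards [coeFn_mulOp (isSymbol_charSymbol y) ((𝓕 χ).toLp 2), (𝓕 χ).coeFn_toLp 2,
      (𝓕 (χ.compSubConstCLM ℂ y)).coeFn_toLp 2] with ξ h₁ h₂ h₃
    rw [h₁, h₂, h₃, SchwartzMap.fourier_coe, SchwartzMap.fourier_coe, Real.fourier_eq,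
      Real.fourier_eq, ← integral_sub_right_eq_self _ y, ← integral_const_mul]
    congr 1 with x
    rw [charSymbol, inner_sub_left, SchwartzMap.compSubConstCLM_apply, Circle.smul_def,
      Circle.smul_def, smul_eq_mul, smul_eq_mul, ← mul_assoc, ← Circle.coe_mul,
      ← AddChar.map_add_eq_mul]
    congr 3
    ring

theorem lpn_mulOp_charSymbol (p : ℝ≥0∞) (y : Rn n) (a : L2 n) :
    lpn p (mulOp (charSymbol y) a) = lpn p a := by
  rw [mulOp_charSymbol, lpn, FourierTransform.fourierInv_fourier_eq, lpn,
    eLpNorm_congr_ae (Lp.coeFn_compMeasurePreserving _ (measurePreserving_sub_const y))]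
  exact eLpNorm_comp_measurePreserving (Lp.aestronglyMeasurable _) (measurePreserving_sub_const y)

/-- Fourier inversion writes `m` as a superposition of characters with the integrable density `𝓕⁻
m`, and Fubini's theorem moves the superposition outside the pairing. -/
theorem inner_mulOp_schwartzMap (m : 𝓢(Rn n, ℂ)) (g a : L2 n) :
    inner ℂ g (mulOp m a) =
      ∫ y, (𝓕⁻ m : 𝓢(Rn n, ℂ)) y * inner ℂ g (mulOp (charSymbol y) a) := by
  have hm : ∀ ξ, m ξ = ∫ y, charSymbol y ξ * (𝓕⁻ m : 𝓢(Rn n, ℂ)) y := by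
    intro ξ
    have : m = 𝓕 (𝓕⁻ m : 𝓢(Rn n, ℂ)) := (FourierTransform.fourier_fourierInv_eq m).symm
    conv_lhs => rw [this, SchwartzMap.fourier_coe, Real.fourier_eq]
    rfl
  have hint : Integrable (fun ξ => inner ℂ (g ξ) (a ξ)) volume := L2.integrable_inner g a
  calc inner ℂ g (mulOp m a)
      = ∫ ξ, ∫ y, charSymbol y ξ * (𝓕⁻ m : 𝓢(Rn n, ℂ)) y * inner ℂ (g ξ) (a ξ) := by
        rw [L2.inner_def]
        apply integral_congr_ae
        filter_upwards [coeFn_mulOp m.isSymbol a] with ξ e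
        rw [e, integral_mul_const, ← hm]
        simp only [RCLike.inner_apply]
        ring
    _ = ∫ y, ∫ ξ, charSymbol y ξ * (𝓕⁻ m : 𝓢(Rn n, ℂ)) y * inner ℂ (g ξ) (a ξ) := by
        apply integral_integral_swap
        have h := hint.mul_prod ((𝓕⁻ m : 𝓢(Rn n, ℂ)).integrable (μ := volume))
        have hc : Continuous fun z : Rn n × Rn n => charSymbol z.2 z.1 := by
          unfold charSymbol; fun_prop
        refine (h.bdd_mul (c := 1) hc.aestronglyMeasurable
          (ae_of_all _ fun z => (Circle.norm_coe _).le)).congr (ae_of_all _ fun z => ?_)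
        simp only [Function.uncurry]
        ring
    _ = _ := by
        congr 1 with y
        rw [L2.inner_def, ← integral_const_mul]
        apply integral_congr_ae
        filter_upwards [coeFn_mulOp (isSymbol_charSymbol y) a] with ξ e
        rw [e]
        simp only [RCLike.inner_apply]
        ring

/-- Young's inequality by duality: the multiplier averages translations, which preserve every `L^p`
norm. -/
theorem lpn_mulOp_schwartzMap_le (p p' : ℝ≥0∞) [p.HolderConjugate p'] (m : 𝓢(Rn n, ℂ))
    (a : L2 n) :
    lpn p (mulOp m a) ≤ (∫⁻ y, ‖(𝓕⁻ m : 𝓢(Rn n, ℂ)) y‖ₑ) * lpn p a := by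
  refine lpn_le_of_forall_inner_le p p' _ _ fun g hg => ?_
  rw [inner_mulOp_schwartzMap]
  refine (enorm_integral_le_lintegral_enorm _).trans ?_
  rw [mul_assoc, ← lintegral_mul_const _ (by fun_prop)]
  apply lintegral_mono
  intro y
  simp only
  rw [enorm_mul, mul_comm (lpn p a)]
  gcongr
  rw [← lpn_mulOp_charSymbol p y a]
  exact enorm_inner_le_lpn_mul_lpn p p' g _

end KernelBound

/-! ### Uniqueness of representing functions and the bound from `L¹` to `L^∞` -/

section Uniqueness

variable {n : ℕ}

theorem ae_eq_of_forall_schwartzMap {f g : Rn n → ℂ} (hf : LocallyIntegrable f volume)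
    (hg : LocallyIntegrable g volume)
    (h : ∀ χ : 𝓢(Rn n, ℂ), ∫ x, χ x * f x = ∫ x, χ x * g x) : f =ᵐ[volume] g := by
  refine ae_eq_of_integral_contDiff_smul_eq hf hg fun w hw hwc => ?_
  have h₁ : HasCompactSupport (Complex.ofRealCLM ∘ w) := hwc.comp_left rfl
  have h₂ : ContDiff ℝ ∞ (Complex.ofRealCLM ∘ w) := by fun_prop
  simpa using h (h₁.toSchwartzMap h₂)

/-- The Plancherel transform and the integral transform have the same pairings with Schwartz
functions, because both can be moved to the other factor. -/
theorem fourierInv_ae_eq {b : L2 n} (hb : Integrable b volume) :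
    (𝓕⁻ b : L2 n) =ᵐ[volume] 𝓕⁻ (b : Rn n → ℂ) := by
  have hcont : Continuous (𝓕⁻ (b : Rn n → ℂ)) :=
    VectorFourier.fourierIntegral_continuous (L := -innerₗ (Rn n)) Real.continuous_fourierChar
      (by simp only [LinearMap.neg_apply, innerₗ_apply_apply]; fun_prop) hb
  refine ae_eq_of_forall_schwartzMap ((Lp.memLp _).locallyIntegrable (by norm_num))
    hcont.locallyIntegrable fun χ => ?_
  have h1 : ∫ x, χ x * (𝓕⁻ b : L2 n) x = ∫ x, (𝓕⁻ χ : 𝓢(Rn n, ℂ)) x * b x := by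
    have h := congrArg (fun T : 𝓢'(Rn n, ℂ) => T χ) (Lp.fourierInv_toTemperedDistribution_eq b)
    simp only [TemperedDistribution.fourierInv_apply, Lp.toTemperedDistribution_apply,
      smul_eq_mul] at h
    exact h.symm
  rw [h1, SchwartzMap.fourierInv_coe]
  have h2 := VectorFourier.integral_fourierIntegral_smul_eq_flip (μ := volume) (ν := volume)
    (L := -innerₗ (Rn n))
    Real.continuous_fourierChar
    (by simp only [LinearMap.neg_apply, innerₗ_apply_apply]; fun_prop)
    (χ.integrable (μ := volume)) hb
  have h3 : (-innerₗ (Rn n)).flip = -innerₗ (Rn n) := by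
    ext x y; simp [real_inner_comm]
  rw [h3] at h2
  exact h2

theorem lpn_top_le (b : L2 n) : lpn ⊤ b ≤ ∫⁻ ξ, ‖b ξ‖ₑ := by
  rcases eq_or_ne (∫⁻ ξ, ‖b ξ‖ₑ) ⊤ with h | h
  · rw [h]; exact le_top
  have hb : Integrable b volume := ⟨Lp.aestronglyMeasurable _, h.lt_top⟩
  rw [lpn, eLpNorm_congr_ae (fourierInv_ae_eq hb), eLpNorm_exponent_top]
  refine essSup_le_of_ae_le _ (ae_of_all _ fun x => ?_)
  simp only
  rw [Real.fourierInv_eq]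
  refine (enorm_integral_le_lintegral_enorm _).trans (le_of_eq ?_)
  congr 1 with ξ
  rw [Circle.smul_def, smul_eq_mul, enorm_mul, ← ofReal_norm, Circle.norm_coe]
  simp

/-- The `L^p` norm lies below the sum of the `L²` norm, controlled by Plancherel's theorem, and the
`L^∞` norm, controlled by the `L¹` norm in frequency and the Cauchy-Schwarz inequality. -/
theorem lpn_mulOp_le_mul_enorm {p : ℝ≥0∞} (hp : 2 ≤ p) {m : Rn n → ℂ} (hm : IsSymbol m)
    (h1 : ∀ ξ, ‖m ξ‖ ≤ 1) (a : L2 n) :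
    lpn p (mulOp m a) ≤ (1 + eLpNorm m 2 volume) * ‖a‖ₑ := by
  refine (eLpNorm_le_add_eLpNorm_top _ (by norm_num) hp).trans ?_
  rw [add_mul, one_mul]
  refine add_le_add ?_ ((lpn_top_le _).trans ?_)
  · rw [← lpn, lpn_two, ← ofReal_norm, ← ofReal_norm]
    exact ENNReal.ofReal_le_ofReal ((norm_mulOp_le hm h1 a).trans (one_mul _).le)
  · have := lintegral_mul_le_eLpNorm_mul_eLpNorm (μ := volume) 2 2
      hm.measurable.aestronglyMeasurable.enorm (Lp.aestronglyMeasurable a).enorm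
    simp only [eLpNorm_enorm] at this
    rw [← Lp.enorm_def] at this
    refine le_trans (le_of_eq ?_) this
    apply lintegral_congr_ae
    filter_upwards [coeFn_mulOp hm a] with ξ e
    rw [e, enorm_mul]

end Uniqueness

/-! ### Littlewood-Paley cutoffs: uniform bounds and Bernstein's inequality -/

section Blocks

variable {n : ℕ} {Φ : Rn n → ℝ}

/-- The symbol of the projector to the frequencies `≲ 2^l`. -/
def low (Φ : Rn n → ℝ) (l : ℕ) (ξ : Rn n) : ℂ := (Φ (((2 : ℝ) ^ l)⁻¹ • ((2 * Real.pi) • ξ)) : ℝ)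

/-- The symbols of the Littlewood-Paley projectors. -/
def sym (Φ : Rn n → ℝ) : ℕ → Rn n → ℂ
  | 0 => low Φ 0
  | k + 1 => fun ξ => low Φ (k + 1) ξ - low Φ k ξ

/-- The symbol of `(I - Δ)^{s/2}`. -/
def wt (s : ℝ) (ξ : Rn n) : ℂ := ((1 + ‖(2 * Real.pi) • ξ‖ ^ 2) ^ (s / 2) : ℝ)

theorem norm_scale (l : ℕ) (x : Rn n) : ‖((2 : ℝ) ^ l)⁻¹ • x‖ = ‖x‖ / 2 ^ l := by
  rw [norm_smul, norm_inv, norm_pow, Real.norm_ofNat, div_eq_inv_mul]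

theorem low_eq_one (hΦ : IsCutoff Φ) {l : ℕ} {ξ : Rn n} (h : ‖(2 * Real.pi) • ξ‖ ≤ 2 ^ l) :
    low Φ l ξ = 1 := by
  rw [low, hΦ.eq_one _ (by rw [norm_scale, div_le_one (by positivity)]; exact h)]
  simp

theorem low_eq_zero (hΦ : IsCutoff Φ) {l : ℕ} {ξ : Rn n}
    (h : 2 ^ (l + 1) < ‖(2 * Real.pi) • ξ‖) : low Φ l ξ = 0 := by
  have h0 : Φ (((2 : ℝ) ^ l)⁻¹ • ((2 * Real.pi) • ξ)) = 0 := by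
    refine image_eq_zero_of_notMem_tsupport fun h' => ?_
    have := hΦ.support_subset h'
    rw [mem_closedBall_zero_iff, norm_scale, div_le_iff₀ (by positivity)] at this
    rw [pow_succ'] at h
    linarith
  rw [low, h0, Complex.ofReal_zero]

theorem norm_low_le (hΦ : IsCutoff Φ) (l : ℕ) (ξ : Rn n) : ‖low Φ l ξ‖ ≤ 1 := by
  rw [low, Complex.norm_real, Real.norm_of_nonneg (hΦ.mem_Icc _).1]
  exact (hΦ.mem_Icc _).2

theorem contDiff_low (hΦ : IsCutoff Φ) (l : ℕ) : ContDiff ℝ ∞ (low Φ l) := by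
  have := hΦ.smooth
  have h2 : ContDiff ℝ ∞ fun ξ : Rn n => Φ (((2 : ℝ) ^ l)⁻¹ • ((2 * Real.pi) • ξ)) := by fun_prop
  exact Complex.ofRealCLM.contDiff.comp h2

theorem isSymbol_low (hΦ : IsCutoff Φ) (l : ℕ) : IsSymbol (low Φ l) :=
  ⟨(contDiff_low hΦ l).continuous.measurable, 1, norm_low_le hΦ l⟩

theorem norm_two_pi_smul (ξ : Rn n) : ‖(2 * Real.pi) • ξ‖ = 2 * Real.pi * ‖ξ‖ := by
  rw [norm_smul, Real.norm_of_nonneg (by positivity)]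

/-- The cutoff lives where `2π‖ξ‖ ≤ 2^(l+1)`, and `2π > 2`. -/
theorem support_low_subset (hΦ : IsCutoff Φ) (l : ℕ) :
    Function.support (low Φ l) ⊆ Metric.closedBall 0 (2 ^ l) := by
  intro ξ hξ
  rw [mem_closedBall_zero_iff]
  by_contra! h
  refine hξ (low_eq_zero hΦ ?_)
  rw [norm_two_pi_smul, pow_succ']
  have := Real.pi_gt_three
  have h0 : (0 : ℝ) < 2 ^ l := by positivity
  nlinarith

theorem hasCompactSupport_low (hΦ : IsCutoff Φ) (l : ℕ) : HasCompactSupport (low Φ l) :=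
  HasCompactSupport.of_support_subset_isCompact (isCompact_closedBall 0 _)
    (support_low_subset hΦ l)

/-- `low Φ l` as a Schwartz function. -/
def lowSchwartz (hΦ : IsCutoff Φ) (l : ℕ) : 𝓢(Rn n, ℂ) :=
  (hasCompactSupport_low hΦ l).toSchwartzMap (contDiff_low hΦ l)

theorem coe_lowSchwartz (hΦ : IsCutoff Φ) (l : ℕ) : ⇑(lowSchwartz hΦ l) = low Φ l := rfl

/-- The kernels are dilations of one another that preserve the `L¹` norm. This is what makes the
bounds for the projectors uniform in the frequency. -/
theorem lintegral_fourierInv_low (hΦ : IsCutoff Φ) (l : ℕ) :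
    ∫⁻ y, ‖(𝓕⁻ (lowSchwartz hΦ l) : 𝓢(Rn n, ℂ)) y‖ₑ =
      ∫⁻ y, ‖(𝓕⁻ (lowSchwartz hΦ 0) : 𝓢(Rn n, ℂ)) y‖ₑ := by
  have h2 : (2 : ℝ) ^ l ≠ 0 := by positivity
  have key : ∀ y, (𝓕⁻ (lowSchwartz hΦ l) : 𝓢(Rn n, ℂ)) y =
      ((2 : ℝ) ^ l) ^ n • (𝓕⁻ (lowSchwartz hΦ 0) : 𝓢(Rn n, ℂ)) ((2 : ℝ) ^ l • y) := by
    intro y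
    rw [SchwartzMap.fourierInv_coe, SchwartzMap.fourierInv_coe, Real.fourierInv_eq,
      Real.fourierInv_eq, coe_lowSchwartz, coe_lowSchwartz]
    have := Measure.integral_comp_inv_smul (volume : Measure (Rn n))
      (fun ξ => Real.fourierChar (inner ℝ ξ ((2 : ℝ) ^ l • y)) • low Φ 0 ξ) ((2 : ℝ) ^ l)
    rw [finrank_euclideanSpace_fin, abs_of_pos (by positivity)] at this
    rw [← this]
    congr 1 with ξ
    rw [inner_smul_left, inner_smul_right]
    congr 1
    · simp [h2]
    · simp only [low]
      rw [smul_comm (2 * Real.pi)]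
      simp
  simp_rw [key]
  set K := (𝓕⁻ (lowSchwartz hΦ 0) : 𝓢(Rn n, ℂ))
  have hK : Measurable fun y => ‖K y‖ₑ := K.continuous.measurable.enorm
  have hsm : Measurable fun y : Rn n => (2 : ℝ) ^ l • y := by fun_prop
  have h3 := lintegral_map (μ := volume) hK hsm
  rw [Measure.map_addHaar_smul volume h2, finrank_euclideanSpace_fin, lintegral_smul_measure] at h3
  have h4 : ∀ y, ‖((2 : ℝ) ^ l) ^ n • K ((2 : ℝ) ^ l • y)‖ₑ =
      ENNReal.ofReal (((2 : ℝ) ^ l) ^ n) * ‖K ((2 : ℝ) ^ l • y)‖ₑ := by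
    intro y
    rw [enorm_smul, ← ofReal_norm, Real.norm_of_nonneg (by positivity)]
  simp_rw [h4]
  rw [lintegral_const_mul' _ _ ENNReal.ofReal_ne_top, ← h3, smul_eq_mul, ← mul_assoc,
    ← ENNReal.ofReal_mul (by positivity), abs_of_pos (by positivity),
    mul_inv_cancel₀ (by positivity)]
  simp

/-- Littlewood-Paley cutoffs are uniformly bounded in `L^p`. -/
theorem exists_lpn_low_le (hΦ : IsCutoff Φ) :
    ∃ C : ℝ≥0, ∀ (p p' : ℝ≥0∞) [p.HolderConjugate p'] (l : ℕ) (a : L2 n),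
      lpn p (mulOp (low Φ l) a) ≤ C * lpn p a := by
  refine ⟨(∫⁻ y, ‖(𝓕⁻ (lowSchwartz hΦ 0) : 𝓢(Rn n, ℂ)) y‖ₑ).toNNReal, fun p p' _ l a => ?_⟩
  rw [ENNReal.coe_toNNReal (SchwartzMap.integrable _).2.ne, ← lintegral_fourierInv_low hΦ l]
  exact lpn_mulOp_schwartzMap_le p p' (lowSchwartz hΦ l) a

/-- The `L²` norm of the symbol is at most the square root of the volume of a ball of radius `2^l`.
The cruder power `2^{nl}` is sufficient: it enters only a lossy embedding and a qualitative
finiteness, never the final powers of `2^k`. -/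
theorem exists_bernstein (hΦ : IsCutoff Φ) :
    ∃ C : ℝ≥0, ∀ (p : ℝ≥0∞), 2 ≤ p → ∀ (l : ℕ) (a : L2 n),
      lpn p (mulOp (low Φ l) a) ≤ C * 2 ^ (n * l) * ‖a‖ₑ := by
  set V := volume (Metric.closedBall (0 : Rn n) 1)
  have hV : V ≠ ⊤ := measure_closedBall_lt_top.ne
  refine ⟨(2 + V).toNNReal, fun p hp l a => (lpn_mulOp_le_mul_enorm hp (isSymbol_low hΦ l)
    (norm_low_le hΦ l) a).trans ?_⟩
  gcongr
  rw [ENNReal.coe_toNNReal (by simp [hV])]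
  have hone : (1 : ℝ≥0∞) ≤ 2 ^ (n * l) := one_le_pow₀ (by norm_num)
  have h1 : eLpNorm (low Φ l) 2 volume ≤ (2 ^ (n * l) * V) ^ (1 / 2 : ℝ) := by
    calc eLpNorm (low Φ l) 2 volume
        ≤ eLpNorm ((Metric.closedBall (0 : Rn n) (2 ^ l)).indicator fun _ => (1 : ℝ)) 2 volume := by
          refine eLpNorm_mono fun ξ => ?_
          by_cases hξ : ξ ∈ Metric.closedBall (0 : Rn n) (2 ^ l)
          · rw [indicator_of_mem hξ, norm_one]; exact norm_low_le hΦ l ξ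
          · rw [Function.notMem_support.1 fun h => hξ (support_low_subset hΦ l h)]
            simp
      _ = _ := by
          rw [eLpNorm_indicator_const Metric.isClosed_closedBall.measurableSet (by simp) (by simp),
            Measure.addHaar_closedBall' _ _ (by positivity), finrank_euclideanSpace_fin, ← pow_mul,
            mul_comm l n, ENNReal.ofReal_pow (by norm_num)]
          simp [V]
  have h2 : ((2 : ℝ≥0∞) ^ (n * l) * V) ^ (1 / 2 : ℝ) ≤ 1 + 2 ^ (n * l) * V := by
    rcases le_total ((2 : ℝ≥0∞) ^ (n * l) * V) 1 with h | h
    · exact (ENNReal.rpow_le_one h (by norm_num)).trans le_self_add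
    · calc _ ≤ ((2 : ℝ≥0∞) ^ (n * l) * V) ^ (1 : ℝ) :=
          ENNReal.rpow_le_rpow_of_exponent_le h (by norm_num)
        _ ≤ _ := by rw [ENNReal.rpow_one]; exact le_add_self
  calc 1 + eLpNorm (low Φ l) 2 volume ≤ 1 + (1 + 2 ^ (n * l) * V) := by gcongr; exact h1.trans h2
    _ = 2 + V * 2 ^ (n * l) := by ring
    _ ≤ 2 * 2 ^ (n * l) + V * 2 ^ (n * l) := by
      gcongr; exact le_mul_of_one_le_right' hone
    _ = _ := by ring

end Blocks

/-! ### Almost orthogonality of the blocks -/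

section Blocks

variable {n : ℕ} {Φ : Rn n → ℝ}

theorem sum_sym (Φ : Rn n → ℝ) (l : ℕ) (ξ : Rn n) :
    ∑ i ∈ Finset.range (l + 1), sym Φ i ξ = low Φ l ξ := by
  induction l with
  | zero => simp [sym]
  | succ l ih => rw [Finset.sum_range_succ, ih, sym]; ring

theorem contDiff_sym (hΦ : IsCutoff Φ) (k : ℕ) : ContDiff ℝ ∞ (sym Φ k) := by
  cases k with
  | zero => exact contDiff_low hΦ 0
  | succ k => exact (contDiff_low hΦ (k + 1)).sub (contDiff_low hΦ k)

theorem norm_sym_le (hΦ : IsCutoff Φ) (k : ℕ) (ξ : Rn n) : ‖sym Φ k ξ‖ ≤ 1 := by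
  cases k with
  | zero => exact norm_low_le hΦ 0 ξ
  | succ k =>
    simp only [sym, low]
    rw [← Complex.ofReal_sub, Complex.norm_real, Real.norm_eq_abs]
    have h1 := hΦ.mem_Icc (((2 : ℝ) ^ (k + 1))⁻¹ • ((2 * Real.pi) • ξ))
    have h2 := hΦ.mem_Icc (((2 : ℝ) ^ k)⁻¹ • ((2 * Real.pi) • ξ))
    exact abs_sub_le_of_nonneg_of_le h1.1 h1.2 h2.1 h2.2

theorem isSymbol_sym (hΦ : IsCutoff Φ) (k : ℕ) : IsSymbol (sym Φ k) :=
  ⟨(contDiff_sym hΦ k).continuous.measurable, 1, norm_sym_le hΦ k⟩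

theorem conj_sym (k : ℕ) (ξ : Rn n) : (starRingEnd ℂ) (sym Φ k ξ) = sym Φ k ξ := by
  cases k with
  | zero => exact Complex.conj_ofReal _
  | succ k => simp [sym, low, Complex.conj_ofReal]

theorem le_of_sym_ne_zero (hΦ : IsCutoff Φ) {k : ℕ} {ξ : Rn n} (h : sym Φ k ξ ≠ 0) :
    ‖(2 * Real.pi) • ξ‖ ≤ 2 ^ (k + 1) := by
  by_contra! hlt
  cases k with
  | zero => exact h (low_eq_zero hΦ hlt)
  | succ k =>
    refine h ?_
    simp only [sym]
    rw [low_eq_zero hΦ hlt, low_eq_zero hΦ, sub_zero]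
    exact (pow_le_pow_right₀ (by norm_num) (by omega)).trans_lt hlt

theorem lt_of_sym_ne_zero (hΦ : IsCutoff Φ) {k : ℕ} {ξ : Rn n} (h : sym Φ (k + 1) ξ ≠ 0) :
    2 ^ k < ‖(2 * Real.pi) • ξ‖ := by
  by_contra! hle
  refine h ?_
  simp only [sym]
  rw [low_eq_one hΦ hle, low_eq_one hΦ, sub_self]
  exact hle.trans (pow_le_pow_right₀ (by norm_num) (by omega))

theorem le_succ_of_sym_ne_zero (hΦ : IsCutoff Φ) {i k : ℕ} {ξ : Rn n} (hi : sym Φ i ξ ≠ 0)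
    (hk : sym Φ k ξ ≠ 0) : k ≤ i + 1 := by
  cases k with
  | zero => omega
  | succ k =>
    have := (lt_of_sym_ne_zero hΦ hk).trans_le (le_of_sym_ne_zero hΦ hi)
    rw [pow_lt_pow_iff_right₀ (by norm_num)] at this
    omega

theorem low_mul_sym (hΦ : IsCutoff Φ) {k l : ℕ} (h : k + 1 ≤ l) (ξ : Rn n) :
    low Φ l ξ * sym Φ k ξ = sym Φ k ξ := by
  by_cases h0 : sym Φ k ξ = 0
  · rw [h0, mul_zero]
  · rw [low_eq_one hΦ, one_mul]
    exact (le_of_sym_ne_zero hΦ h0).trans (pow_le_pow_right₀ (by norm_num) h)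

/-- The indices of the Littlewood-Paley blocks that meet the block of index `k`. -/
def nbr (k : ℕ) : Finset ℕ := Finset.Icc (k - 1) (k + 1)

theorem mem_nbr {i k : ℕ} : i ∈ nbr k ↔ i ≤ k + 1 ∧ k ≤ i + 1 := by
  rw [nbr, Finset.mem_Icc]; omega

theorem mem_nbr_of_sym_ne_zero (hΦ : IsCutoff Φ) {i k : ℕ} {ξ : Rn n} (hi : sym Φ i ξ ≠ 0)
    (hk : sym Φ k ξ ≠ 0) : i ∈ nbr k :=
  mem_nbr.2 ⟨le_succ_of_sym_ne_zero hΦ hk hi, le_succ_of_sym_ne_zero hΦ hi hk⟩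

theorem card_nbr_le (k : ℕ) : (nbr k).card ≤ 3 := by
  rw [nbr, Nat.card_Icc]; omega

/-- Where block `k` is nonzero, only neighbouring symbols survive in the telescoping sum for `low Φ
(k + 1)`, which equals `1` there. -/
theorem sum_nbr_sym_mul_sym (hΦ : IsCutoff Φ) (k : ℕ) (ξ : Rn n) :
    ∑ i ∈ nbr k, sym Φ i ξ * sym Φ k ξ = sym Φ k ξ := by
  rw [← Finset.sum_mul]
  by_cases h0 : sym Φ k ξ = 0
  · rw [h0, mul_zero]
  · have : ∑ i ∈ nbr k, sym Φ i ξ = ∑ i ∈ Finset.range (k + 1 + 1), sym Φ i ξ := by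
      refine Finset.sum_subset (fun i hi => ?_) fun i _ hi => ?_
      · rw [Finset.mem_range]; have := (mem_nbr.1 hi).1; omega
      · by_contra h
        exact hi (mem_nbr_of_sym_ne_zero hΦ h h0)
    rw [this, sum_sym, low_mul_sym hΦ le_rfl]

theorem isSymbol_sum {ι : Type*} (s : Finset ι) {m : ι → Rn n → ℂ} (h : ∀ i, IsSymbol (m i)) :
    IsSymbol fun ξ => ∑ i ∈ s, m i ξ := by
  classical
  induction s using Finset.induction_on with
  | empty => simpa using IsSymbol.const 0
  | insert i s hi ih => simp only [Finset.sum_insert hi]; exact (h i).add ih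

theorem mulOp_sum {ι : Type*} (s : Finset ι) {m : ι → Rn n → ℂ} (h : ∀ i, IsSymbol (m i))
    (a : L2 n) : mulOp (fun ξ => ∑ i ∈ s, m i ξ) a = ∑ i ∈ s, mulOp (m i) a := by
  classical
  induction s using Finset.induction_on with
  | empty => simpa using mulOp_zero a
  | insert i s hi ih =>
    simp only [Finset.sum_insert hi]
    rw [mulOp_add (h i) (isSymbol_sum s h), ih]

theorem sum_nbr_mulOp_sym (hΦ : IsCutoff Φ) (k : ℕ) (a : L2 n) :
    ∑ i ∈ nbr k, mulOp (sym Φ i) (mulOp (sym Φ k) a) = mulOp (sym Φ k) a := by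
  simp_rw [fun i => mulOp_mulOp (isSymbol_sym hΦ i) (isSymbol_sym hΦ k) a]
  rw [← mulOp_sum _ fun i => (isSymbol_sym hΦ i).mul (isSymbol_sym hΦ k)]
  simp_rw [sum_nbr_sym_mul_sym hΦ]

theorem mulOp_sym_mulOp_sym_eq_zero (hΦ : IsCutoff Φ) {i k : ℕ} (h : i ∉ nbr k) (a : L2 n) :
    mulOp (sym Φ i) (mulOp (sym Φ k) a) = 0 := by
  rw [mulOp_mulOp (isSymbol_sym hΦ i) (isSymbol_sym hΦ k)]
  have : (fun ξ => sym Φ i ξ * sym Φ k ξ) = fun _ => 0 := by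
    funext ξ
    by_contra h'
    exact h (mem_nbr_of_sym_ne_zero hΦ (left_ne_zero_of_mul h') (right_ne_zero_of_mul h'))
  rw [this, mulOp_zero]

theorem exists_lpn_sym_le (hΦ : IsCutoff Φ) :
    ∃ C : ℝ≥0, ∀ (p p' : ℝ≥0∞) [p.HolderConjugate p'] (k : ℕ) (a : L2 n),
      lpn p (mulOp (sym Φ k) a) ≤ C * lpn p a := by
  obtain ⟨C, hC⟩ := exists_lpn_low_le hΦ
  refine ⟨C + C, fun p p' hpp k a => ?_⟩
  have hp := ENNReal.HolderTriple.le p p' 1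
  cases k with
  | zero =>
    refine (hC p p' 0 a).trans ?_
    gcongr
    exact le_self_add
  | succ k =>
    have : mulOp (sym Φ (k + 1)) a = mulOp (low Φ (k + 1)) a - mulOp (low Φ k) a :=
      mulOp_sub (isSymbol_low hΦ _) (isSymbol_low hΦ _) a
    rw [this, sub_eq_add_neg]
    refine (lpn_add_le hp _ _).trans ?_
    rw [lpn_neg]
    push_cast
    rw [add_mul]
    exact add_le_add (hC p p' _ a) (hC p p' _ a)

theorem exists_bernstein_sym (hΦ : IsCutoff Φ) :
    ∃ C : ℝ≥0, ∀ (p : ℝ≥0∞), 2 ≤ p → ∀ (k : ℕ) (a : L2 n),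
      lpn p (mulOp (sym Φ k) a) ≤ C * 2 ^ (n * k) * ‖a‖ₑ := by
  obtain ⟨C, hC⟩ := exists_bernstein hΦ
  refine ⟨C * 2 ^ n, fun p hp k a => ?_⟩
  have h1 : mulOp (sym Φ k) a = mulOp (low Φ (k + 1)) (mulOp (sym Φ k) a) := by
    rw [mulOp_mulOp (isSymbol_low hΦ _) (isSymbol_sym hΦ k)]
    simp_rw [low_mul_sym hΦ le_rfl]
  rw [h1]
  refine (hC p hp (k + 1) _).trans ?_
  have h2 : ‖mulOp (sym Φ k) a‖ₑ ≤ ‖a‖ₑ := by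
    rw [← ofReal_norm, ← ofReal_norm]
    exact ENNReal.ofReal_le_ofReal
      ((norm_mulOp_le (isSymbol_sym hΦ k) (norm_sym_le hΦ k) a).trans (one_mul _).le)
  calc (C : ℝ≥0∞) * 2 ^ (n * (k + 1)) * ‖mulOp (sym Φ k) a‖ₑ ≤ C * 2 ^ (n * (k + 1)) * ‖a‖ₑ := by
        gcongr
    _ = _ := by push_cast; rw [mul_add, mul_one, pow_add]; ring

/-- All blocks that are nonzero at `ξ` are neighbours of any one of them, and a block has at most
three neighbours including itself. -/
theorem tsum_indicator_sym_le (hΦ : IsCutoff Φ) (ξ : Rn n) :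
    ∑' k, (if sym Φ k ξ ≠ 0 then (1 : ℝ≥0∞) else 0) ≤ 3 := by
  by_cases h : ∃ k, sym Φ k ξ ≠ 0
  · obtain ⟨k, hk⟩ := h
    rw [tsum_eq_sum (s := nbr k)]
    · calc _ ≤ ∑ i ∈ nbr k, (1 : ℝ≥0∞) := Finset.sum_le_sum fun i _ => by split_ifs <;> simp
        _ ≤ 3 := by
          simp only [Finset.sum_const, nsmul_eq_mul, mul_one]
          exact_mod_cast card_nbr_le k
    · intro i hi
      rw [if_neg]
      intro h'
      exact hi (mem_nbr_of_sym_ne_zero hΦ h' hk)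
  · push Not at h
    simp [h]

/-- The symbols sum to `1` with at most three nonzero terms, so the Cauchy-Schwarz inequality bounds
the sum of squares from below. -/
theorem one_le_tsum_sym_sq (hΦ : IsCutoff Φ) (ξ : Rn n) : 1 ≤ 3 * ∑' k, ‖sym Φ k ξ‖ₑ ^ 2 := by
  obtain ⟨l, hl⟩ := pow_unbounded_of_one_lt ‖(2 * Real.pi) • ξ‖ (one_lt_two (α := ℝ))
  have h1 : ∑ i ∈ Finset.range (l + 1), sym Φ i ξ = 1 := by
    rw [sum_sym, low_eq_one hΦ hl.le]
  obtain ⟨k, -, hk⟩ := Finset.exists_ne_zero_of_sum_ne_zero (h1.trans_ne one_ne_zero)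
  have h2 : ∑ i ∈ Finset.range (l + 1), ‖sym Φ i ξ‖ ≤ ∑ i ∈ nbr k, ‖sym Φ i ξ‖ := by
    rw [← Finset.sum_filter_ne_zero]
    refine Finset.sum_le_sum_of_subset_of_nonneg (fun i hi => ?_) fun _ _ _ => norm_nonneg _
    exact mem_nbr_of_sym_ne_zero hΦ (norm_ne_zero_iff.1 (Finset.mem_filter.1 hi).2) hk
  have h3 : 1 ≤ ∑ i ∈ nbr k, ‖sym Φ i ξ‖ := by
    refine le_trans ?_ h2
    rw [← norm_one (α := ℂ), ← h1]
    exact norm_sum_le _ _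
  have h4 : 1 ≤ 3 * ∑ i ∈ nbr k, ‖sym Φ i ξ‖ ^ 2 := by
    have h5 := sq_sum_le_card_mul_sum_sq (s := nbr k) (f := fun i => ‖sym Φ i ξ‖)
    have h6 : ((nbr k).card : ℝ) ≤ 3 := by exact_mod_cast card_nbr_le k
    have h7 : 0 ≤ ∑ i ∈ nbr k, ‖sym Φ i ξ‖ ^ 2 := Finset.sum_nonneg fun i _ => sq_nonneg _
    nlinarith
  calc (1 : ℝ≥0∞) ≤ ENNReal.ofReal (3 * ∑ i ∈ nbr k, ‖sym Φ i ξ‖ ^ 2) := by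
        rw [← ENNReal.ofReal_one]; exact ENNReal.ofReal_le_ofReal h4
    _ = 3 * ∑ i ∈ nbr k, ‖sym Φ i ξ‖ₑ ^ 2 := by
        rw [ENNReal.ofReal_mul (by norm_num), ENNReal.ofReal_sum_of_nonneg fun i _ => sq_nonneg _]
        simp_rw [ENNReal.ofReal_pow (norm_nonneg _), ofReal_norm]
        simp
    _ ≤ _ := by gcongr; exact ENNReal.sum_le_tsum _

theorem enorm_sq_eq_lintegral (a : L2 n) : ‖a‖ₑ ^ 2 = ∫⁻ ξ, ‖a ξ‖ₑ ^ 2 := by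
  rw [Lp.enorm_def, eLpNorm_eq_lintegral_rpow_enorm_toReal (by simp) (by simp),
    ← ENNReal.rpow_natCast, ← ENNReal.rpow_mul]
  simp

/-- At each frequency at most three of the multipliers act, so the sum costs a factor `3`. -/
theorem tsum_enorm_mulOp_sq_le (hΦ : IsCutoff Φ) {m : ℕ → Rn n → ℂ} (hm : ∀ k, IsSymbol (m k))
    {C : ℝ≥0} (hC : ∀ k ξ, ‖m k ξ‖ₑ ≤ C) (h0 : ∀ k ξ, sym Φ k ξ = 0 → m k ξ = 0) (a : L2 n) :
    ∑' k, ‖mulOp (m k) a‖ₑ ^ 2 ≤ 3 * C ^ 2 * ‖a‖ₑ ^ 2 := by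
  have ha : Measurable a := (Lp.stronglyMeasurable a).measurable
  calc ∑' k, ‖mulOp (m k) a‖ₑ ^ 2
      ≤ ∑' k, ∫⁻ ξ, (if sym Φ k ξ ≠ 0 then (1 : ℝ≥0∞) else 0) * (C ^ 2 * ‖a ξ‖ₑ ^ 2) := by
        refine ENNReal.tsum_le_tsum fun k => ?_
        rw [enorm_sq_eq_lintegral]
        apply lintegral_mono_ae
        filter_upwards [coeFn_mulOp (hm k) a] with ξ e
        rw [e, enorm_mul, mul_pow]
        by_cases h : sym Φ k ξ = 0
        · simp [h0 k ξ h]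
        · rw [if_pos h, one_mul]
          gcongr
          exact hC k ξ
    _ = ∫⁻ ξ, ∑' k, (if sym Φ k ξ ≠ 0 then (1 : ℝ≥0∞) else 0) * (C ^ 2 * ‖a ξ‖ₑ ^ 2) := by
        rw [lintegral_tsum]
        intro k
        have : MeasurableSet {ξ | sym Φ k ξ ≠ 0} :=
          ((isSymbol_sym hΦ k).measurable (measurableSet_singleton 0)).compl
        exact ((Measurable.ite this measurable_const measurable_const).mul
          (by fun_prop)).aemeasurable
    _ ≤ ∫⁻ ξ, 3 * (C ^ 2 * ‖a ξ‖ₑ ^ 2) := by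
        apply lintegral_mono
        intro ξ
        simp only
        rw [ENNReal.tsum_mul_right]
        gcongr
        exact tsum_indicator_sym_le hΦ ξ
    _ = _ := by
        simp_rw [← mul_assoc]
        rw [lintegral_const_mul _ (by fun_prop), enorm_sq_eq_lintegral]

theorem lintegral_le_tsum_sym (hΦ : IsCutoff Φ) {F : Rn n → ℝ≥0∞} (hF : AEMeasurable F volume) :
    ∫⁻ ξ, F ξ ≤ 3 * ∑' k, ∫⁻ ξ, ‖sym Φ k ξ‖ₑ ^ 2 * F ξ := by
  have hm : ∀ k, AEMeasurable (fun ξ => ‖sym Φ k ξ‖ₑ ^ 2 * F ξ) volume := fun k =>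
    (((isSymbol_sym hΦ k).measurable.enorm.pow_const 2).aemeasurable).mul hF
  rw [← lintegral_tsum hm, ← lintegral_const_mul' _ _ (by simp)]
  refine lintegral_mono fun ξ => ?_
  simp only
  rw [ENNReal.tsum_mul_right, ← mul_assoc]
  exact le_mul_of_one_le_left' (one_le_tsum_sym_sq hΦ ξ)

end Blocks

/-! ### Sobolev weights on a dyadic block -/

section Weights

variable {n : ℕ} {Φ : Rn n → ℝ}

theorem wt_base_pos (ξ : Rn n) : 0 < 1 + ‖(2 * Real.pi) • ξ‖ ^ 2 := by positivity

theorem wt_mul_wt (s t : ℝ) (ξ : Rn n) : wt s ξ * wt t ξ = wt (s + t) ξ := by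
  rw [wt, wt, wt, ← Complex.ofReal_mul, ← Real.rpow_add (wt_base_pos ξ), add_div]

theorem wt_zero (ξ : Rn n) : wt 0 ξ = 1 := by simp [wt]

theorem hasTemperateGrowth_wt (s : ℝ) : Function.HasTemperateGrowth (wt (n := n) s) := by
  have h1 : Function.HasTemperateGrowth fun x : Rn n => (1 + ‖x‖ ^ 2) ^ (s / 2) :=
    Function.hasTemperateGrowth_one_add_norm_sq_rpow (Rn n) (s / 2)
  have h2 : Function.HasTemperateGrowth fun ξ : Rn n => (2 * Real.pi) • ξ := by fun_prop
  exact Function.Complex.hasTemperateGrowth_ofReal.comp (h1.comp h2)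

theorem measurable_wt (s : ℝ) : Measurable (wt (n := n) s) :=
  (hasTemperateGrowth_wt s).1.continuous.measurable

theorem norm_wt (s : ℝ) (ξ : Rn n) : ‖wt s ξ‖ = (1 + ‖(2 * Real.pi) • ξ‖ ^ 2) ^ (s / 2) := by
  rw [wt, Complex.norm_real, Real.norm_of_nonneg (by positivity)]

/-- On the block of index `k`, `wt s` is at most `wtConst s * 2^{ks}`. -/
def wtConst (s : ℝ) : ℝ := 5 ^ (|s| / 2)

theorem wtConst_pos (s : ℝ) : 0 < wtConst s := by unfold wtConst; positivity

/-- On block `k` the quantity `1 + |2πξ|²` and `4^k` are comparable with factor `5` in both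
directions. The sign of `s` decides which direction is used. -/
theorem norm_wt_le (hΦ : IsCutoff Φ) (s : ℝ) {k : ℕ} {ξ : Rn n} (h : sym Φ k ξ ≠ 0) :
    ‖wt s ξ‖ ≤ wtConst s * 2 ^ (k * s) := by
  set r := ‖(2 * Real.pi) • ξ‖ with hr
  have h4 : (2 : ℝ) ^ (k * s) = ((4 : ℝ) ^ k) ^ (s / 2) := by
    rw [show (4 : ℝ) = 2 ^ 2 by norm_num, ← pow_mul, ← Real.rpow_natCast, ← Real.rpow_mul (by norm_num)]
    congr 1; push_cast; ring
  have hk : (0 : ℝ) < 4 ^ k := by positivity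
  have hup : 1 + r ^ 2 ≤ 5 * 4 ^ k := by
    have h1 : r ≤ 2 ^ (k + 1) := le_of_sym_ne_zero hΦ h
    have h2 : r ^ 2 ≤ (2 ^ (k + 1)) ^ 2 := by gcongr
    have h3 : ((2 : ℝ) ^ (k + 1)) ^ 2 = 4 * 4 ^ k := by
      rw [← pow_mul, mul_comm, pow_mul]; norm_num; ring
    have h4 : (1 : ℝ) ≤ 4 ^ k := one_le_pow₀ (by norm_num)
    linarith
  have hlow : 4 ^ k ≤ 5 * (1 + r ^ 2) := by
    cases k with
    | zero => rw [pow_zero]; nlinarith [sq_nonneg r]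
    | succ k =>
      have h1 : 2 ^ k < r := lt_of_sym_ne_zero hΦ h
      have h2 : ((2 : ℝ) ^ k) ^ 2 ≤ r ^ 2 := by gcongr
      have h3 : ((2 : ℝ) ^ k) ^ 2 = 4 ^ k := by
        rw [← pow_mul, mul_comm, pow_mul]; norm_num
      rw [pow_succ]; nlinarith
  rw [norm_wt, ← hr, h4]
  have hb : 0 < 1 + r ^ 2 := by positivity
  rw [← div_le_iff₀ (by positivity), ← Real.div_rpow hb.le hk.le, wtConst]
  rcases le_total 0 s with hs | hs
  · rw [abs_of_nonneg hs]
    apply Real.rpow_le_rpow (by positivity) _ (by linarith)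
    rw [div_le_iff₀ hk]; exact hup
  · rw [abs_of_nonpos hs, show s / 2 = -(-s / 2) by ring, Real.rpow_neg (by positivity),
      ← Real.inv_rpow (by positivity)]
    apply Real.rpow_le_rpow (by positivity) _ (by linarith)
    rw [inv_div, div_le_iff₀ hb]; exact hlow

/-- `wt s` restricted to the block of index `k`. -/
def blockWt (Φ : Rn n → ℝ) (s : ℝ) (k : ℕ) (ξ : Rn n) : ℂ := if sym Φ k ξ = 0 then 0 else wt s ξ

theorem norm_blockWt_le (hΦ : IsCutoff Φ) (s : ℝ) (k : ℕ) (ξ : Rn n) :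
    ‖blockWt Φ s k ξ‖ ≤ wtConst s * 2 ^ (k * s) := by
  have := wtConst_pos s
  unfold blockWt
  split_ifs with h
  · rw [norm_zero]; positivity
  · exact norm_wt_le hΦ s h

theorem isSymbol_blockWt (hΦ : IsCutoff Φ) (s : ℝ) (k : ℕ) : IsSymbol (blockWt Φ s k) :=
  ⟨Measurable.ite ((isSymbol_sym hΦ k).measurable (measurableSet_singleton 0)) measurable_const
    (measurable_wt s), _, norm_blockWt_le hΦ s k⟩

/-- The weight itself may be unbounded. Cut to a block it is a bounded symbol, so `mulOp` applies,
and the projector does not see the difference. -/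
theorem sym_mul_blockWt (s : ℝ) (k : ℕ) (ξ : Rn n) :
    sym Φ k ξ * blockWt Φ s k ξ = sym Φ k ξ * wt s ξ := by
  unfold blockWt
  split_ifs with h <;> simp [h]

end Weights

/-! ### Tempered distributions with an `L²` density up to a Sobolev weight -/

section Distributions

variable {n : ℕ} {Φ : Rn n → ℝ}

/-- The tempered distribution whose Fourier transform is the function `a`. -/
def tdist (n : ℕ) : L2 n →L[ℂ] 𝓢'(Rn n, ℂ) :=
  (Lp.toTemperedDistributionCLM ℂ volume 2).comp
    ((Lp.fourierTransformₗᵢ (Rn n) ℂ).symm.toContinuousLinearEquiv : L2 n →L[ℂ] L2 n)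

theorem tdist_eq (a : L2 n) : tdist n a = ((𝓕⁻ a : L2 n) : 𝓢'(Rn n, ℂ)) := rfl

theorem tdist_apply (a : L2 n) (χ : 𝓢(Rn n, ℂ)) : tdist n a χ = ∫ x, χ x * (𝓕⁻ a : L2 n) x := by
  rw [tdist_eq, Lp.toTemperedDistribution_apply]; rfl

theorem tdist_apply_fourier (a : L2 n) (χ : 𝓢(Rn n, ℂ)) :
    tdist n a (𝓕 χ) = ∫ ξ, χ ξ * a ξ := by
  rw [← TemperedDistribution.fourier_apply, tdist_eq, Lp.fourier_toTemperedDistribution_eq,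
    FourierTransform.fourier_fourierInv_eq, Lp.toTemperedDistribution_apply]
  rfl

theorem tdist_injective (n : ℕ) : Function.Injective (tdist n) := by
  refine Function.Injective.comp (g := Lp.toTemperedDistributionCLM ℂ volume 2) ?_
    (Lp.fourierTransformₗᵢ (Rn n) ℂ).symm.injective
  exact LinearMap.ker_eq_bot.1 Lp.ker_toTemperedDistributionCLM_eq_bot

/-- Fourier multipliers with temperate symbols, acting on tempered distributions. -/
abbrev fmul (m : Rn n → ℂ) : 𝓢'(Rn n, ℂ) →L[ℂ] 𝓢'(Rn n, ℂ) :=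
  TemperedDistribution.fourierMultiplierCLM ℂ m

theorem fmul_fmul {m₁ m₂ : Rn n → ℂ} (h₁ : m₁.HasTemperateGrowth) (h₂ : m₂.HasTemperateGrowth)
    (f : 𝓢'(Rn n, ℂ)) : fmul m₂ (fmul m₁ f) = fmul (fun ξ => m₂ ξ * m₁ ξ) f := by
  rw [TemperedDistribution.fourierMultiplierCLM_fourierMultiplierCLM_apply h₁ h₂, mul_comm]
  rfl

theorem fmul_tdist {m : Rn n → ℂ} (hm : m.HasTemperateGrowth) {a b : L2 n}
    (hb : b =ᵐ[volume] fun ξ => m ξ * a ξ) : fmul m (tdist n a) = tdist n b := by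
  ext χ
  rw [TemperedDistribution.fourierMultiplierCLM_apply_apply, tdist_apply_fourier]
  have : χ = 𝓕 (𝓕⁻ χ : 𝓢(Rn n, ℂ)) := (FourierTransform.fourier_fourierInv_eq χ).symm
  conv_rhs => rw [this, tdist_apply_fourier]
  apply integral_congr_ae
  filter_upwards [hb] with ξ e
  rw [e, SchwartzMap.smulLeftCLM_apply_apply hm, smul_eq_mul]
  ring

theorem hasTemperateGrowth_sym (hΦ : IsCutoff Φ) (k : ℕ) : (sym Φ k).HasTemperateGrowth := by
  cases k with
  | zero => exact (hasCompactSupport_low hΦ 0).hasTemperateGrowth (contDiff_low hΦ 0)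
  | succ k =>
    exact ((hasCompactSupport_low hΦ (k + 1)).hasTemperateGrowth (contDiff_low hΦ (k + 1))).sub
      ((hasCompactSupport_low hΦ k).hasTemperateGrowth (contDiff_low hΦ k))

theorem lowProj_eq (Φ : Rn n → ℝ) (f : 𝓢'(Rn n, ℂ)) : lowProj Φ f = fmul (sym Φ 0) f := by
  rw [lowProj, freqMultiplier]
  congr 2 with ξ
  simp [sym, low]

theorem dyadicProj_eq (Φ : Rn n → ℝ) (k : ℕ) (f : 𝓢'(Rn n, ℂ)) :
    dyadicProj Φ (k + 1) f = fmul (sym Φ (k + 1)) f := by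
  rw [dyadicProj, freqMultiplier]
  congr 2 with ξ
  simp only [sym, low, Complex.ofReal_sub]
  congr 3
  rw [smul_smul, pow_succ, mul_inv_rev, ← mul_assoc, mul_inv_cancel₀ two_ne_zero, one_mul]

/-- The low frequency part is the term `k = 0`, whose weight is `2^0 = 1`. -/
theorem besovNorm_eq (Φ : Rn n → ℝ) (s : ℝ) (p : ℝ≥0∞) (f : 𝓢'(Rn n, ℂ)) :
    besovNorm Φ s p f =
      (∑' k : ℕ, ENNReal.ofReal (2 ^ (2 * (k : ℝ) * s)) *
        distLpNorm p (fmul (sym Φ k) f) ^ 2) ^ (1 / 2 : ℝ) := by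
  rw [besovNorm]
  simp only [lowProj_eq, dyadicProj_eq]
  conv_rhs => rw [tsum_eq_zero_add' ENNReal.summable]
  simp

/-- The representing function is unique, so any competitor in the infimum is `𝓕⁻ a`; if `𝓕⁻ a` is
not in `L^p`, the right side is infinite. -/
theorem distLpNorm_tdist {p : ℝ≥0∞} (hp : 1 ≤ p) (a : L2 n) :
    distLpNorm p (tdist n a) = lpn p a := by
  apply le_antisymm
  · by_cases h : MemLp (𝓕⁻ a : L2 n) p volume
    · exact iInf_le_of_le (𝓕⁻ a : L2 n) (iInf_le_of_le h (iInf_le_of_le (tdist_apply a) le_rfl))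
    · have : lpn p a = ⊤ := by
        by_contra h'
        exact h ⟨Lp.aestronglyMeasurable _, lt_top_iff_ne_top.2 h'⟩
      rw [this]; exact le_top
  · refine le_iInf fun g => le_iInf fun hg => le_iInf fun h => le_of_eq ?_
    refine eLpNorm_congr_ae (ae_eq_of_forall_schwartzMap
      ((Lp.memLp _).locallyIntegrable (by norm_num)) (hg.locallyIntegrable hp) fun χ => ?_)
    rw [← h, tdist_apply]

theorem exists_tdist_of_distLpNorm_lt_top {f : 𝓢'(Rn n, ℂ)} (h : distLpNorm 2 f < ⊤) :
    ∃ a : L2 n, f = tdist n a := by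
  simp only [distLpNorm, iInf_lt_iff] at h
  obtain ⟨g, hg, hfg, -⟩ := h
  refine ⟨𝓕 (hg.toLp g), ?_⟩
  ext χ
  rw [hfg, tdist_apply, FourierTransform.fourierInv_fourier_eq]
  apply integral_congr_ae
  filter_upwards [hg.coeFn_toLp] with x e
  rw [e]

/-- The distribution `(I - Δ)^{-s/2} ℱ⁻¹ a`, for `a ∈ L²`. -/
def ofL2 (n : ℕ) (s : ℝ) : L2 n →L[ℂ] 𝓢'(Rn n, ℂ) := (fmul (wt (-s))).comp (tdist n)

theorem ofL2_apply (s : ℝ) (a : L2 n) : ofL2 n s a = fmul (wt (-s)) (tdist n a) := rfl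

theorem fmul_wt_ofL2 (s : ℝ) (a : L2 n) : fmul (wt s) (ofL2 n s a) = tdist n a := by
  rw [ofL2_apply, fmul_fmul (hasTemperateGrowth_wt _) (hasTemperateGrowth_wt _)]
  refine fmul_tdist ?_ (ae_of_all _ fun ξ => ?_)
  · exact (hasTemperateGrowth_wt s).mul (hasTemperateGrowth_wt (-s))
  · simp only
    rw [wt_mul_wt, add_neg_cancel, wt_zero, one_mul]

theorem eq_ofL2_of_fmul_wt_eq {s : ℝ} {f : 𝓢'(Rn n, ℂ)} {a : L2 n}
    (h : fmul (wt s) f = tdist n a) : f = ofL2 n s a := by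
  rw [ofL2_apply, ← h, fmul_fmul (hasTemperateGrowth_wt _) (hasTemperateGrowth_wt _)]
  have : (fun ξ : Rn n => wt (-s) ξ * wt s ξ) = fun _ => 1 := by
    funext ξ; rw [wt_mul_wt, neg_add_cancel, wt_zero]
  rw [this, fmul, TemperedDistribution.fourierMultiplierCLM_const]
  simp

theorem ofL2_injective (n : ℕ) (s : ℝ) : Function.Injective (ofL2 n s) := fun a b h => by
  apply tdist_injective n
  rw [← fmul_wt_ofL2 s a, h, fmul_wt_ofL2]

/-- Change of Sobolev index: the weights multiply, so the densities differ by the weight of order `s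
- σ`. -/
theorem ofL2_eq_ofL2 {s σ : ℝ} {a b : L2 n} (h : b =ᵐ[volume] fun ξ => wt (s - σ) ξ * a ξ) :
    ofL2 n s b = ofL2 n σ a := by
  symm
  apply eq_ofL2_of_fmul_wt_eq
  rw [ofL2_apply, fmul_fmul (hasTemperateGrowth_wt _) (hasTemperateGrowth_wt _)]
  refine fmul_tdist ((hasTemperateGrowth_wt s).mul (hasTemperateGrowth_wt (-σ))) ?_
  filter_upwards [h] with ξ e
  rw [e, Pi.mul_apply, wt_mul_wt, sub_eq_add_neg]

theorem sobolevNorm_eq (s : ℝ) (f : 𝓢'(Rn n, ℂ)) :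
    sobolevNorm s f = distLpNorm 2 (fmul (wt s) f) := rfl

theorem sobolevNorm_ofL2 (s : ℝ) (a : L2 n) : sobolevNorm s (ofL2 n s a) = ‖a‖ₑ := by
  rw [sobolevNorm_eq, fmul_wt_ofL2, distLpNorm_tdist (by norm_num), lpn_two]

theorem exists_ofL2_of_sobolevNorm_lt_top {s : ℝ} {f : 𝓢'(Rn n, ℂ)} (h : sobolevNorm s f < ⊤) :
    ∃ a : L2 n, f = ofL2 n s a := by
  obtain ⟨a, ha⟩ := exists_tdist_of_distLpNorm_lt_top h
  exact ⟨a, eq_ofL2_of_fmul_wt_eq ha⟩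

/-- The Littlewood-Paley block of index `k` of `ofL2 n s a`, on the frequency side. -/
def block (Φ : Rn n → ℝ) (s : ℝ) (k : ℕ) : L2 n →L[ℂ] L2 n :=
  (mulOp (sym Φ k)).comp (mulOp (blockWt Φ (-s) k))

theorem block_apply (s : ℝ) (k : ℕ) (a : L2 n) :
    block Φ s k a = mulOp (sym Φ k) (mulOp (blockWt Φ (-s) k) a) := rfl

theorem coeFn_block (hΦ : IsCutoff Φ) (s : ℝ) (k : ℕ) (a : L2 n) :
    block Φ s k a =ᵐ[volume] fun ξ => sym Φ k ξ * wt (-s) ξ * a ξ := by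
  rw [block_apply, mulOp_mulOp (isSymbol_sym hΦ k) (isSymbol_blockWt hΦ (-s) k)]
  simp_rw [sym_mul_blockWt]
  refine coeFn_mulOp ?_ a
  have := (isSymbol_sym hΦ k).mul (isSymbol_blockWt hΦ (-s) k)
  simp_rw [sym_mul_blockWt] at this
  exact this

theorem fmul_sym_ofL2 (hΦ : IsCutoff Φ) (s : ℝ) (k : ℕ) (a : L2 n) :
    fmul (sym Φ k) (ofL2 n s a) = tdist n (block Φ s k a) := by
  rw [ofL2_apply, fmul_fmul (hasTemperateGrowth_wt _) (hasTemperateGrowth_sym hΦ k)]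
  exact fmul_tdist ((hasTemperateGrowth_sym hΦ k).mul (hasTemperateGrowth_wt _))
    (coeFn_block hΦ s k a)

theorem besovNorm_ofL2 (hΦ : IsCutoff Φ) (s σ : ℝ) {p : ℝ≥0∞} (hp : 1 ≤ p) (a : L2 n) :
    besovNorm Φ s p (ofL2 n σ a) =
      (∑' k : ℕ, ENNReal.ofReal (2 ^ (2 * (k : ℝ) * s)) * lpn p (block Φ σ k a) ^ 2)
        ^ (1 / 2 : ℝ) := by
  simp_rw [besovNorm_eq, fmul_sym_ofL2 hΦ, distLpNorm_tdist hp]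

/-- The lower bound for the squares of the partition of unity reduces the claim to single blocks,
where the weight is at most a constant times `2^{ks}`. The index `σ` is arbitrary because Duhamel
integrals are constructed in a Sobolev space much weaker than the one in which they are estimated.
-/
theorem exists_sobolevNorm_le_besovNorm (hΦ : IsCutoff Φ) (s : ℝ) :
    ∃ C : ℝ≥0, ∀ (σ : ℝ) (a : L2 n),
      sobolevNorm s (ofL2 n σ a) ≤ C * besovNorm Φ s 2 (ofL2 n σ a) := by
  set c := wtConst s
  have hc := wtConst_pos s
  refine ⟨(3 * ENNReal.ofReal (c ^ 2)).toNNReal.sqrt + 1, fun σ a => ?_⟩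
  set D : ℝ≥0 := (3 * ENNReal.ofReal (c ^ 2)).toNNReal.sqrt with hD
  have hD2 : (D : ℝ≥0∞) ^ 2 = 3 * ENNReal.ofReal (c ^ 2) := by
    rw [hD, ← ENNReal.coe_pow, NNReal.sq_sqrt, ENNReal.coe_toNNReal]
    exact ENNReal.mul_ne_top (by simp) ENNReal.ofReal_ne_top
  rcases eq_or_ne (besovNorm Φ s 2 (ofL2 n σ a)) ⊤ with ht | ht
  · rw [ht, ENNReal.mul_top]
    · exact le_top
    · positivity
  have ha : Measurable a := (Lp.stronglyMeasurable a).measurable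
  have key : ∫⁻ ξ, ‖wt (s - σ) ξ * a ξ‖ₑ ^ 2 ≤ (D * besovNorm Φ s 2 (ofL2 n σ a)) ^ 2 := by
    have hF : Measurable fun ξ => ‖wt (s - σ) ξ * a ξ‖ₑ ^ 2 :=
      (((measurable_wt (n := n) (s - σ)).mul ha).enorm).pow_const 2
    refine (lintegral_le_tsum_sym hΦ hF.aemeasurable).trans ?_
    rw [mul_pow, hD2, besovNorm_ofL2 hΦ s σ (by norm_num), ← ENNReal.rpow_natCast (_ ^ (1 / 2 : ℝ)),
      ← ENNReal.rpow_mul, mul_assoc, show (1 / 2 : ℝ) * (2 : ℕ) = 1 by norm_num, ENNReal.rpow_one]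
    gcongr
    rw [← ENNReal.tsum_mul_left]
    refine ENNReal.tsum_le_tsum fun k => ?_
    rw [lpn_two, enorm_sq_eq_lintegral, ← mul_assoc, ← lintegral_const_mul']
    swap
    · exact ENNReal.mul_ne_top (by simp) ENNReal.ofReal_ne_top
    apply lintegral_mono_ae
    filter_upwards [coeFn_block hΦ σ k a] with ξ e
    rw [e]
    by_cases h : sym Φ k ξ = 0
    · simp [h]
    have h1 : ‖wt s ξ‖ₑ ^ 2 ≤ ENNReal.ofReal c ^ 2 * ENNReal.ofReal (2 ^ (2 * (k : ℝ) * s)) := by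
      have h2 : (2 : ℝ) ^ (2 * (k : ℝ) * s) = (2 ^ (k * s)) ^ 2 := by
        rw [← Real.rpow_natCast, ← Real.rpow_mul (by norm_num)]
        congr 1; push_cast; ring
      rw [h2, ENNReal.ofReal_pow (by positivity), ← mul_pow, ← ENNReal.ofReal_mul hc.le,
        ← ofReal_norm]
      gcongr
      exact norm_wt_le hΦ s h
    have h3 : wt (s - σ) ξ = wt s ξ * wt (-σ) ξ := by rw [wt_mul_wt, sub_eq_add_neg]
    calc ‖sym Φ k ξ‖ₑ ^ 2 * ‖wt (s - σ) ξ * a ξ‖ₑ ^ 2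
        = ‖wt s ξ‖ₑ ^ 2 * ‖sym Φ k ξ * wt (-σ) ξ * a ξ‖ₑ ^ 2 := by
          rw [h3]; simp only [enorm_mul]; ring
      _ ≤ _ := by
          rw [ENNReal.ofReal_pow hc.le]
          gcongr
  -- Finiteness of the Besov norm is what places the reweighted density in `L²`.
  have hmem : MemLp (fun ξ => wt (s - σ) ξ * a ξ) 2 volume := by
    refine ⟨((measurable_wt (n := n) (s - σ)).mul ha).aestronglyMeasurable, ?_⟩
    rw [eLpNorm_lt_top_iff_lintegral_rpow_enorm_lt_top (by simp) (by simp)]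
    simpa using key.trans_lt (ENNReal.pow_lt_top
      (ENNReal.mul_lt_top (by simp) ht.lt_top))
  rw [← ofL2_eq_ofL2 (s := s) (σ := σ) hmem.coeFn_toLp, sobolevNorm_ofL2]
  have h4 : ‖hmem.toLp‖ₑ ^ 2 ≤ (D * besovNorm Φ s 2 (ofL2 n σ a)) ^ 2 := by
    refine le_trans (le_of_eq ?_) key
    rw [enorm_sq_eq_lintegral]
    apply lintegral_congr_ae
    filter_upwards [hmem.coeFn_toLp] with ξ e
    rw [e]
  rw [ofL2_eq_ofL2 (s := s) (σ := σ) hmem.coeFn_toLp]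
  refine ((ENNReal.pow_le_pow_left_iff two_ne_zero).1 h4).trans ?_
  gcongr
  exact le_self_add

end Distributions

/-! ### Convergence of the frequency cutoffs on Schwartz functions -/

section CutoffConvergence

variable {n : ℕ} {Φ : Rn n → ℝ}

theorem low_eq_comp (Φ : Rn n → ℝ) (l : ℕ) :
    low Φ l = low Φ 0 ∘ ((((2 : ℝ) ^ l)⁻¹ • ContinuousLinearMap.id ℝ (Rn n) : Rn n →L[ℝ] Rn n)) := by
  funext ξ
  simp only [low, Function.comp_apply, smul_apply, ContinuousLinearMap.id_apply]
  rw [smul_comm (2 * Real.pi)]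
  simp

/-- Each derivative of the dilated cutoff produces a factor `2^{-l} ≤ 1`; one of these factors is
kept. -/
theorem norm_iteratedFDeriv_low_le (hΦ : IsCutoff Φ) (i l : ℕ) (hi : i ≠ 0) (ξ : Rn n) :
    ‖iteratedFDeriv ℝ i (low Φ l) ξ‖ ≤
      SchwartzMap.seminorm ℝ 0 i (lowSchwartz hΦ 0) * ((2 : ℝ) ^ l)⁻¹ := by
  set c : ℝ := ((2 : ℝ) ^ l)⁻¹ with hc
  have hc0 : 0 < c := by positivity
  have hc1 : c ≤ 1 := inv_le_one_of_one_le₀ (one_le_pow₀ (by norm_num))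
  rw [low_eq_comp, ContinuousLinearMap.iteratedFDeriv_comp_right _ (contDiff_low hΦ 0) ξ
    (by exact_mod_cast le_top)]
  refine (ContinuousMultilinearMap.norm_compContinuousLinearMap_le _ _).trans ?_
  have h1 := (lowSchwartz hΦ 0).norm_iteratedFDeriv_le_seminorm ℝ i (c • ξ)
  have h2 : ‖c • ContinuousLinearMap.id ℝ (Rn n)‖ ≤ c := by
    rw [norm_smul, Real.norm_of_nonneg hc0.le]
    exact mul_le_of_le_one_right hc0.le ContinuousLinearMap.norm_id_le
  rw [Finset.prod_const, Finset.card_univ, Fintype.card_fin]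
  refine mul_le_mul h1 ?_ (by positivity) ((norm_nonneg _).trans h1)
  calc ‖c • ContinuousLinearMap.id ℝ (Rn n)‖ ^ i ≤ c ^ i := by gcongr
    _ ≤ c ^ 1 := pow_le_pow_of_le_one hc0.le hc1 (Nat.one_le_iff_ne_zero.2 hi)
    _ = c := pow_one c

/-- For `i = 0` the difference vanishes unless `2π‖ξ‖ > 2^l`, so one power of `‖ξ‖` pays for the
factor `2^{-l}`. Derivatives of positive order are small everywhere. -/
theorem exists_norm_iteratedFDeriv_low_sub_one_le (hΦ : IsCutoff Φ) (i : ℕ) :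
    ∃ C : ℝ, 0 ≤ C ∧ ∀ (l : ℕ) (ξ : Rn n),
      ‖iteratedFDeriv ℝ i (fun ζ => low Φ l ζ + (-1)) ξ‖ ≤ C * ((2 : ℝ) ^ l)⁻¹ * (1 + ‖ξ‖) := by
  rcases eq_or_ne i 0 with rfl | hi
  · refine ⟨2 * Real.pi, by positivity, fun l ξ => ?_⟩
    rw [norm_iteratedFDeriv_zero]
    rcases le_or_gt ‖(2 * Real.pi) • ξ‖ (2 ^ l) with h | h
    · rw [low_eq_one hΦ h]
      simp only [add_neg_cancel, norm_zero]
      positivity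
    · have h1 : ‖low Φ l ξ + -1‖ ≤ 1 := by
        rw [low, ← Complex.ofReal_one, ← Complex.ofReal_neg, ← Complex.ofReal_add,
          Complex.norm_real, Real.norm_eq_abs, abs_le]
        have := hΦ.mem_Icc (((2 : ℝ) ^ l)⁻¹ • ((2 * Real.pi) • ξ))
        constructor <;> linarith [this.1, this.2]
      rw [norm_two_pi_smul] at h
      refine h1.trans ?_
      rw [mul_right_comm, ← div_eq_mul_inv, le_div_iff₀ (by positivity), one_mul]
      have := Real.pi_pos
      nlinarith
  · refine ⟨SchwartzMap.seminorm ℝ 0 i (lowSchwartz hΦ 0), apply_nonneg _ _, fun l ξ => ?_⟩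
    have h1 : iteratedFDeriv ℝ i (fun ζ => low Φ l ζ + (-1)) ξ = iteratedFDeriv ℝ i (low Φ l) ξ := by
      have := iteratedFDeriv_add_apply (𝕜 := ℝ) (i := i) (x := ξ)
        (((contDiff_low hΦ l).of_le (by exact_mod_cast le_top)).contDiffAt)
        (contDiffAt_const (c := (-1 : ℂ)))
      rw [iteratedFDeriv_const_of_ne hi] at this
      simpa using! this
    rw [h1]
    refine (norm_iteratedFDeriv_low_le hΦ i l hi ξ).trans ?_
    refine le_mul_of_one_le_right (by positivity) (by linarith [norm_nonneg ξ])

/-- By the Leibniz rule each seminorm of `(low Φ l - 1) u` is `O(2^{-l})`; the additional power of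
`‖ξ‖` is absorbed by the seminorms with decay index `k + 1`. -/
theorem tendsto_smulLeftCLM_low (hΦ : IsCutoff Φ) (u : 𝓢(Rn n, ℂ)) :
    Tendsto (fun l => SchwartzMap.smulLeftCLM ℂ (low Φ l) u) atTop (𝓝 u) := by
  rw [(schwartz_withSeminorms ℝ (Rn n) ℂ).tendsto_nhds]
  rintro ⟨k, m⟩ ε hε
  choose C hC0 hC using exists_norm_iteratedFDeriv_low_sub_one_le (n := n) hΦ
  set D := ∑ i ∈ Finset.range (m + 1), (m.choose i : ℝ) * C i *
    (SchwartzMap.seminorm ℝ k (m - i) u + SchwartzMap.seminorm ℝ (k + 1) (m - i) u)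
  have hD : 0 ≤ D := Finset.sum_nonneg fun i _ =>
    mul_nonneg (mul_nonneg (by positivity) (hC0 i)) (by positivity)
  have hbound : ∀ l, SchwartzMap.seminorm ℝ k m (SchwartzMap.smulLeftCLM ℂ (low Φ l) u - u) ≤
      D * ((2 : ℝ) ^ l)⁻¹ := by
    intro l
    refine SchwartzMap.seminorm_le_bound ℝ k m _ (by positivity) fun ξ => ?_
    have htg : (low Φ l).HasTemperateGrowth :=
      (hasCompactSupport_low hΦ l).hasTemperateGrowth (contDiff_low hΦ l)
    have e : (⇑(SchwartzMap.smulLeftCLM ℂ (low Φ l) u - u) : Rn n → ℂ) =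
        fun ζ => (low Φ l ζ + (-1)) * u ζ := by
      funext ζ
      rw [sub_apply, SchwartzMap.smulLeftCLM_apply_apply htg, smul_eq_mul]
      ring
    rw [e]
    have hl : ContDiff ℝ ∞ fun ζ => low Φ l ζ + (-1) := (contDiff_low hΦ l).add contDiff_const
    have := norm_iteratedFDeriv_mul_le hl u.smooth' ξ (n := m) (by exact_mod_cast le_top)
    refine (mul_le_mul_of_nonneg_left this (by positivity)).trans ?_
    rw [Finset.mul_sum, Finset.sum_mul]
    refine Finset.sum_le_sum fun i _ => ?_
    have h1 := hC i l ξ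
    have h2 := u.le_seminorm ℝ k (m - i) ξ
    have h3 := u.le_seminorm ℝ (k + 1) (m - i) ξ
    set A := ‖iteratedFDeriv ℝ i (fun ζ => low Φ l ζ + (-1)) ξ‖
    set B := ‖iteratedFDeriv ℝ (m - i) u ξ‖
    calc ‖ξ‖ ^ k * ((m.choose i : ℝ) * A * B)
        ≤ ‖ξ‖ ^ k * ((m.choose i : ℝ) * (C i * ((2 : ℝ) ^ l)⁻¹ * (1 + ‖ξ‖)) * B) := by
          gcongr
      _ = (m.choose i : ℝ) * C i * ((2 : ℝ) ^ l)⁻¹ * (‖ξ‖ ^ k * B + ‖ξ‖ ^ (k + 1) * B) := by ring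
      _ ≤ (m.choose i : ℝ) * C i * ((2 : ℝ) ^ l)⁻¹ * (SchwartzMap.seminorm ℝ k (m - i) u +
          SchwartzMap.seminorm ℝ (k + 1) (m - i) u) := by
          have := hC0 i
          gcongr
      _ = _ := by ring
  have hlim : Tendsto (fun l : ℕ => D * ((2 : ℝ) ^ l)⁻¹) atTop (𝓝 0) := by
    have h := (tendsto_pow_atTop_nhds_zero_of_lt_one (r := (1 / 2 : ℝ)) (by norm_num)
      (by norm_num)).const_mul D
    simpa using h
  filter_upwards [hlim.eventually (gt_mem_nhds hε)] with l hl
  exact (hbound l).trans_lt hl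

end CutoffConvergence

/-! ### Embedding of the dual Besov space into a Sobolev space -/

section Embedding

variable {n : ℕ} {Φ : Rn n → ℝ}

/-- Riesz representation: a tempered distribution that is bounded for the `L²` norm is in `L²`. -/
theorem exists_tdist_of_norm_apply_le {f : 𝓢'(Rn n, ℂ)} {M : ℝ} (hM : 0 ≤ M)
    (h : ∀ χ : 𝓢(Rn n, ℂ), ‖f χ‖ ≤ M * ‖χ.toLp 2 (volume : Measure (Rn n))‖) :
    ∃ a : L2 n, f = tdist n a ∧ ‖a‖ ≤ M := by
  set e : 𝓢(Rn n, ℂ) →ₗ[ℂ] L2 n := (SchwartzMap.toLpCLM ℂ ℂ 2 (volume : Measure (Rn n))).toLinearMap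
  have hd : DenseRange e := SchwartzMap.denseRange_toLpCLM (p := 2) ENNReal.ofNat_ne_top
  set ℓ : L2 n →L[ℂ] ℂ := (f.toLinearMap : 𝓢(Rn n, ℂ) →ₗ[ℂ] ℂ).extendOfNorm e
  have hℓ : ∀ χ, ℓ (e χ) = f χ := fun χ => LinearMap.extendOfNorm_eq hd ⟨M, h⟩ χ
  have hℓM : ‖ℓ‖ ≤ M := LinearMap.opNorm_extendOfNorm_le hd hM h
  set w : L2 n := (InnerProductSpace.toDual ℂ (L2 n)).symm ℓ
  have hw : ∀ x, inner ℂ w x = ℓ x := fun x => InnerProductSpace.toDual_symm_apply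
  -- The inner product conjugates `w`, whereas the pairing with `χ` is bilinear; hence the
  -- conjugate.
  refine ⟨𝓕 (star w), ?_, ?_⟩
  · ext χ
    rw [tdist_apply, FourierTransform.fourierInv_fourier_eq, ← hℓ, ← hw, L2.inner_def]
    apply integral_congr_ae
    filter_upwards [Lp.coeFn_star w, χ.coeFn_toLp 2 volume] with x h1 h2
    rw [h1]
    simp only [e, ContinuousLinearMap.coe_coe, SchwartzMap.toLpCLM_apply, h2]
    simp
  · rw [Lp.norm_fourier_eq]
    have h1 : ‖star w‖ ≤ ‖w‖ := by
      refine Lp.norm_le_norm_of_ae_le ?_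
      filter_upwards [Lp.coeFn_star w] with x hx
      rw [hx]
      simp
    refine h1.trans ?_
    simpa [w] using hℓM

theorem distLpNorm_eq {p : ℝ≥0∞} (hp : 1 ≤ p) {f : 𝓢'(Rn n, ℂ)} {g : Rn n → ℂ}
    (hg : MemLp g p volume) (h : ∀ χ : 𝓢(Rn n, ℂ), f χ = ∫ x, χ x * g x) :
    distLpNorm p f = eLpNorm g p volume := by
  apply le_antisymm
  · exact iInf_le_of_le g (iInf_le_of_le hg (iInf_le_of_le h le_rfl))
  · refine le_iInf fun g' => le_iInf fun hg' => le_iInf fun h' => le_of_eq ?_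
    refine eLpNorm_congr_ae (ae_eq_of_forall_schwartzMap
      (hg.locallyIntegrable hp) (hg'.locallyIntegrable hp) fun χ => ?_)
    rw [← h, ← h']

theorem enorm_apply_le_distLpNorm_mul (p p' : ℝ≥0∞) [p.HolderConjugate p'] {f : 𝓢'(Rn n, ℂ)}
    (hf : distLpNorm p' f < ⊤) (χ : 𝓢(Rn n, ℂ)) :
    ‖f χ‖ₑ ≤ distLpNorm p' f * eLpNorm χ p volume := by
  have hp' := ENNReal.HolderTriple.le p' p 1
  have hf' := hf
  simp only [distLpNorm, iInf_lt_iff] at hf'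
  obtain ⟨g, hg, hfg, -⟩ := hf'
  rw [distLpNorm_eq hp' hg hfg, hfg, mul_comm]
  refine (enorm_integral_le_lintegral_enorm _).trans ?_
  have := lintegral_mul_le_eLpNorm_mul_eLpNorm (μ := volume) p p'
    χ.continuous.aestronglyMeasurable.enorm hg.1.enorm
  simpa only [eLpNorm_enorm, ← enorm_mul] using this

/-- The transform and its inverse differ by the reflection `x ↦ -x`, which preserves the norm. -/
theorem eLpNorm_fourier_eq_lpn (p : ℝ≥0∞) (u : 𝓢(Rn n, ℂ)) :
    eLpNorm (𝓕 u : 𝓢(Rn n, ℂ)) p volume = lpn p (u.toLp 2 volume) := by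
  have h1 : ∀ x, (𝓕 u : 𝓢(Rn n, ℂ)) x = (𝓕⁻ u : 𝓢(Rn n, ℂ)) (-x) := by
    intro x
    rw [SchwartzMap.fourierInv_coe, SchwartzMap.fourier_coe, Real.fourierInv_eq_fourier_neg, neg_neg]
  have h2 : ((𝓕 u : 𝓢(Rn n, ℂ)) : Rn n → ℂ) = (𝓕⁻ u : 𝓢(Rn n, ℂ)) ∘ Neg.neg := funext h1
  rw [h2, eLpNorm_comp_measurePreserving
    (𝓕⁻ u : 𝓢(Rn n, ℂ)).continuous.aestronglyMeasurable (Measure.measurePreserving_neg volume),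
    lpn, SchwartzMap.toLp_fourierInv_eq]
  exact (eLpNorm_congr_ae ((𝓕⁻ u : 𝓢(Rn n, ℂ)).coeFn_toLp 2 volume)).symm

theorem ofReal_rpow_mul_distLpNorm_le_besovNorm (Φ : Rn n → ℝ) (s : ℝ) (p : ℝ≥0∞)
    (f : 𝓢'(Rn n, ℂ)) (k : ℕ) :
    ENNReal.ofReal (2 ^ ((k : ℝ) * s)) * distLpNorm p (fmul (sym Φ k) f) ≤ besovNorm Φ s p f := by
  rw [besovNorm_eq, ← ENNReal.rpow_inv_le_iff (by norm_num), one_div, inv_inv]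
  refine le_trans (le_of_eq ?_) (ENNReal.le_tsum k)
  have h2 : (2 : ℝ) ^ (2 * (k : ℝ) * s) = (2 ^ (k * s)) ^ 2 := by
    rw [← Real.rpow_natCast, ← Real.rpow_mul (by norm_num)]
    congr 1; push_cast; ring
  rw [h2, ENNReal.ofReal_pow (by positivity), ← mul_pow]
  exact ENNReal.rpow_ofNat _ 2

/-- `B^η_{p',2}` embeds into a Sobolev space for `p' ≤ 2`. -/
theorem exists_ofL2_of_besovNorm_lt_top (hΦ : IsCutoff Φ) (p p' : ℝ≥0∞) [p.HolderConjugate p']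
    (hp : 2 ≤ p) (η : ℝ) :
    ∃ C : ℝ≥0, ∀ f : 𝓢'(Rn n, ℂ), besovNorm Φ η p' f < ⊤ →
      ∃ a : L2 n, f = ofL2 n (η - n - 1) a ∧ ‖a‖ₑ ≤ C * besovNorm Φ η p' f := by
  -- Bernstein's inequality loses `2^{nk}`. The additional loss of one derivative leaves a factor
  -- `2^{-k}`, so that the blocks form a geometric series.
  set σ : ℝ := η - n - 1 with hσ
  obtain ⟨B, hB⟩ := exists_bernstein_sym hΦ
  -- The power of `2` pays for replacing the index `i` of a neighbour by `k`, the factor `3` for the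
  -- number of neighbours. The later factor `2` is the sum of the geometric series.
  set c : ℝ≥0 := B * (wtConst σ).toNNReal * (2 ^ |η - 1| : ℝ).toNNReal * 3
  have hc : 0 < wtConst σ := wtConst_pos σ
  refine ⟨c * 2, fun f hf => ?_⟩
  set N := besovNorm Φ η p' f with hN
  have hNk : ∀ k, distLpNorm p' (fmul (sym Φ k) f) < ⊤ := by
    intro k
    have := (ofReal_rpow_mul_distLpNorm_le_besovNorm Φ η p' f k).trans_lt hf
    exact ENNReal.lt_top_of_mul_ne_top_right this.ne (by positivity)
  -- a single block
  have hpiece : ∀ (χ : 𝓢(Rn n, ℂ)) (i : ℕ),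
      eLpNorm (𝓕 (SchwartzMap.smulLeftCLM ℂ (sym Φ i)
        (SchwartzMap.smulLeftCLM ℂ (wt σ) (𝓕⁻ χ))) : 𝓢(Rn n, ℂ)) p volume ≤
      B * (wtConst σ).toNNReal * ENNReal.ofReal (2 ^ (i * (η - 1))) *
        ‖χ.toLp 2 (volume : Measure (Rn n))‖ₑ := by
    intro χ i
    rw [eLpNorm_fourier_eq_lpn]
    have e : (SchwartzMap.smulLeftCLM ℂ (sym Φ i) (SchwartzMap.smulLeftCLM ℂ (wt σ)
        (𝓕⁻ χ : 𝓢(Rn n, ℂ)))).toLp 2 volume =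
        mulOp (sym Φ i) (mulOp (blockWt Φ σ i) ((𝓕⁻ χ : 𝓢(Rn n, ℂ)).toLp 2 volume)) := by
      apply Lp.ext
      have h1 := coeFn_block hΦ (-σ) i ((𝓕⁻ χ : 𝓢(Rn n, ℂ)).toLp 2 volume)
      rw [block_apply, neg_neg] at h1
      filter_upwards [h1, (𝓕⁻ χ : 𝓢(Rn n, ℂ)).coeFn_toLp 2 volume, SchwartzMap.coeFn_toLp
        (SchwartzMap.smulLeftCLM ℂ (sym Φ i) (SchwartzMap.smulLeftCLM ℂ (wt σ) (𝓕⁻ χ : 𝓢(Rn n, ℂ))))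
        2 volume] with ξ e1 e2 e3
      rw [e1, e2, e3, SchwartzMap.smulLeftCLM_apply_apply (hasTemperateGrowth_sym hΦ i),
        SchwartzMap.smulLeftCLM_apply_apply (hasTemperateGrowth_wt σ), smul_eq_mul, smul_eq_mul,
        mul_assoc]
    rw [e]
    refine (hB p hp i _).trans ?_
    have h2 : ‖mulOp (blockWt Φ σ i) ((𝓕⁻ χ : 𝓢(Rn n, ℂ)).toLp 2 volume)‖ₑ ≤
        ENNReal.ofReal (wtConst σ * 2 ^ (i * σ)) * ‖χ.toLp 2 (volume : Measure (Rn n))‖ₑ := by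
      rw [← ofReal_norm, ← ofReal_norm, ← ENNReal.ofReal_mul (by positivity)]
      apply ENNReal.ofReal_le_ofReal
      refine (norm_mulOp_le (isSymbol_blockWt hΦ σ i) (norm_blockWt_le hΦ σ i) _).trans ?_
      gcongr
      rw [← SchwartzMap.toLp_fourierInv_eq, ← Lp.norm_fourier_eq,
        FourierTransform.fourier_fourierInv_eq]
    refine (mul_le_mul_right h2 _).trans (le_of_eq ?_)
    have h3 : (2 : ℝ) ^ (i * (η - 1)) = 2 ^ (n * i) * 2 ^ (i * σ) := by
      rw [← Real.rpow_natCast, ← Real.rpow_add two_pos, hσ]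
      congr 1; push_cast; ring
    rw [h3, ENNReal.ofReal_mul hc.le, ENNReal.ofReal_mul (by positivity), ENNReal.ofReal_pow (by simp)]
    simp only [ENNReal.ofReal_ofNat]
    rw [show ENNReal.ofReal (wtConst σ) = ((wtConst σ).toNNReal : ℝ≥0∞) from rfl]
    ring
  -- A block of `f` is unchanged by the sum of the neighbouring projectors. These are moved to `χ`,
  -- which becomes localized in frequency; then Hölder's inequality pairs the `L^{p'}` norm of the
  -- block with an `L^p` norm to which Bernstein's inequality applies.
  have hblock : ∀ (χ : 𝓢(Rn n, ℂ)) (k : ℕ), ‖fmul (wt σ) (fmul (sym Φ k) f) χ‖ₑ ≤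
      c * N * (2⁻¹ ^ k) * ‖χ.toLp 2 (volume : Measure (Rn n))‖ₑ := by
    intro χ k
    have e : fmul (wt σ) (fmul (sym Φ k) f) χ = ∑ i ∈ nbr k, fmul (sym Φ k) f
        (𝓕 (SchwartzMap.smulLeftCLM ℂ (sym Φ i)
          (SchwartzMap.smulLeftCLM ℂ (wt σ) (𝓕⁻ χ))) : 𝓢(Rn n, ℂ)) := by
      have h1 : fmul (sym Φ k) f = ∑ i ∈ nbr k, fmul (sym Φ i) (fmul (sym Φ k) f) := by
        simp_rw [fun i => fmul_fmul (hasTemperateGrowth_sym hΦ k) (hasTemperateGrowth_sym hΦ i) f]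
        have h2 := TemperedDistribution.fourierMultiplierCLM_sum ℂ (s := nbr k)
          (g := fun i ξ => sym Φ i ξ * sym Φ k ξ)
          (fun i _ => (hasTemperateGrowth_sym hΦ i).mul (hasTemperateGrowth_sym hΦ k))
        simp_rw [sum_nbr_sym_mul_sym hΦ] at h2
        conv_lhs => rw [fmul, h2]
        simp
      rw [TemperedDistribution.fourierMultiplierCLM_apply_apply]
      conv_lhs => rw [h1]
      have h3 : ∀ (s : Finset ℕ) (g : ℕ → 𝓢'(Rn n, ℂ)) (ψ : 𝓢(Rn n, ℂ)),
          (∑ i ∈ s, g i) ψ = ∑ i ∈ s, g i ψ := fun s g ψ => by simp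
      rw [h3]
      refine Finset.sum_congr rfl fun i _ => ?_
      rw [TemperedDistribution.fourierMultiplierCLM_apply_apply _ (fmul (sym Φ k) f),
        FourierTransform.fourierInv_fourier_eq]
    rw [e]
    refine (enorm_sum_le _ _).trans ?_
    have hterm : ∀ i ∈ nbr k, ‖fmul (sym Φ k) f (𝓕 (SchwartzMap.smulLeftCLM ℂ (sym Φ i)
          (SchwartzMap.smulLeftCLM ℂ (wt σ) (𝓕⁻ χ))) : 𝓢(Rn n, ℂ))‖ₑ ≤
        B * (wtConst σ).toNNReal * (2 ^ |η - 1| : ℝ).toNNReal * N * (2⁻¹ ^ k) *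
          ‖χ.toLp 2 (volume : Measure (Rn n))‖ₑ := by
      intro i hi
      refine (enorm_apply_le_distLpNorm_mul p p' (hNk k) _).trans ?_
      refine (mul_le_mul_right (hpiece χ i) _).trans ?_
      have h1 : ENNReal.ofReal (2 ^ (i * (η - 1))) ≤ ((2 ^ |η - 1| : ℝ).toNNReal : ℝ≥0∞) * (2⁻¹ ^ k *
          ENNReal.ofReal (2 ^ (k * η))) := by
        have h2 : (2⁻¹ : ℝ≥0∞) ^ k = ENNReal.ofReal ((2 : ℝ)⁻¹ ^ k) := by
          rw [ENNReal.ofReal_pow (by positivity), ENNReal.ofReal_inv_of_pos two_pos]; simp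
        rw [h2, ← ENNReal.ofReal_mul (by positivity),
          show ((2 ^ |η - 1| : ℝ).toNNReal : ℝ≥0∞) = ENNReal.ofReal (2 ^ |η - 1|) from rfl,
          ← ENNReal.ofReal_mul (by positivity)]
        apply ENNReal.ofReal_le_ofReal
        rw [inv_pow, ← Real.rpow_natCast, ← Real.rpow_neg two_pos.le, ← Real.rpow_add two_pos,
          ← Real.rpow_add two_pos]
        apply Real.rpow_le_rpow_of_exponent_le one_le_two
        have h3 := mem_nbr.1 hi
        have h4 : |(i : ℝ) - k| ≤ 1 := by
          rw [abs_le]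
          have h5 : (i : ℝ) ≤ k + 1 := by exact_mod_cast h3.1
          have h6 : (k : ℝ) ≤ i + 1 := by exact_mod_cast h3.2
          constructor <;> linarith
        have h7 : ((i : ℝ) - k) * (η - 1) ≤ |η - 1| := by
          refine (le_abs_self _).trans ?_
          rw [abs_mul]
          exact mul_le_of_le_one_left (abs_nonneg _) h4
        linarith
      calc _ ≤ distLpNorm p' (fmul (sym Φ k) f) * (B * (wtConst σ).toNNReal *
            (((2 ^ |η - 1| : ℝ).toNNReal : ℝ≥0∞) * (2⁻¹ ^ k * ENNReal.ofReal (2 ^ (k * η)))) *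
            ‖χ.toLp 2 (volume : Measure (Rn n))‖ₑ) := by gcongr
        _ = B * (wtConst σ).toNNReal * (2 ^ |η - 1| : ℝ).toNNReal *
            (ENNReal.ofReal (2 ^ (k * η)) * distLpNorm p' (fmul (sym Φ k) f)) * (2⁻¹ ^ k) *
            ‖χ.toLp 2 (volume : Measure (Rn n))‖ₑ := by ring
        _ ≤ _ := by
            gcongr
            exact ofReal_rpow_mul_distLpNorm_le_besovNorm Φ η p' f k
    refine (Finset.sum_le_sum hterm).trans ?_
    rw [Finset.sum_const, nsmul_eq_mul]
    calc ((nbr k).card : ℝ≥0∞) * _ ≤ 3 * _ := by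
          gcongr; exact_mod_cast card_nbr_le k
      _ = _ := by simp only [c]; push_cast; ring
  have hsum : ∀ (χ : 𝓢(Rn n, ℂ)) (l : ℕ), ‖fmul (wt σ) (fmul (low Φ l) f) χ‖ₑ ≤
      c * 2 * N * ‖χ.toLp 2 (volume : Measure (Rn n))‖ₑ := by
    intro χ l
    have e : fmul (wt σ) (fmul (low Φ l) f) χ =
        ∑ k ∈ Finset.range (l + 1), fmul (wt σ) (fmul (sym Φ k) f) χ := by
      have h2 := TemperedDistribution.fourierMultiplierCLM_sum ℂ (s := Finset.range (l + 1))
        (g := fun k ξ => sym Φ k ξ) (fun k _ => hasTemperateGrowth_sym hΦ k)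
      simp_rw [sum_sym] at h2
      change fmul (low Φ l) = _ at h2
      rw [h2]
      simp
    rw [e]
    refine (enorm_sum_le _ _).trans ((Finset.sum_le_sum fun k _ => hblock χ k).trans ?_)
    rw [← Finset.sum_mul, ← Finset.mul_sum]
    have : ∑ k ∈ Finset.range (l + 1), (2⁻¹ : ℝ≥0∞) ^ k ≤ 2 := by
      refine (ENNReal.sum_le_tsum _).trans ?_
      rw [ENNReal.tsum_geometric, ENNReal.one_sub_inv_two, inv_inv]
    calc _ ≤ c * N * 2 * ‖χ.toLp 2 (volume : Measure (Rn n))‖ₑ := by gcongr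
      _ = _ := by ring
  -- The truncated bound is uniform in `l`, and the cutoffs, moved to the test function, converge in
  -- the Schwartz topology.
  have hlim : ∀ χ : 𝓢(Rn n, ℂ), ‖fmul (wt σ) f χ‖ₑ ≤
      c * 2 * N * ‖χ.toLp 2 (volume : Measure (Rn n))‖ₑ := by
    intro χ
    have : Tendsto (fun l => ‖fmul (wt σ) (fmul (low Φ l) f) χ‖ₑ) atTop
        (𝓝 ‖fmul (wt σ) f χ‖ₑ) := by
      refine (Tendsto.enorm ?_)
      simp only [TemperedDistribution.fourierMultiplierCLM_apply_apply,
        FourierTransform.fourierInv_fourier_eq]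
      refine (f.continuous.tendsto _).comp ?_
      exact ((FourierTransform.continuous_fourier (E := 𝓢(Rn n, ℂ))).tendsto _).comp
        (tendsto_smulLeftCLM_low hΦ _)
    exact le_of_tendsto' this fun l => hsum χ l
  have hNt : N ≠ ⊤ := hf.ne
  obtain ⟨a, ha, han⟩ := exists_tdist_of_norm_apply_le (f := fmul (wt σ) f)
    (M := (c * 2 * N).toReal) ENNReal.toReal_nonneg fun χ => by
      have := hlim χ
      rw [← ofReal_norm, ← ofReal_norm, ← ENNReal.ofReal_toReal
        (a := c * 2 * N) (ENNReal.mul_ne_top (by finiteness) hNt),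
        ← ENNReal.ofReal_mul ENNReal.toReal_nonneg] at this
      exact (ENNReal.ofReal_le_ofReal_iff (by positivity)).1 this
  refine ⟨a, eq_ofL2_of_fmul_wt_eq ha, ?_⟩
  rw [← ofReal_norm]
  refine (ENNReal.ofReal_le_ofReal han).trans ?_
  rw [ENNReal.ofReal_toReal (ENNReal.mul_ne_top (by finiteness) hNt)]
  push_cast
  exact le_rfl

end Embedding

/-! ### The unitary group and its decay on a single block -/

section Propagator

variable {n : ℕ} {Φ : Rn n → ℝ} {φ : ℝ → ℝ}

/-- The symbol of `U(t)`. -/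
def phase (φ : ℝ → ℝ) (t : ℝ) (ξ : Rn n) : ℂ :=
  Complex.exp (Complex.I * (t * φ (2 * Real.pi * ‖ξ‖) : ℝ))

theorem norm_phase (φ : ℝ → ℝ) (t : ℝ) (ξ : Rn n) : ‖phase φ t ξ‖ = 1 := by
  rw [phase, mul_comm]; exact Complex.norm_exp_ofReal_mul_I _

/-- Nothing is known of `φ` at zero, but the phase is continuous off the origin, which suffices for
measurability. -/
theorem isSymbol_phase (hφ : ContinuousOn φ (Ioi 0)) (t : ℝ) : IsSymbol (phase (n := n) φ t) := by
  refine ⟨?_, 1, fun ξ => (norm_phase φ t ξ).le⟩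
  refine measurable_of_continuousOn_compl_singleton 0 ?_
  have h1 : ContinuousOn (fun ξ : Rn n => φ (2 * Real.pi * ‖ξ‖)) {0}ᶜ := by
    refine hφ.comp (by fun_prop) fun ξ hξ => ?_
    have : 0 < ‖ξ‖ := norm_pos_iff.2 hξ
    exact mul_pos (by positivity) this
  have h2 : ContinuousOn (fun ξ : Rn n => ((t * φ (2 * Real.pi * ‖ξ‖) : ℝ) : ℂ)) {0}ᶜ :=
    Complex.continuous_ofReal.comp_continuousOn (continuousOn_const.mul h1)
  exact Complex.continuous_exp.comp_continuousOn (continuousOn_const.mul h2)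

/-- The unitary group `U(t)` on the frequency side. -/
def prop (φ : ℝ → ℝ) (t : ℝ) : L2 n →L[ℂ] L2 n := mulOp (phase φ t)

theorem prop_mulOp (hφ : ContinuousOn φ (Ioi 0)) (t : ℝ) {m : Rn n → ℂ} (hm : IsSymbol m)
    (a : L2 n) : prop φ t (mulOp m a) = mulOp m (prop φ t a) :=
  mulOp_comm (isSymbol_phase hφ t) hm a

theorem prop_prop (hφ : ContinuousOn φ (Ioi 0)) (s t : ℝ) (a : L2 n) :
    prop φ s (prop φ t a) = prop φ (s + t) a := by
  rw [prop, prop, prop, mulOp_mulOp (isSymbol_phase hφ s) (isSymbol_phase hφ t)]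
  congr 2 with ξ
  rw [phase, phase, phase, ← Complex.exp_add]
  congr 1
  push_cast
  ring

theorem prop_zero (a : L2 n) : prop φ 0 a = a := by
  have : phase (n := n) φ 0 = fun _ => 1 := by funext ξ; simp [phase]
  rw [prop, this, mulOp_one]

theorem norm_prop (hφ : ContinuousOn φ (Ioi 0)) (t : ℝ) (a : L2 n) : ‖prop φ t a‖ = ‖a‖ := by
  have h : ∀ t (a : L2 n), ‖prop φ t a‖ ≤ ‖a‖ := fun t a =>
    (norm_mulOp_le (isSymbol_phase hφ t) (fun ξ => (norm_phase φ t ξ).le) a).trans (one_mul _).le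
  refine le_antisymm (h t a) ?_
  calc ‖a‖ = ‖prop φ (-t) (prop φ t a)‖ := by rw [prop_prop hφ, neg_add_cancel, prop_zero]
    _ ≤ _ := h _ _

theorem inner_prop (hφ : ContinuousOn φ (Ioi 0)) (t : ℝ) (g a : L2 n) :
    inner ℂ g (prop φ t a) = inner ℂ (prop φ (-t) g) a := by
  rw [prop, inner_mulOp (isSymbol_phase hφ t), prop]
  congr 3 with ξ
  rw [phase, phase, ← Complex.exp_conj]
  simp [Complex.conj_ofReal]

/-- Dominated convergence with the majorant `4 |a|²`: the phases converge pointwise and have modulus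
one. -/
theorem continuous_prop_apply (hφ : ContinuousOn φ (Ioi 0)) (a : L2 n) :
    Continuous fun t => prop φ t a := by
  rw [continuous_iff_continuousAt]
  intro s
  rw [ContinuousAt, tendsto_iff_edist_tendsto_0]
  have ha : Measurable a := (Lp.stronglyMeasurable a).measurable
  have h1 : Tendsto (fun t => ∫⁻ ξ, ‖phase φ t ξ - phase φ s ξ‖ₑ ^ 2 * ‖a ξ‖ₑ ^ 2) (𝓝 s)
      (𝓝 (∫⁻ _ : Rn n, 0)) := by
    refine tendsto_lintegral_filter_of_dominated_convergence (fun ξ => 4 * ‖a ξ‖ₑ ^ 2) ?_ ?_ ?_ ?_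
    · refine Eventually.of_forall fun t => ?_
      exact ((((isSymbol_phase hφ t).measurable.sub (isSymbol_phase hφ s).measurable).enorm).pow_const
        2).mul (by fun_prop)
    · refine Eventually.of_forall fun t => ae_of_all _ fun ξ => ?_
      gcongr
      have : ‖phase φ t ξ - phase φ s ξ‖ₑ ≤ 2 := by
        refine (enorm_sub_le).trans (le_of_eq ?_)
        rw [← ofReal_norm, ← ofReal_norm, norm_phase, norm_phase]
        norm_num
      calc _ ≤ (2 : ℝ≥0∞) ^ 2 := by gcongr
        _ = 4 := by norm_num
    · rw [lintegral_const_mul _ (by fun_prop), ← enorm_sq_eq_lintegral]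
      finiteness
    · refine ae_of_all _ fun ξ => ?_
      have hc : Continuous fun t => ‖phase φ t ξ - phase φ s ξ‖ₑ := by
        unfold phase; fun_prop
      have h2 : Tendsto (fun t => ‖phase φ t ξ - phase φ s ξ‖ₑ) (𝓝 s) (𝓝 0) := by
        have := hc.tendsto s
        simpa using this
      have h3 := ENNReal.Tendsto.mul_const ((ENNReal.continuous_pow 2).tendsto _ |>.comp h2)
        (b := ‖a ξ‖ₑ ^ 2) (Or.inr (by finiteness))
      simpa using h3
  simp only [lintegral_zero] at h1
  have h4 : ∀ t, edist (prop φ t a) (prop φ s a) =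
      (∫⁻ ξ, ‖phase φ t ξ - phase φ s ξ‖ₑ ^ 2 * ‖a ξ‖ₑ ^ 2) ^ (1 / 2 : ℝ) := by
    intro t
    have h5 : ‖prop φ t a - prop φ s a‖ₑ ^ 2 =
        ∫⁻ ξ, ‖phase φ t ξ - phase φ s ξ‖ₑ ^ 2 * ‖a ξ‖ₑ ^ 2 := by
      rw [prop, prop, ← mulOp_sub (isSymbol_phase hφ t) (isSymbol_phase hφ s),
        enorm_sq_eq_lintegral]
      apply lintegral_congr_ae
      filter_upwards [coeFn_mulOp ((isSymbol_phase hφ t).sub (isSymbol_phase hφ s)) a] with ξ e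
      rw [e, enorm_mul, mul_pow]
    rw [edist_eq_enorm_sub, ← h5, ← ENNReal.rpow_natCast, ← ENNReal.rpow_mul]
    norm_num
  simp_rw [h4]
  have h6 := (ENNReal.continuous_rpow_const (y := (1 / 2 : ℝ))).tendsto 0 |>.comp h1
  rw [ENNReal.zero_rpow_of_pos (by norm_num)] at h6
  exact h6

/-- Strong continuity in time is combined with the fact that every `prop φ t` is an isometry. -/
theorem continuous_prop (hφ : ContinuousOn φ (Ioi 0)) :
    Continuous fun z : ℝ × L2 n => prop φ z.1 z.2 := by
  rw [continuous_iff_continuousAt]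
  rintro ⟨s, a⟩
  rw [ContinuousAt, tendsto_iff_norm_sub_tendsto_zero]
  have h1 : Tendsto (fun z : ℝ × L2 n => ‖z.2 - a‖ + ‖prop φ z.1 a - prop φ s a‖) (𝓝 (s, a))
      (𝓝 0) := by
    have hc : Continuous fun z : ℝ × L2 n => ‖z.2 - a‖ + ‖prop φ z.1 a - prop φ s a‖ := by
      have := (continuous_prop_apply hφ a).comp (continuous_fst (X := ℝ) (Y := L2 n))
      simp only [Function.comp_def] at this
      fun_prop
    simpa using hc.tendsto (s, a)
  refine squeeze_zero (fun _ => norm_nonneg _) (fun z => ?_) h1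
  calc ‖prop φ z.1 z.2 - prop φ s a‖ = ‖prop φ z.1 (z.2 - a) + (prop φ z.1 a - prop φ s a)‖ := by
        rw [map_sub]; congr 1; abel
    _ ≤ _ := (norm_add_le _ _).trans (by rw [norm_prop hφ])

theorem HasFourierDensity.locallyIntegrable {f : 𝓢'(Rn n, ℂ)} {g : Rn n → ℂ}
    (h : HasFourierDensity f g) : LocallyIntegrable g volume := by
  intro x
  set β : ContDiffBump x := ⟨1, 2, one_pos, one_lt_two⟩
  have h₁ : HasCompactSupport (Complex.ofRealCLM ∘ β) := β.hasCompactSupport.comp_left rfl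
  have h₂ : ContDiff ℝ ∞ (Complex.ofRealCLM ∘ β) := Complex.ofRealCLM.contDiff.comp β.contDiff
  have h3 := (h (h₁.toSchwartzMap h₂)).1
  refine ⟨Metric.closedBall x 1, Metric.closedBall_mem_nhds x one_pos, ?_⟩
  refine h3.integrableOn.congr_fun (fun ξ hξ => ?_) Metric.isClosed_closedBall.measurableSet
  have : β ξ = 1 := β.one_of_mem_closedBall hξ
  simp [this]

theorem HasFourierDensity.ae_eq {f : 𝓢'(Rn n, ℂ)} {g₁ g₂ : Rn n → ℂ}
    (h₁ : HasFourierDensity f g₁) (h₂ : HasFourierDensity f g₂) : g₁ =ᵐ[volume] g₂ :=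
  ae_eq_of_forall_schwartzMap h₁.locallyIntegrable h₂.locallyIntegrable fun χ => by
    rw [← (h₁ χ).2, ← (h₂ χ).2]

theorem HasFourierDensity.congr {f : 𝓢'(Rn n, ℂ)} {g₁ g₂ : Rn n → ℂ}
    (h₁ : HasFourierDensity f g₁) (h : g₁ =ᵐ[volume] g₂) : HasFourierDensity f g₂ := fun χ => by
  have : (fun ξ => χ ξ * g₁ ξ) =ᵐ[volume] fun ξ => χ ξ * g₂ ξ := by
    filter_upwards [h] with ξ e
    rw [e]
  exact ⟨(h₁ χ).1.congr this, by rw [(h₁ χ).2, integral_congr_ae this]⟩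

theorem HasFourierDensity.eq {f₁ f₂ : 𝓢'(Rn n, ℂ)} {g : Rn n → ℂ}
    (h₁ : HasFourierDensity f₁ g) (h₂ : HasFourierDensity f₂ g) : f₁ = f₂ := by
  have : 𝓕 f₁ = 𝓕 f₂ := by
    ext χ
    rw [(h₁ χ).2, (h₂ χ).2]
  calc f₁ = 𝓕⁻ (𝓕 f₁) := (FourierTransform.fourierInv_fourier_eq f₁).symm
    _ = 𝓕⁻ (𝓕 f₂) := by rw [this]
    _ = f₂ := FourierTransform.fourierInv_fourier_eq f₂

theorem hasFourierDensity_ofL2 (s : ℝ) (a : L2 n) :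
    HasFourierDensity (ofL2 n s a) fun ξ => wt (-s) ξ * a ξ := by
  intro χ
  have e : ∀ ξ, SchwartzMap.smulLeftCLM ℂ (wt (-s)) χ ξ * a ξ = χ ξ * (wt (-s) ξ * a ξ) := by
    intro ξ
    rw [SchwartzMap.smulLeftCLM_apply_apply (hasTemperateGrowth_wt _), smul_eq_mul]
    ring
  constructor
  · simp_rw [← e]
    exact ((SchwartzMap.smulLeftCLM ℂ (wt (-s)) χ).memLp 2 volume).integrable_mul (Lp.memLp a)
  · rw [TemperedDistribution.fourier_apply, ofL2_apply,
      TemperedDistribution.fourierMultiplierCLM_apply_apply,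
      FourierTransform.fourierInv_fourier_eq, tdist_apply_fourier]
    simp_rw [e]

/-- The choice inside `propagator` is harmless: the density of a Fourier transform is unique almost
everywhere, and it determines the distribution. -/
theorem propagator_ofL2 (hφ : ContinuousOn φ (Ioi 0)) (s t : ℝ) (a : L2 n) :
    propagator φ t (ofL2 n s a) = ofL2 n s (prop φ t a) := by
  have hae : (fun ξ => phase φ t ξ * (wt (-s) ξ * a ξ)) =ᵐ[volume]
      fun ξ => wt (-s) ξ * prop φ t a ξ := by
    filter_upwards [coeFn_mulOp (isSymbol_phase hφ t) a] with ξ e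
    rw [prop, e]
    ring
  have hex : ∃ v, IsPropagated φ t (ofL2 n s a) v :=
    ⟨ofL2 n s (prop φ t a), _, hasFourierDensity_ofL2 s a,
      (hasFourierDensity_ofL2 s (prop φ t a)).congr hae.symm⟩
  rw [propagator, dif_pos hex]
  obtain ⟨g, hg, hv⟩ := hex.choose_spec
  have hv' : HasFourierDensity hex.choose fun ξ => wt (-s) ξ * prop φ t a ξ := by
    refine hv.congr (EventuallyEq.trans ?_ hae)
    filter_upwards [hg.ae_eq (hasFourierDensity_ofL2 s a)] with ξ e
    rw [e]; rfl
  exact hv'.eq (hasFourierDensity_ofL2 s _)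

theorem block_zero (hΦ : IsCutoff Φ) (k : ℕ) (a : L2 n) : block Φ 0 k a = mulOp (sym Φ k) a := by
  apply Lp.ext
  filter_upwards [coeFn_block hΦ 0 k a, coeFn_mulOp (isSymbol_sym hΦ k) a] with ξ e1 e2
  rw [e1, e2, neg_zero, wt_zero, mul_one]

theorem lpn_block_le_besovNorm (hΦ : IsCutoff Φ) (s σ : ℝ) {p : ℝ≥0∞} (hp : 1 ≤ p) (k : ℕ)
    (a : L2 n) :
    lpn p (block Φ σ k a) ≤ ENNReal.ofReal (2 ^ (-((k : ℝ) * s))) * besovNorm Φ s p (ofL2 n σ a) := by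
  have := ofReal_rpow_mul_distLpNorm_le_besovNorm Φ s p (ofL2 n σ a) k
  rw [fmul_sym_ofL2 hΦ, distLpNorm_tdist hp] at this
  refine le_trans (le_of_eq ?_) (mul_le_mul_right this _)
  rw [← mul_assoc, ← ENNReal.ofReal_mul (by positivity), ← Real.rpow_add two_pos, neg_add_cancel]
  simp

/-- The decay estimate for a single Littlewood-Paley block. -/
theorem exists_lpn_prop_le (hΦ : IsCutoff Φ) (p p' : ℝ≥0∞) [p.HolderConjugate p'] (α K : ℝ)
    (hK : 0 < K) :
    ∃ C : ℝ≥0, ∀ (φ : ℝ → ℝ) (θ₁ θ₂ : ℝ), ContinuousOn φ (Ioi 0) →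
      DecayEstimate Φ φ p p' α θ₁ θ₂ K → ∀ (t : ℝ), t ≠ 0 → ∀ (k : ℕ) (x : L2 n),
        lpn p (prop φ t (mulOp (sym Φ k) x)) ≤
          C * ENNReal.ofReal (2 ^ (-((k : ℝ) * α))) * ENNReal.ofReal (decayRate θ₁ θ₂ t) *
            lpn p' (mulOp (sym Φ k) x) := by
  obtain ⟨B, hB⟩ := exists_lpn_sym_le hΦ
  have hp := ENNReal.HolderTriple.le p p' 1
  have hp' := ENNReal.HolderTriple.le p' p 1
  -- The factor `3 * B` bounds the Besov norm of a single block by its `L^{p'}` norm. The other `3`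
  -- counts the neighbours into which the output is decomposed, and `2 ^ |α|` replaces their indices
  -- by `k`.
  set D : ℝ≥0 := (2 ^ |α| : ℝ).toNNReal * 3 * (K.toNNReal * (3 * B)) with hD
  -- A nonzero constant makes the right side infinite when `lpn p' v` is, since the hypothesis says
  -- nothing in that case.
  refine ⟨D + 1, fun φ θ₁ θ₂ hφ hdec t ht k x => ?_⟩
  set v := mulOp (sym Φ k) x with hv
  have hk := decayRate_pos θ₁ θ₂ ht
  rcases eq_or_ne (lpn p' v) ⊤ with h | h
  · rw [h, ENNReal.mul_top]
    · exact le_top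
    · have h1 : ENNReal.ofReal (2 ^ (-((k : ℝ) * α))) ≠ 0 := by
        rw [Ne, ENNReal.ofReal_eq_zero, not_le]; positivity
      have h2 : ENNReal.ofReal (decayRate θ₁ θ₂ t) ≠ 0 := by
        rw [Ne, ENNReal.ofReal_eq_zero, not_le]; exact hk
      have h3 : ((D + 1 : ℝ≥0) : ℝ≥0∞) ≠ 0 := by positivity
      exact mul_ne_zero (mul_ne_zero h3 h1) h2
  have hbes : besovNorm Φ 0 p' (ofL2 n 0 v) ≤ 3 * B * lpn p' v := by
    rw [besovNorm_ofL2 hΦ 0 0 hp', one_div, ENNReal.rpow_inv_le_iff (by norm_num)]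
    rw [tsum_eq_sum (s := nbr k)]
    · calc _ ≤ ∑ i ∈ nbr k, (B * lpn p' v) ^ 2 := by
            refine Finset.sum_le_sum fun i _ => ?_
            rw [block_zero hΦ]
            simp only [mul_zero, Real.rpow_zero, ENNReal.ofReal_one, one_mul]
            gcongr
            exact hB p' p i v
        _ ≤ 3 * (B * lpn p' v) ^ 2 := by
            rw [Finset.sum_const, nsmul_eq_mul]
            gcongr
            exact_mod_cast card_nbr_le k
        _ ≤ 3 ^ 2 * (B * lpn p' v) ^ 2 := by
            gcongr; norm_num
        _ = _ := by rw [← mul_pow, ← mul_assoc]; exact (ENNReal.rpow_ofNat _ 2).symm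
    · intro i hi
      rw [block_zero hΦ, hv, mulOp_sym_mulOp_sym_eq_zero hΦ hi, lpn_zero]
      simp
  have hfin : besovNorm Φ 0 p' (ofL2 n 0 v) < ⊤ :=
    hbes.trans_lt (ENNReal.mul_lt_top (by finiteness) h.lt_top)
  have hest := hdec t ht _ hfin
  rw [propagator_ofL2 hφ] at hest
  have hsum : prop φ t v = ∑ i ∈ nbr k, mulOp (sym Φ i) (prop φ t v) := by
    conv_lhs => rw [hv, ← sum_nbr_mulOp_sym hΦ k x, map_sum]
    exact Finset.sum_congr rfl fun i _ => prop_mulOp hφ t (isSymbol_sym hΦ i) _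
  have hterm : ∀ i ∈ nbr k, lpn p (mulOp (sym Φ i) (prop φ t v)) ≤
      ENNReal.ofReal (2 ^ |α|) * ENNReal.ofReal (2 ^ (-((k : ℝ) * α))) *
        besovNorm Φ α p (ofL2 n 0 (prop φ t v)) := by
    intro i hi
    rw [← block_zero hΦ]
    refine (lpn_block_le_besovNorm hΦ α 0 hp i _).trans ?_
    gcongr
    rw [← ENNReal.ofReal_mul (by positivity), ← Real.rpow_add two_pos]
    apply ENNReal.ofReal_le_ofReal
    apply Real.rpow_le_rpow_of_exponent_le one_le_two
    have h3 := mem_nbr.1 hi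
    have h4 : |(k : ℝ) - i| ≤ 1 := by
      rw [abs_le]
      have h5 : (i : ℝ) ≤ k + 1 := by exact_mod_cast h3.1
      have h6 : (k : ℝ) ≤ i + 1 := by exact_mod_cast h3.2
      constructor <;> linarith
    have h7 : ((k : ℝ) - i) * α ≤ |α| := by
      refine (le_abs_self _).trans ?_
      rw [abs_mul]
      exact mul_le_of_le_one_left (abs_nonneg _) h4
    linarith
  rw [hsum]
  refine (lpn_sum_le hp _ _).trans ((Finset.sum_le_sum hterm).trans ?_)
  rw [Finset.sum_const, nsmul_eq_mul]
  calc ((nbr k).card : ℝ≥0∞) * (ENNReal.ofReal (2 ^ |α|) * ENNReal.ofReal (2 ^ (-((k : ℝ) * α))) *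
        besovNorm Φ α p (ofL2 n 0 (prop φ t v)))
      ≤ 3 * (ENNReal.ofReal (2 ^ |α|) * ENNReal.ofReal (2 ^ (-((k : ℝ) * α))) *
        (ENNReal.ofReal (K * decayRate θ₁ θ₂ t) * (3 * B * lpn p' v))) := by
        gcongr
        · exact_mod_cast card_nbr_le k
        · exact hest.trans (by gcongr)
    _ = D * ENNReal.ofReal (2 ^ (-((k : ℝ) * α))) * ENNReal.ofReal (decayRate θ₁ θ₂ t) *
          lpn p' v := by
        rw [ENNReal.ofReal_mul hK.le, hD]
        push_cast
        simp only [ENNReal.ofReal]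
        ring
    _ ≤ _ := by
        gcongr
        exact le_self_add

end Propagator

/-! ### The `TT*` argument -/

section Duality

theorem measurable_apply_simpleFunc {α β : Type*} [MeasurableSpace α] [MeasurableSpace β]
    {F : ℕ → α → β} (hF : ∀ i, Measurable (F i)) (s : SimpleFunc α ℕ) :
    Measurable fun t => F (s t) t :=
  (measurable_from_prod_countable_right (f := fun x : ℕ × α => F x.1 x.2) hF).comp
    (s.measurable.prodMk measurable_id)

/-- The square is the inner product of the integral with itself; the integral is pulled out of one
slot and then out of the other. -/
theorem enorm_integral_sq_le {α E : Type*} [MeasurableSpace α] {μ : Measure α}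
    [NormedAddCommGroup E] [InnerProductSpace ℂ E] [CompleteSpace E] {G : α → E}
    (hG : Integrable G μ) :
    ‖∫ t, G t ∂μ‖ₑ ^ 2 ≤ ∫⁻ t, ∫⁻ s, ‖inner ℂ (G t) (G s)‖ₑ ∂μ ∂μ := by
  have h0 : ∀ v : E, ‖v‖ₑ ^ 2 = ‖inner ℂ v v‖ₑ := fun v => by
    rw [← ofReal_norm, ← ofReal_norm, ← ENNReal.ofReal_pow (norm_nonneg _),
      inner_self_eq_norm_sq_to_K]
    simp
  have h1 : ∀ c : E, ‖inner ℂ c (∫ t, G t ∂μ)‖ₑ ≤ ∫⁻ s, ‖inner ℂ c (G s)‖ₑ ∂μ := fun c => by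
    rw [← integral_inner hG]; exact enorm_integral_le_lintegral_enorm _
  rw [h0]
  refine (h1 _).trans (lintegral_mono fun t => ?_)
  refine le_trans (le_of_eq ?_) (h1 (G t))
  rw [← ofReal_norm, ← ofReal_norm, norm_inner_symm]

variable {n : ℕ} {Φ : Rn n → ℝ} {φ : ℝ → ℝ}

theorem stronglyMeasurable_prop (hφ : ContinuousOn φ (Ioi 0)) {β : Type*}
    [MeasurableSpace β] {g : β → ℝ} (hg : Measurable g) {F : β → L2 n}
    (hF : StronglyMeasurable F) : StronglyMeasurable fun s => prop φ (g s) (F s) :=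
  (continuous_prop hφ).comp_stronglyMeasurable (hg.stronglyMeasurable.prodMk hF)

theorem integrable_prop (hφ : ContinuousOn φ (Ioi 0)) {g : ℝ → ℝ} (hg : Measurable g)
    {F : ℝ → L2 n} (hF : StronglyMeasurable F) {μ : Measure ℝ} (hF' : Integrable F μ) :
    Integrable (fun s => prop φ (g s) (F s)) μ :=
  hF'.congr' (stronglyMeasurable_prop hφ hg hF).aestronglyMeasurable
    (ae_of_all _ fun _ => (norm_prop hφ _ _).symm)

theorem measurable_lpn_comp {β : Type*} [MeasurableSpace β] (p p' : ℝ≥0∞)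
    [p.HolderConjugate p'] {F : β → L2 n}
    (hF : StronglyMeasurable F) : Measurable fun t => lpn p (F t) := by
  borelize (L2 n)
  exact (measurable_lpn p p').comp hF.measurable

/-- Unitarity and the group law combine the two propagators into `U(t - s)`, so the square becomes a
double integral governed by the kernel. The diagonal `t = s`, where no decay is assumed, is a null
set for each `t`. -/
theorem enorm_integral_prop_sq_le (hφ : ContinuousOn φ (Ioi 0)) {q' A C : ℝ≥0∞} {κ : ℝ → ℝ≥0∞}
    (hκ : Measurable κ)
    (hC : ∀ f g : ℝ → ℝ≥0∞, Measurable f → Measurable g →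
      ∫⁻ t, ∫⁻ s, f s * g t * κ (t - s) ≤ C * eLpNorm f q' volume * eLpNorm g q' volume)
    {F : ℝ → L2 n} (hF : StronglyMeasurable F) (hF' : Integrable F) {N : ℝ → ℝ≥0∞}
    (hN : Measurable N)
    (h : ∀ t s, t ≠ s → ‖inner ℂ (F t) (prop φ (t - s) (F s))‖ₑ ≤ A * κ (t - s) * N s * N t) :
    ‖∫ s, prop φ (-s) (F s)‖ₑ ^ 2 ≤ A * C * eLpNorm N q' volume ^ 2 := by
  refine (enorm_integral_sq_le (integrable_prop hφ measurable_neg hF hF')).trans ?_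
  have h1 : ∀ t, ∫⁻ s, ‖inner ℂ (prop φ (-t) (F t)) (prop φ (-s) (F s))‖ₑ ≤
      A * ∫⁻ s, N s * N t * κ (t - s) := by
    intro t
    rw [← lintegral_const_mul _ (by fun_prop)]
    refine lintegral_mono_ae ?_
    filter_upwards [Measure.ae_ne volume t] with s hs
    rw [← inner_prop hφ, prop_prop hφ, ← sub_eq_add_neg]
    refine (h t s hs.symm).trans (le_of_eq ?_)
    ring
  refine (lintegral_mono h1).trans ?_
  have hm : Measurable fun z : ℝ × ℝ => N z.2 * N z.1 * κ (z.1 - z.2) := by fun_prop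
  rw [lintegral_const_mul _ hm.lintegral_prod_right', mul_assoc, sq, ← mul_assoc C]
  gcongr
  exact hC N N hN hN

/-- The homogeneous estimate for one frequency block, by duality. -/
theorem eLpNorm_lpn_prop_le (hφ : ContinuousOn φ (Ioi 0)) {p p' q q' A B C : ℝ≥0∞}
    [p.HolderConjugate p'] [q.HolderConjugate q'] {κ : ℝ → ℝ≥0∞} (hκ : Measurable κ)
    (hC : ∀ f g : ℝ → ℝ≥0∞, Measurable f → Measurable g →
      ∫⁻ t, ∫⁻ s, f s * g t * κ (t - s) ≤ C * eLpNorm f q' volume * eLpNorm g q' volume)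
    {m : Rn n → ℂ} (hm : IsSymbol m) (hmc : ∀ ξ, (starRingEnd ℂ) (m ξ) = m ξ)
    (hB : ∀ x, lpn p' (mulOp m x) ≤ B * lpn p' x)
    (hA : ∀ t ≠ 0, ∀ x, lpn p (prop φ t (mulOp m x)) ≤ A * κ t * lpn p' (mulOp m x)) (x : L2 n) :
    eLpNorm (fun t => lpn p (prop φ t (mulOp m x))) q volume ≤
      (A * B ^ 2 * C) ^ (1 / 2 : ℝ) * ‖x‖ₑ := by
  -- Countably many testers in space, chosen measurably in time, avoid a duality theorem for
  -- vector-valued `L^q` spaces.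
  obtain ⟨g, hg1, hg⟩ := exists_seq_lpn_eq_iSup n p p'
  have hu : StronglyMeasurable fun t => prop φ t (mulOp m x) :=
    (continuous_prop_apply hφ _).stronglyMeasurable
  have hz : ∀ i, StronglyMeasurable fun t => inner ℂ (g i) (prop φ t (mulOp m x)) := fun i =>
    (Continuous.inner continuous_const (continuous_prop_apply hφ _)).stronglyMeasurable
  refine eLpNorm_le_of_forall_lintegral_mul_le q q' (measurable_lpn_comp p p' hu) _ ?_
  rintro w hw ⟨R, hR⟩ hfin
  -- For a simple choice of testers the integral equals `⟨x, ∫ U(-t) F(t) dt⟩`, where `F` carries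
  -- the weight `w`, the phase of the pairing and the projected tester. The Cauchy-Schwarz
  -- inequality and the `TT*` bound for `F` finish the argument.
  have key : ∀ s : SimpleFunc ℝ ℕ,
      ∫⁻ t, ‖inner ℂ (g (s t)) (prop φ t (mulOp m x))‖ₑ * w t ≤
        (A * B ^ 2 * C) ^ (1 / 2 : ℝ) * ‖x‖ₑ * eLpNorm w q' volume := by
    intro s
    set z : ℝ → ℂ := fun t => inner ℂ (g (s t)) (prop φ t (mulOp m x)) with hzdef
    have hzm : Measurable z := 
      measurable_apply_simpleFunc (F := fun i t => inner ℂ (g i) (prop φ t (mulOp m x)))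
        (fun i => (hz i).measurable) s
    set c : ℝ → ℂ := fun t => ((w t).toReal : ℂ) * (z t / ‖z t‖) with hcdef
    have hcm : Measurable c := by
      have := hw.ennreal_toReal
      exact (Complex.measurable_ofReal.comp this).mul
        (hzm.div (Complex.measurable_ofReal.comp hzm.norm))
    have hwt : ∀ t, w t ≠ ⊤ := fun t => ne_top_of_le_ne_top ENNReal.coe_ne_top (hR t)
    have hcw : ∀ t, ‖c t‖ₑ ≤ w t := fun t => by
      rw [hcdef, enorm_mul, ← ofReal_norm, Complex.norm_real,
        Real.norm_of_nonneg ENNReal.toReal_nonneg, ENNReal.ofReal_toReal (hwt t)]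
      refine mul_le_of_le_one_right' ?_
      rw [← ofReal_norm, norm_div, Complex.norm_real, norm_norm]
      exact ENNReal.ofReal_le_one.2 (div_self_le_one _)
    -- `G` takes finitely many values and is therefore bounded in `L²`, even though the testers are
    -- normalized only in `L^{p'}`.
    set G : SimpleFunc ℝ (L2 n) := s.map fun i => mulOp m (g i) with hGdef
    have hGs : ∀ t, G t = mulOp m (g (s t)) := fun t => rfl
    set F : ℝ → L2 n := fun t => c t • G t with hFdef
    have hFm : StronglyMeasurable F := hcm.stronglyMeasurable.smul G.stronglyMeasurable
    obtain ⟨M, hM⟩ := G.exists_forall_norm_le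
    have hFi : Integrable F := by
      have hci : Integrable c := by
        refine ⟨hcm.aestronglyMeasurable, ?_⟩
        calc ∫⁻ t, ‖c t‖ₑ ≤ ∫⁻ t, (Function.support w).indicator (fun _ => (R : ℝ≥0∞)) t := by
              refine lintegral_mono fun t => ?_
              by_cases ht : t ∈ Function.support w
              · rw [indicator_of_mem ht]; exact (hcw t).trans (hR t)
              · rw [indicator_of_notMem ht]; exact (hcw t).trans (Function.notMem_support.1 ht).le
          _ ≤ R * volume (Function.support w) := lintegral_indicator_const_le _ _
          _ < ⊤ := ENNReal.mul_lt_top ENNReal.coe_lt_top hfin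
      refine Integrable.mono' (hci.norm.mul_const M) hFm.aestronglyMeasurable (ae_of_all _ fun t => ?_)
      rw [hFdef, norm_smul]
      gcongr
      exact hM t
    have hsq := enorm_integral_prop_sq_le hφ hκ hC hFm hFi (N := w) (A := A * B ^ 2) hw ?_
    · have hv : ‖∫ s, prop φ (-s) (F s)‖ₑ ≤
          (A * B ^ 2 * C) ^ (1 / 2 : ℝ) * eLpNorm w q' volume := by
        rw [← ENNReal.rpow_le_rpow_iff (z := 2) two_pos, ENNReal.mul_rpow_of_nonneg _ _ two_pos.le,
          ← ENNReal.rpow_mul]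
        norm_num
        exact_mod_cast hsq
      have hid : ∀ t, inner ℂ x (prop φ (-t) (F t)) = ((w t).toReal * ‖z t‖ : ℝ) := by
        intro t
        rw [← inner_conj_symm, ← inner_prop hφ, hFdef]
        simp only [inner_smul_left, hGs]
        have e : inner ℂ (mulOp m (g (s t))) (prop φ t x) = z t := by
          simp only [hzdef]
          rw [prop_mulOp hφ t hm, inner_mulOp hm]
          simp only [hmc]
        rw [e, hcdef]
        simp only [map_mul, map_div₀, Complex.conj_ofReal, Complex.conj_conj]
        rcases eq_or_ne (z t) 0 with h0 | h0
        · simp [h0]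
        · have : (‖z t‖ : ℂ) ≠ 0 := by simpa using h0
          have h2 := Complex.mul_conj' (z t)
          push_cast
          field_simp
          rw [mul_assoc, h2]
      have hpi := integrable_prop hφ measurable_neg hFm hFi
      calc ∫⁻ t, ‖z t‖ₑ * w t = ∫⁻ t, ENNReal.ofReal ((w t).toReal * ‖z t‖) := by
            refine lintegral_congr fun t => ?_
            rw [ENNReal.ofReal_mul ENNReal.toReal_nonneg, ENNReal.ofReal_toReal (hwt t), ofReal_norm,
              mul_comm]
        _ = ENNReal.ofReal (∫ t, (w t).toReal * ‖z t‖) := by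
            rw [ofReal_integral_eq_lintegral_ofReal]
            · have := (hpi.const_inner (𝕜 := ℂ) x).norm
              refine this.congr (ae_of_all _ fun t => ?_)
              simp only [hid]
              rw [Complex.norm_real, Real.norm_of_nonneg (by positivity)]
            · exact ae_of_all _ fun t => by positivity
        _ = ‖inner ℂ x (∫ t, prop φ (-t) (F t))‖ₑ := by
            rw [← integral_inner hpi]
            simp only [hid]
            rw [integral_complex_ofReal, ← ofReal_norm, Complex.norm_real,
              Real.norm_of_nonneg (integral_nonneg fun t => by positivity)]
        _ ≤ ‖x‖ₑ * ‖∫ t, prop φ (-t) (F t)‖ₑ := by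
            rw [← ofReal_norm, ← ofReal_norm, ← ofReal_norm, ← ENNReal.ofReal_mul (norm_nonneg _)]
            exact ENNReal.ofReal_le_ofReal (norm_inner_le_norm _ _)
        _ ≤ ‖x‖ₑ * ((A * B ^ 2 * C) ^ (1 / 2 : ℝ) * eLpNorm w q' volume) := by gcongr
        _ = _ := by ring
    · intro t s' hts
      rw [hFdef]
      simp only [map_smul, inner_smul_left, inner_smul_right, enorm_mul, hGs]
      -- The tester occurs on both sides of the pairing, and each occurrence of the projector costs
      -- a factor `B`.
      have h1 : ‖inner ℂ (mulOp m (g (s t))) (prop φ (t - s') (mulOp m (g (s s'))))‖ₑ ≤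
          B * (A * κ (t - s') * B) := by
        have hb : ∀ i, lpn p' (mulOp m (g i)) ≤ B := fun i =>
          (hB _).trans (mul_le_of_le_one_right' (hg1 i))
        refine (enorm_inner_le_lpn_mul_lpn p p' _ _).trans ?_
        gcongr
        · exact hb _
        · refine (hA _ (sub_ne_zero.2 hts) _).trans ?_
          gcongr
          exact hb _
      have h2 : ‖(starRingEnd ℂ) (c t)‖ₑ = ‖c t‖ₑ := by
        rw [← ofReal_norm, ← ofReal_norm, RCLike.norm_conj]
      rw [h2]
      calc _ ≤ w s' * (w t * (B * (A * κ (t - s') * B))) := by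
            gcongr
            · exact hcw s'
            · exact hcw t
        _ = _ := by ring
  -- The best of the first `j + 1` testers is selected at each time. As `j` grows these values reach
  -- the norm from below, and Fatou's lemma passes to the limit.
  choose s hs using fun j => exists_simpleFunc_forall_le
    (F := fun i t => ‖inner ℂ (g i) (prop φ t (mulOp m x))‖ₑ) (fun i => (hz i).measurable.enorm) j
  have hzs : ∀ j, Measurable fun t => ‖inner ℂ (g (s j t)) (prop φ t (mulOp m x))‖ₑ := fun j =>
    measurable_apply_simpleFunc (F := fun i t => ‖inner ℂ (g i) (prop φ t (mulOp m x))‖ₑ)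
      (fun i => (hz i).measurable.enorm) (s j)
  calc ∫⁻ t, lpn p (prop φ t (mulOp m x)) * w t
      ≤ ∫⁻ t, liminf (fun j => ‖inner ℂ (g (s j t)) (prop φ t (mulOp m x))‖ₑ * w t) atTop := by
        refine lintegral_mono fun t => ?_
        rw [hg, ENNReal.iSup_mul]
        refine iSup_le fun i => le_liminf_of_le (by isBoundedDefault) ?_
        filter_upwards [eventually_ge_atTop i] with j hj
        gcongr
        exact hs j t i hj
    _ ≤ liminf (fun j => ∫⁻ t, ‖inner ℂ (g (s j t)) (prop φ t (mulOp m x))‖ₑ * w t) atTop :=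
        lintegral_liminf_le fun j => (hzs j).mul hw
    _ ≤ _ := liminf_le_of_le (by isBoundedDefault) fun b hb => by
        obtain ⟨j, hj⟩ := hb.exists
        exact hj.trans (key (s j))

end Duality

/-! ### Bochner representatives of the forcing and the Duhamel integral -/

section Representatives

variable {n : ℕ} {Φ : Rn n → ℝ} {φ : ℝ → ℝ}

/-- The pairing of `ofL2 n s` with a Schwartz function. -/
def ofL2Apply (s : ℝ) (χ : 𝓢(Rn n, ℂ)) : L2 n →L[ℂ] ℂ :=
  (PointwiseConvergenceCLM.evalCLM (RingHom.id ℂ) ℂ χ).comp (ofL2 n s)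

theorem ofL2Apply_apply (s : ℝ) (χ : 𝓢(Rn n, ℂ)) (a : L2 n) : ofL2Apply s χ a = ofL2 n s a χ := rfl

/-- The embedding `hN` turns convergence of simple functions in the norm `N` into convergence of
their densities in `L²`. -/
theorem StronglyMeas.exists_aestronglyMeasurable {T σ : ℝ} {N : 𝓢'(Rn n, ℂ) → ℝ≥0∞} {C : ℝ≥0}
    (hN : ∀ f, N f < ⊤ → ∃ a, f = ofL2 n σ a ∧ ‖a‖ₑ ≤ C * N f) {f : ℝ → 𝓢'(Rn n, ℂ)}
    (hf : StronglyMeas T N f) :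
    ∃ b : ℝ → L2 n, AEStronglyMeasurable b (volume.restrict (Ioo (-T) T)) ∧
      ∀ᵐ t ∂(volume.restrict (Ioo (-T) T)), f t = ofL2 n σ (b t) := by
  classical
  obtain ⟨s, hs, hlim⟩ := hf
  -- `R` inverts `ofL2 n σ` on its range. No measurability of `R` is needed, since it is composed
  -- only with simple functions.
  set R : 𝓢'(Rn n, ℂ) → L2 n := fun f => if h : ∃ a, f = ofL2 n σ a then h.choose else 0 with hR
  have hRs : ∀ a, R (ofL2 n σ a) = a := fun a => by
    have h : ∃ b, ofL2 n σ a = ofL2 n σ b := ⟨a, rfl⟩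
    simp only [hR, dif_pos h]
    exact (ofL2_injective n σ h.choose_spec).symm
  have hlim' : ∀ᵐ t ∂(volume.restrict (Ioo (-T) T)), f t = ofL2 n σ (R (f t)) ∧
      Tendsto (fun j => R (s j t)) atTop (𝓝 (R (f t))) := by
    filter_upwards [hlim] with t ht
    have hex : ∃ a, f t = ofL2 n σ a := by
      obtain ⟨j, hj⟩ := (ht.eventually (gt_mem_nhds ENNReal.zero_lt_top)).exists
      obtain ⟨a, ha, -⟩ := hN _ (hs j t)
      obtain ⟨c, hc, -⟩ := hN _ hj
      refine ⟨a - c, ?_⟩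
      rw [map_sub, ← ha, ← hc, sub_sub_cancel]
    obtain ⟨a, ha⟩ := hex
    rw [ha, hRs]
    refine ⟨rfl, ?_⟩
    rw [tendsto_iff_edist_tendsto_0]
    have h0 : Tendsto (fun j => (C : ℝ≥0∞) * N (s j t - f t)) atTop (𝓝 0) := by
      simpa using ENNReal.Tendsto.const_mul ht (Or.inr ENNReal.coe_ne_top)
    refine tendsto_of_tendsto_of_tendsto_of_le_of_le' tendsto_const_nhds h0
      (Eventually.of_forall fun _ => zero_le) ?_
    filter_upwards [ht.eventually (gt_mem_nhds ENNReal.zero_lt_top)] with j hj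
    obtain ⟨b, hb, -⟩ := hN _ (hs j t)
    obtain ⟨c, hc, hcN⟩ := hN _ hj
    have : c = R (s j t) - a := ofL2_injective n σ (by rw [← hc, map_sub, hb, hRs, ha])
    rw [edist_eq_enorm_sub, ← this]
    exact hcN
  refine ⟨fun t => R (f t), ?_, hlim'.mono fun t h => h.1⟩
  exact aestronglyMeasurable_of_tendsto_ae atTop
    (fun j => ((s j).map R).stronglyMeasurable.aestronglyMeasurable) (hlim'.mono fun t h => h.2)

theorem eLpNorm_le_spaceTimeNorm {q : ℝ≥0∞} {T : ℝ} {N : 𝓢'(Rn n, ℂ) → ℝ≥0∞}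
    {f : ℝ → 𝓢'(Rn n, ℂ)} (h : spaceTimeNorm q T N f < ⊤) :
    StronglyMeas T N f ∧
      spaceTimeNorm q T N f = eLpNorm (fun t => N (f t)) q (volume.restrict (Ioo (-T) T)) := by
  have hs : StronglyMeas T N f := by
    by_contra hs
    rw [spaceTimeNorm, iInf_neg hs] at h
    exact lt_irrefl _ h
  exact ⟨hs, by rw [spaceTimeNorm, iInf_pos hs]⟩

/-- The density is extended by zero outside `(-T, T)`. The estimates can then be made on the whole
line, with constants that do not involve `T`. -/
theorem exists_representative {T σ : ℝ} {N : 𝓢'(Rn n, ℂ) → ℝ≥0∞} {C : ℝ≥0} (r r' : ℝ≥0∞)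
    [r.HolderConjugate r'] (hN : ∀ f, N f < ⊤ → ∃ a, f = ofL2 n σ a ∧ ‖a‖ₑ ≤ C * N f)
    (hN0 : N 0 = 0)
    (hNm : ∀ b : ℝ → L2 n, StronglyMeasurable b → Measurable fun t => N (ofL2 n σ (b t)))
    {f : ℝ → 𝓢'(Rn n, ℂ)} (hf : spaceTimeNorm r T N f < ⊤) :
    ∃ b : ℝ → L2 n, StronglyMeasurable b ∧ Integrable b ∧
      (∀ᵐ t ∂(volume.restrict (Ioo (-T) T)), f t = ofL2 n σ (b t)) ∧
      eLpNorm (fun t => N (ofL2 n σ (b t))) r volume = spaceTimeNorm r T N f := by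
  obtain ⟨hs, hfe⟩ := eLpNorm_le_spaceTimeNorm hf
  obtain ⟨b₀, hb₀, hfb₀⟩ := hs.exists_aestronglyMeasurable hN
  set b : ℝ → L2 n := (Ioo (-T) T).indicator (hb₀.mk b₀) with hb
  have hbm : StronglyMeasurable b := hb₀.stronglyMeasurable_mk.indicator measurableSet_Ioo
  have hfb : ∀ᵐ t ∂(volume.restrict (Ioo (-T) T)), f t = ofL2 n σ (b t) := by
    filter_upwards [hfb₀, hb₀.ae_eq_mk, ae_restrict_mem measurableSet_Ioo] with t h1 h2 h3
    rw [h1, h2, hb, indicator_of_mem h3]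
  have hNb : (fun t => N (ofL2 n σ (b t))) =
      (Ioo (-T) T).indicator fun t => N (ofL2 n σ (b t)) := by
    funext t
    by_cases ht : t ∈ Ioo (-T) T
    · rw [indicator_of_mem ht]
    · rw [indicator_of_notMem ht, hb, indicator_of_notMem ht, map_zero, hN0]
  have he : eLpNorm (fun t => N (ofL2 n σ (b t))) r (volume.restrict (Ioo (-T) T)) =
      spaceTimeNorm r T N f := by
    rw [hfe]
    exact eLpNorm_congr_ae (hfb.mono fun t ht => by simp only [ht])
  refine ⟨b, hbm, ⟨hbm.aestronglyMeasurable, ?_⟩, hfb, ?_⟩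
  -- The length of the interval enters only this qualitative integrability, through Hölder's
  -- inequality against the constant `1`.
  · have hfin : ∫⁻ t in Ioo (-T) T, N (ofL2 n σ (b t)) < ⊤ := by
      have h1 := lintegral_mul_le_eLpNorm_mul_eLpNorm (μ := volume.restrict (Ioo (-T) T)) r r'
        (hNm b hbm).aemeasurable (aemeasurable_const (b := (1 : ℝ≥0∞)))
      simp only [mul_one] at h1
      refine h1.trans_lt (ENNReal.mul_lt_top (he.trans_lt hf) ?_)
      have h2 : MemLp (fun _ : ℝ => (1 : ℝ)) r' (volume.restrict (Ioo (-T) T)) := memLp_const 1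
      refine lt_of_le_of_lt (le_of_eq ?_) h2.2
      exact eLpNorm_congr_enorm_ae (ae_of_all _ fun t => by simp)
    have hlt := ae_lt_top (hNm b hbm) hfin.ne
    have hind : (fun t => ‖b t‖ₑ) = (Ioo (-T) T).indicator fun t => ‖b t‖ₑ := by
      funext t
      by_cases ht : t ∈ Ioo (-T) T
      · rw [indicator_of_mem ht]
      · rw [indicator_of_notMem ht, hb, indicator_of_notMem ht, enorm_zero]
    rw [HasFiniteIntegral, hind, lintegral_indicator measurableSet_Ioo]
    calc ∫⁻ t in Ioo (-T) T, ‖b t‖ₑ ≤ ∫⁻ t in Ioo (-T) T, C * N (ofL2 n σ (b t)) := by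
          refine lintegral_mono_ae (hlt.mono fun t ht => ?_)
          obtain ⟨a, ha, haN⟩ := hN _ ht
          rw [ofL2_injective n σ ha, ← ha]
          exact haN
      _ = C * ∫⁻ t in Ioo (-T) T, N (ofL2 n σ (b t)) := lintegral_const_mul _ (hNm b hbm)
      _ < ⊤ := ENNReal.mul_lt_top ENNReal.coe_lt_top hfin
  · rw [hNb, eLpNorm_indicator_eq_eLpNorm_restrict measurableSet_Ioo, he]

/-- The Duhamel integral on the frequency side. -/
def duhamel (φ : ℝ → ℝ) (b : ℝ → L2 n) (t : ℝ) : L2 n := ∫ s in (0 : ℝ)..t, prop φ (t - s) (b s)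

/-- The group law pulls `U(t)` out of the integral. What remains is a continuous primitive, which
gives measurability in `t`, and the unitary factor disappears from `L²` norms. -/
theorem duhamel_eq (hφ : ContinuousOn φ (Ioi 0)) {b : ℝ → L2 n} (hb : StronglyMeasurable b)
    (hb' : Integrable b) (t : ℝ) :
    duhamel φ b t = prop φ t (∫ s in (0 : ℝ)..t, prop φ (-s) (b s)) := by
  rw [duhamel, ← ContinuousLinearMap.intervalIntegral_comp_comm _
    (integrable_prop hφ measurable_neg hb hb').intervalIntegrable]
  simp_rw [prop_prop hφ, ← sub_eq_add_neg]

theorem stronglyMeasurable_duhamel (hφ : ContinuousOn φ (Ioi 0)) {b : ℝ → L2 n}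
    (hb : StronglyMeasurable b) (hb' : Integrable b) : StronglyMeasurable (duhamel φ b) := by
  rw [show duhamel φ b = fun t => prop φ t (∫ s in (0 : ℝ)..t, prop φ (-s) (b s)) from
    funext (duhamel_eq hφ hb hb')]
  refine stronglyMeasurable_prop hφ measurable_id (Continuous.stronglyMeasurable ?_)
  exact intervalIntegral.continuous_primitive
    (fun _ _ => (integrable_prop hφ measurable_neg hb hb').intervalIntegrable) 0

theorem prop_block (hφ : ContinuousOn φ (Ioi 0)) (hΦ : IsCutoff Φ) (s : ℝ) (k : ℕ) (t : ℝ)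
    (a : L2 n) : block Φ s k (prop φ t a) = prop φ t (block Φ s k a) := by
  rw [block_apply, block_apply, prop_mulOp hφ t (isSymbol_sym hΦ k),
    prop_mulOp hφ t (isSymbol_blockWt hΦ _ k)]

theorem block_duhamel (hφ : ContinuousOn φ (Ioi 0)) (hΦ : IsCutoff Φ) {b : ℝ → L2 n}
    (hb : StronglyMeasurable b) (hb' : Integrable b) (s : ℝ) (k : ℕ) (t : ℝ) :
    block Φ s k (duhamel φ b t) = duhamel φ (fun s' => block Φ s k (b s')) t := by
  have hi : IntervalIntegrable (fun s => prop φ (t - s) (b s)) volume 0 t :=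
    (integrable_prop hφ (measurable_const.sub measurable_id) hb hb').intervalIntegrable
  rw [duhamel, duhamel, ← ContinuousLinearMap.intervalIntegral_comp_comm _ hi]
  simp_rw [prop_block hφ hΦ]

/-- Pairing with a Schwartz function is a continuous functional of the `L²` density, so it commutes
with the Bochner integral. -/
theorem isDuhamel_ofL2 (hφ : ContinuousOn φ (Ioi 0)) {T σ : ℝ} (hT : 0 < T) {b : ℝ → L2 n}
    (hb : StronglyMeasurable b) (hb' : Integrable b) {f : ℝ → 𝓢'(Rn n, ℂ)}
    (hf : ∀ᵐ t ∂(volume.restrict (Ioo (-T) T)), f t = ofL2 n σ (b t)) :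
    IsDuhamel φ T f fun t => ofL2 n σ (duhamel φ b t) := by
  intro t ht χ
  have hsub : uIoc 0 t ⊆ Ioo (-T) T := by
    intro s hs
    rw [mem_uIoc] at hs
    rcases hs with hs | hs
    · exact ⟨by linarith [hs.1], by linarith [hs.2, ht.2]⟩
    · exact ⟨by linarith [hs.1, ht.1], by linarith [hs.2]⟩
  have hae : ∀ᵐ s ∂(volume.restrict (uIoc 0 t)),
      ofL2Apply σ χ (prop φ (t - s) (b s)) = propagator φ (t - s) (f s) χ := by
    filter_upwards [ae_restrict_of_ae_restrict_of_subset hsub hf] with s hs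
    rw [hs, propagator_ofL2 hφ, ofL2Apply_apply]
  have hi : IntervalIntegrable (fun s => prop φ (t - s) (b s)) volume 0 t :=
    (integrable_prop hφ (measurable_const.sub measurable_id) hb hb').intervalIntegrable
  constructor
  · refine IntervalIntegrable.congr_ae ?_ hae
    rw [intervalIntegrable_iff] at hi ⊢
    exact (ofL2Apply σ χ).integrable_comp hi
  · rw [← ofL2Apply_apply, duhamel, ← ContinuousLinearMap.intervalIntegral_comp_comm _ hi]
    refine intervalIntegral.integral_congr_ae ?_
    exact (ae_restrict_iff' measurableSet_uIoc).1 hae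

end Representatives

/-! ### Strong measurability with values in Besov and Sobolev spaces -/

section Approximation

variable {n : ℕ} {Φ : Rn n → ℝ}

theorem two_rpow_mul_sq (x s : ℝ) (a : ℝ≥0∞) :
    ENNReal.ofReal (2 ^ (2 * x * s)) * a ^ 2 = (ENNReal.ofReal (2 ^ (x * s)) * a) ^ 2 := by
  rw [mul_pow, ← ENNReal.ofReal_pow (by positivity), ← Real.rpow_mul_natCast (by norm_num)]
  congr 3
  push_cast
  ring_nf

/-- The terms of the Besov norm of `ofL2 n σ a`. -/
def blockTerm (Φ : Rn n → ℝ) (s : ℝ) (p : ℝ≥0∞) (σ : ℝ) (k : ℕ) (a : L2 n) : ℝ≥0∞ :=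
  ENNReal.ofReal (2 ^ ((k : ℝ) * s)) * lpn p (block Φ σ k a)

theorem besovNorm_ofL2_eq (hΦ : IsCutoff Φ) (s σ : ℝ) {p : ℝ≥0∞} (hp : 1 ≤ p) (a : L2 n) :
    besovNorm Φ s p (ofL2 n σ a) = (∑' k, blockTerm Φ s p σ k a ^ 2) ^ (1 / 2 : ℝ) := by
  simp_rw [besovNorm_ofL2 hΦ s σ hp, two_rpow_mul_sq, blockTerm]

theorem measurable_blockTerm {β : Type*} [MeasurableSpace β] (s σ : ℝ) (p p' : ℝ≥0∞)
    [p.HolderConjugate p'] (k : ℕ) {b : β → L2 n} (hb : StronglyMeasurable b) :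
    Measurable fun t => blockTerm Φ s p σ k (b t) :=
  (measurable_lpn_comp p p' ((block Φ σ k).continuous.comp_stronglyMeasurable hb)).const_mul _

theorem measurable_besovNorm_ofL2 (hΦ : IsCutoff Φ) (s σ : ℝ) (p p' : ℝ≥0∞)
    [hpp : p.HolderConjugate p'] {b : ℝ → L2 n} (hb : StronglyMeasurable b) :
    Measurable fun t => besovNorm Φ s p (ofL2 n σ (b t)) := by
  have hp : 1 ≤ p := ENNReal.HolderTriple.le p p' 1
  simp_rw [besovNorm_ofL2_eq hΦ s σ hp]
  have := fun k => measurable_blockTerm (Φ := Φ) s σ p p' k hb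
  fun_prop

theorem besovNorm_zero (hΦ : IsCutoff Φ) (s : ℝ) {p : ℝ≥0∞} (hp : 1 ≤ p) :
    besovNorm Φ s p (0 : 𝓢'(Rn n, ℂ)) = 0 := by
  rw [← map_zero (ofL2 n 0), besovNorm_ofL2_eq hΦ s 0 hp]
  simp [blockTerm, lpn_zero]

theorem ennreal_add_sq_le (x y : ℝ≥0∞) : (x + y) ^ 2 ≤ 2 * (x ^ 2 + y ^ 2) := by
  induction x with
  | top => simp
  | coe x =>
    induction y with
    | top => simp
    | coe y =>
      have : (x + y) ^ 2 ≤ 2 * (x ^ 2 + y ^ 2) := add_sq_le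
      exact_mod_cast this

theorem tsum_blockTerm_add_sq_le (s σ : ℝ) {p : ℝ≥0∞} (hp : 1 ≤ p) (a b : L2 n) :
    ∑' k, blockTerm Φ s p σ k (a + b) ^ 2 ≤
      2 * (∑' k, blockTerm Φ s p σ k a ^ 2 + ∑' k, blockTerm Φ s p σ k b ^ 2) := by
  rw [← ENNReal.tsum_add, ← ENNReal.tsum_mul_left]
  refine ENNReal.tsum_le_tsum fun k => le_trans ?_ (ennreal_add_sq_le _ _)
  simp only [blockTerm]
  gcongr
  rw [← mul_add, map_add]
  gcongr
  exact lpn_add_le hp _ _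

theorem block_mulOp_low (hΦ : IsCutoff Φ) (σ : ℝ) (k l : ℕ) (a : L2 n) :
    block Φ σ k (mulOp (low Φ l) a) = mulOp (low Φ l) (block Φ σ k a) := by
  rw [block_apply, block_apply, mulOp_comm (isSymbol_blockWt hΦ _ k) (isSymbol_low hΦ l),
    mulOp_comm (isSymbol_sym hΦ k) (isSymbol_low hΦ l)]

theorem block_mulOp_low_eq (hΦ : IsCutoff Φ) (σ : ℝ) {k l : ℕ} (h : k + 1 ≤ l) (a : L2 n) :
    block Φ σ k (mulOp (low Φ l) a) = block Φ σ k a := by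
  rw [block_mulOp_low hΦ, block_apply, mulOp_mulOp (isSymbol_low hΦ l) (isSymbol_sym hΦ k)]
  simp_rw [low_mul_sym hΦ h]

theorem block_mulOp_low_eq_zero (hΦ : IsCutoff Φ) (σ : ℝ) {k l : ℕ} (h : l + 2 ≤ k) (a : L2 n) :
    block Φ σ k (mulOp (low Φ l) a) = 0 := by
  rw [block_mulOp_low hΦ, block_apply, mulOp_mulOp (isSymbol_low hΦ l) (isSymbol_sym hΦ k)]
  have : (fun ξ => low Φ l ξ * sym Φ k ξ) = fun _ => 0 := by
    funext ξ
    obtain ⟨k, rfl⟩ : ∃ j, k = j + 1 := ⟨k - 1, by omega⟩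
    rcases le_or_gt ‖(2 * Real.pi) • ξ‖ (2 ^ (l + 1)) with h1 | h1
    · simp only [sym]
      have h2 : ‖(2 * Real.pi) • ξ‖ ≤ 2 ^ k :=
        h1.trans (pow_le_pow_right₀ (by norm_num) (by omega))
      have h3 : ‖(2 * Real.pi) • ξ‖ ≤ 2 ^ (k + 1) :=
        h2.trans (pow_le_pow_right₀ (by norm_num) (by omega))
      rw [low_eq_one hΦ h2, low_eq_one hΦ h3, sub_self, mul_zero]
    · rw [low_eq_zero hΦ h1, zero_mul]
  rw [this, mulOp_zero]

/-- After the cutoff only the blocks `k < l + 2` remain, and each is bounded on `L²` by Bernstein's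
inequality. The constant may depend on `l` in any way. -/
theorem exists_tsum_blockTerm_low_le (hΦ : IsCutoff Φ) (s σ : ℝ) {p : ℝ≥0∞} (hp : 2 ≤ p) (l : ℕ) :
    ∃ D : ℝ≥0∞, D < ⊤ ∧ ∀ x : L2 n,
      ∑' k, blockTerm Φ s p σ k (mulOp (low Φ l) x) ^ 2 ≤ D * ‖x‖ₑ ^ 2 := by
  obtain ⟨B, hB⟩ := exists_bernstein_sym hΦ
  set L : ℕ → L2 n →L[ℂ] L2 n := fun k => (mulOp (blockWt Φ (-σ) k)).comp (mulOp (low Φ l))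
  refine ⟨∑ k ∈ Finset.range (l + 2),
    (ENNReal.ofReal (2 ^ ((k : ℝ) * s)) * (B * 2 ^ (n * k) * ‖L k‖ₑ)) ^ 2, ?_, fun x => ?_⟩
  · refine ENNReal.sum_lt_top.2 fun k _ => ?_
    refine ENNReal.pow_lt_top (ENNReal.mul_lt_top ENNReal.ofReal_lt_top (ENNReal.mul_lt_top
      (ENNReal.mul_lt_top ENNReal.coe_lt_top ?_) enorm_lt_top))
    exact ENNReal.pow_lt_top (by simp)
  · rw [tsum_eq_sum (s := Finset.range (l + 2)), Finset.sum_mul]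
    · refine Finset.sum_le_sum fun k _ => ?_
      rw [← mul_pow, blockTerm, mul_assoc]
      gcongr
      refine (hB p hp k _).trans ?_
      rw [mul_assoc (B * 2 ^ (n * k) : ℝ≥0∞)]
      gcongr
      exact (L k).le_opENorm x
    · intro k hk
      rw [Finset.mem_range, not_lt] at hk
      rw [blockTerm, block_mulOp_low_eq_zero hΦ σ hk, lpn_zero, mul_zero]
      simp

/-- The cutoff does not change the blocks `k < l`, and on the others it is uniformly bounded. What
is left is the tail of a convergent series. -/
theorem tendsto_tsum_blockTerm_low_sub (hΦ : IsCutoff Φ) (s σ : ℝ) (p p' : ℝ≥0∞)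
    [hpp : p.HolderConjugate p'] {a : L2 n} (ha : ∑' k, blockTerm Φ s p σ k a ^ 2 ≠ ⊤) :
    Tendsto (fun l => ∑' k, blockTerm Φ s p σ k (mulOp (low Φ l) a - a) ^ 2) atTop (𝓝 0) := by
  have hp : 1 ≤ p := ENNReal.HolderTriple.le p p' 1
  obtain ⟨C, hC⟩ := exists_lpn_low_le hΦ
  have h0 : Tendsto (fun l => ((C : ℝ≥0∞) + 1) ^ 2 * ∑' k, blockTerm Φ s p σ (k + l) a ^ 2) atTop
      (𝓝 0) := by
    simpa using ENNReal.Tendsto.const_mul (ENNReal.tendsto_sum_nat_add _ ha)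
      (Or.inr (ENNReal.pow_ne_top (n := 2) (by simp : (C : ℝ≥0∞) + 1 ≠ ⊤)))
  refine tendsto_of_tendsto_of_tendsto_of_le_of_le tendsto_const_nhds h0 (fun _ => zero_le)
    fun l => ?_
  rw [← ENNReal.summable.sum_add_tsum_nat_add' (k := l), ← ENNReal.tsum_mul_left]
  rw [Finset.sum_eq_zero, zero_add]
  · refine ENNReal.tsum_le_tsum fun k => ?_
    rw [← mul_pow]
    gcongr
    rw [blockTerm, blockTerm, mul_left_comm]
    gcongr
    rw [map_sub, block_mulOp_low hΦ, sub_eq_add_neg, add_mul, one_mul]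
    refine (lpn_add_le hp _ _).trans ?_
    rw [lpn_neg]
    gcongr
    exact hC p p' l _
  · intro k hk
    rw [blockTerm, map_sub, block_mulOp_low_eq hΦ σ (Finset.mem_range.1 hk), sub_self, lpn_zero,
      mul_zero]
    simp

/-- Cut off members of a countable dense subset of `L²` suffice: once frequencies are bounded,
approximation in `L²` is approximation in the Besov norm. Only elements with an `L²` density are
approximated, which is why `p = ∞` is allowed. -/
theorem exists_seq_besovNorm_sub_le (hΦ : IsCutoff Φ) (s σ : ℝ) {p : ℝ≥0∞} (p' : ℝ≥0∞)
    [p.HolderConjugate p'] (hp : 2 ≤ p) :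
    ∃ y : ℕ → L2 n, (∀ i, besovNorm Φ s p (ofL2 n σ (y i)) < ⊤) ∧
      ∀ a, besovNorm Φ s p (ofL2 n σ a) < ⊤ → ∀ ε : ℝ≥0∞, ε ≠ 0 →
        ∃ i, besovNorm Φ s p (ofL2 n σ (y i - a)) ≤ ε := by
  have hp1 : 1 ≤ p := one_le_two.trans hp
  have : Fact ((2 : ℝ≥0∞) ≠ ⊤) := ⟨by simp⟩
  choose D hDt hD using exists_tsum_blockTerm_low_le hΦ s σ hp
  have hhalf : (0 : ℝ) < 1 / 2 := by norm_num
  refine ⟨fun i => mulOp (low Φ i.unpair.1) (TopologicalSpace.denseSeq (L2 n) i.unpair.2),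
    fun i => ?_, fun a ha ε hε => ?_⟩
  · rw [besovNorm_ofL2_eq hΦ s σ hp1, ENNReal.rpow_lt_top_iff_of_pos hhalf]
    exact (hD _ _).trans_lt (ENNReal.mul_lt_top (hDt _) (ENNReal.pow_lt_top enorm_lt_top))
  · rw [besovNorm_ofL2_eq hΦ s σ hp1, ENNReal.rpow_lt_top_iff_of_pos hhalf] at ha
    -- Two errors of this size, doubled by the inequality for squares of sums, add up to `ε ^ 2`.
    have hδ : 0 < ε ^ 2 / 4 := ENNReal.div_pos (pow_ne_zero 2 hε) (by simp)
    obtain ⟨l, hl⟩ := ((tendsto_tsum_blockTerm_low_sub hΦ s σ p p' ha.ne).eventually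
      (ge_mem_nhds hδ)).exists
    have hcont : Tendsto (fun x : L2 n => D l * ‖x - a‖ₑ ^ 2) (𝓝 a) (𝓝 0) := by
      have h1 : Tendsto (fun x : L2 n => ‖x - a‖ₑ ^ 2) (𝓝 a) (𝓝 (‖a - a‖ₑ ^ 2)) :=
        ((ENNReal.continuous_pow 2).comp (continuous_id.sub continuous_const).enorm).tendsto a
      rw [sub_self, enorm_zero, zero_pow two_ne_zero] at h1
      simpa using ENNReal.Tendsto.const_mul h1 (Or.inr (hDt l).ne)
    obtain ⟨U, hU, hUo, haU⟩ := mem_nhds_iff.1 (hcont.eventually (ge_mem_nhds hδ))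
    obtain ⟨i, hi⟩ := (TopologicalSpace.denseRange_denseSeq (L2 n)).exists_mem_open hUo ⟨a, haU⟩
    refine ⟨Nat.pair l i, ?_⟩
    rw [besovNorm_ofL2_eq hΦ s σ hp1]
    simp only [Nat.unpair_pair]
    set x := TopologicalSpace.denseSeq (L2 n) i
    have hx : D l * ‖x - a‖ₑ ^ 2 ≤ ε ^ 2 / 4 := hU hi
    have hsplit : mulOp (low Φ l) x - a = mulOp (low Φ l) (x - a) + (mulOp (low Φ l) a - a) := by
      rw [map_sub]; abel
    have h4 : 2 * (ε ^ 2 / 4 + ε ^ 2 / 4) = ε ^ 2 := by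
      rw [← two_mul, ← mul_assoc, mul_comm, show (2 : ℝ≥0∞) * 2 = 4 by norm_num]
      exact ENNReal.div_mul_cancel (by simp) (by simp)
    calc _ ≤ (2 * (ε ^ 2 / 4 + ε ^ 2 / 4)) ^ (1 / 2 : ℝ) := by
          refine ENNReal.rpow_le_rpow ?_ hhalf.le
          rw [hsplit]
          refine (tsum_blockTerm_add_sq_le s σ hp1 _ _).trans ?_
          gcongr
          exact (hD l _).trans hx
      _ = ε := by
          rw [h4, ← ENNReal.rpow_natCast, ← ENNReal.rpow_mul]
          norm_num

/-- The approximating simple function takes, at each time, the nearest of the first `j + 1` members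
of the family. The gauge `G` may be stronger than `N`. -/
theorem stronglyMeas_ofL2 {T σ : ℝ} {N : 𝓢'(Rn n, ℂ) → ℝ≥0∞} {G : L2 n → ℝ≥0∞} {C : ℝ≥0}
    (hG : ∀ a, N (ofL2 n σ a) ≤ C * G a) {y : ℕ → L2 n} (hy : ∀ i, G (y i) < ⊤) {b : ℝ → L2 n}
    (hm : ∀ i, Measurable fun t => G (y i - b t))
    (hb : ∀ᵐ t ∂(volume.restrict (Ioo (-T) T)), ∀ ε : ℝ≥0∞, ε ≠ 0 → ∃ i, G (y i - b t) ≤ ε) :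
    StronglyMeas T N fun t => ofL2 n σ (b t) := by
  -- Inversion turns the selection of a maximizer into that of a minimizer.
  choose s hs using fun j => exists_simpleFunc_forall_le
    (F := fun i t => (G (y i - b t))⁻¹) (fun i => (hm i).inv) j
  refine ⟨fun j => (s j).map fun i => ofL2 n σ (y i),
    fun j t => (hG _).trans_lt (ENNReal.mul_lt_top ENNReal.coe_lt_top (hy _)), ?_⟩
  filter_upwards [hb] with t ht
  have h0 : Tendsto (fun j => G (y (s j t) - b t)) atTop (𝓝 0) := by
    rw [ENNReal.tendsto_nhds_zero]
    intro ε hε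
    obtain ⟨i, hi⟩ := ht ε hε.ne'
    filter_upwards [eventually_ge_atTop i] with j hj
    exact (ENNReal.inv_le_inv.1 (hs j t i hj)).trans hi
  have h1 : Tendsto (fun j => C * G (y (s j t) - b t)) atTop (𝓝 0) := by
    simpa using ENNReal.Tendsto.const_mul h0 (Or.inr ENNReal.coe_ne_top)
  refine tendsto_of_tendsto_of_tendsto_of_le_of_le tendsto_const_nhds h1 (fun _ => zero_le)
    fun j => ?_
  rw [SimpleFunc.map_apply, ← map_sub]
  exact hG _

theorem ae_lt_top_of_eLpNorm_lt_top {α : Type*} [MeasurableSpace α] {μ : Measure α} {q : ℝ≥0∞}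
    (hq : q ≠ 0) {f : α → ℝ≥0∞} (hf : Measurable f) (h : eLpNorm f q μ < ⊤) :
    ∀ᵐ t ∂μ, f t < ⊤ := by
  rcases eq_or_ne q ⊤ with rfl | hq'
  · rw [eLpNorm_exponent_top] at h
    filter_upwards [enorm_ae_le_eLpNormEssSup f μ] with t ht
    exact lt_of_le_of_lt ht h
  · have h1 := lintegral_rpow_enorm_lt_top_of_eLpNorm_lt_top hq hq' h
    have hq0 : 0 < q.toReal := ENNReal.toReal_pos hq hq'
    filter_upwards [ae_lt_top (hf.enorm.pow_const _) h1.ne] with t ht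
    exact (ENNReal.rpow_lt_top_iff_of_pos hq0).1 ht

theorem spaceTimeNorm_besov_le (hΦ : IsCutoff Φ) {s σ T : ℝ} {p : ℝ≥0∞} (p' : ℝ≥0∞)
    [p.HolderConjugate p'] (hp : 2 ≤ p) {q : ℝ≥0∞} (hq : q ≠ 0) {b : ℝ → L2 n}
    (hb : StronglyMeasurable b) {M : ℝ≥0∞} (hM : M < ⊤)
    (h : eLpNorm (fun t => besovNorm Φ s p (ofL2 n σ (b t))) q volume ≤ M) :
    spaceTimeNorm q T (besovNorm Φ s p) (fun t => ofL2 n σ (b t)) ≤ M := by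
  have hm := measurable_besovNorm_ofL2 hΦ s σ p p' hb
  obtain ⟨y, hy, hya⟩ := exists_seq_besovNorm_sub_le hΦ s σ p' hp
  have hfin : ∀ᵐ t, besovNorm Φ s p (ofL2 n σ (b t)) < ⊤ :=
    ae_lt_top_of_eLpNorm_lt_top hq hm (h.trans_lt hM)
  have hs : StronglyMeas T (besovNorm Φ s p) fun t => ofL2 n σ (b t) :=
    stronglyMeas_ofL2 (C := 1) (G := fun a => besovNorm Φ s p (ofL2 n σ a))
      (fun a => by rw [ENNReal.coe_one, one_mul]) hy (fun i => measurable_besovNorm_ofL2 hΦ s σ p p'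
      (stronglyMeasurable_const.sub hb)) ((ae_restrict_of_ae hfin).mono fun t ht => hya _ ht)
  rw [spaceTimeNorm, iInf_pos hs]
  exact (eLpNorm_mono_measure _ Measure.restrict_le_self).trans h

/-- Measurability and size are both checked in the norm of `B^s_{2,2}`, which dominates that of
`H^s`. -/
theorem spaceTimeNorm_sobolev_le (hΦ : IsCutoff Φ) (s : ℝ) : ∃ C : ℝ≥0, ∀ (σ T : ℝ) (b : ℝ → L2 n),
    StronglyMeasurable b → ∀ M : ℝ≥0∞, M < ⊤ → (∀ t, besovNorm Φ s 2 (ofL2 n σ (b t)) ≤ M) →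
      spaceTimeNorm ⊤ T (sobolevNorm s) (fun t => ofL2 n σ (b t)) ≤ C * M := by
  obtain ⟨C, hC⟩ := exists_sobolevNorm_le_besovNorm hΦ s
  refine ⟨C, fun σ T b hb M hM h => ?_⟩
  obtain ⟨y, hy, hya⟩ := exists_seq_besovNorm_sub_le hΦ s σ 2 le_rfl
  have hs : StronglyMeas T (sobolevNorm s) fun t => ofL2 n σ (b t) :=
    stronglyMeas_ofL2 (G := fun a => besovNorm Φ s 2 (ofL2 n σ a)) (hC σ) hy
      (fun i => measurable_besovNorm_ofL2 hΦ s σ 2 2 (stronglyMeasurable_const.sub hb))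
      (ae_of_all _ fun t => hya _ ((h t).trans_lt hM))
  rw [spaceTimeNorm, iInf_pos hs, eLpNorm_exponent_top]
  refine essSup_le_of_ae_le _ (ae_of_all _ fun t => ?_)
  exact (hC σ _).trans (mul_le_mul_right (h t) _)

end Approximation

/-! ### Summation of block estimates -/

section Summation

variable {α : Type*} [MeasurableSpace α] {μ : Measure α}

theorem eLpNorm_ofReal_mul {c : ℝ} (hc : 0 < c) (f : α → ℝ≥0∞) (q : ℝ≥0∞) :
    eLpNorm (fun t => ENNReal.ofReal c * f t) q μ = ENNReal.ofReal c * eLpNorm f q μ := by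
  have key : ∀ (d : ℝ) (g : α → ℝ≥0∞),
      eLpNorm (fun t => ENNReal.ofReal d * g t) q μ ≤ ENNReal.ofReal d * eLpNorm g q μ := by
    intro d g
    have := eLpNorm_le_nnreal_smul_eLpNorm_of_ae_le_mul' (μ := μ) (c := d.toNNReal)
      (f := fun t => ENNReal.ofReal d * g t) (g := g) (ae_of_all _ fun _ => le_rfl) q
    exact this
  have hcc : ENNReal.ofReal c * ENNReal.ofReal c⁻¹ = 1 := by
    rw [← ENNReal.ofReal_mul hc.le, mul_inv_cancel₀ hc.ne', ENNReal.ofReal_one]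
  refine le_antisymm (key c f) ?_
  calc ENNReal.ofReal c * eLpNorm f q μ
      = ENNReal.ofReal c * eLpNorm (fun t => ENNReal.ofReal c⁻¹ * (ENNReal.ofReal c * f t)) q μ := by
        congr 3 with t
        rw [← mul_assoc, mul_comm (ENNReal.ofReal c⁻¹), hcc, one_mul]
    _ ≤ ENNReal.ofReal c * (ENNReal.ofReal c⁻¹ *
          eLpNorm (fun t => ENNReal.ofReal c * f t) q μ) := by
        gcongr
        exact key _ _
    _ = _ := by rw [← mul_assoc, hcc, one_mul]

theorem sqrt_tsum_mul_sq (D : ℝ≥0∞) (a : ℕ → ℝ≥0∞) :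
    (∑' k, (D * a k) ^ 2) ^ (1 / 2 : ℝ) = D * (∑' k, a k ^ 2) ^ (1 / 2 : ℝ) := by
  simp_rw [mul_pow]
  rw [ENNReal.tsum_mul_left, ENNReal.mul_rpow_of_nonneg _ _ (by norm_num), ← ENNReal.rpow_natCast,
    ← ENNReal.rpow_mul]
  norm_num

theorem le_sqrt_of_sq_le {a b : ℝ≥0∞} (h : a ^ 2 ≤ b) : a ≤ b ^ (1 / 2 : ℝ) := by
  refine le_trans (le_of_eq ?_) (ENNReal.rpow_le_rpow h (by norm_num))
  rw [← ENNReal.rpow_natCast, ← ENNReal.rpow_mul]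
  norm_num

theorem sqrt_sq (a : ℝ≥0∞) : (a ^ 2) ^ (1 / 2 : ℝ) = a := by
  rw [← ENNReal.rpow_natCast, ← ENNReal.rpow_mul]
  norm_num

theorem sqrt_tsum_eLpNorm_sq_le {q : ℝ≥0∞} (h1 : 1 ≤ q) (h2 : q ≤ 2) {u : ℕ → α → ℝ≥0∞}
    (hu : ∀ k, Measurable (u k)) :
    (∑' k, eLpNorm (u k) q μ ^ 2) ^ (1 / 2 : ℝ) ≤
      eLpNorm (fun t => (∑' k, u k t ^ 2) ^ (1 / 2 : ℝ)) q μ := by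
  rw [← sqrt_sq (eLpNorm _ q μ)]
  exact ENNReal.rpow_le_rpow (tsum_eLpNorm_sq_le h1 h2 fun k => (hu k).aemeasurable) (by norm_num)

theorem eLpNorm_sqrt_tsum_sq_le_of_forall [SigmaFinite μ] {q : ℝ≥0∞} (hq : 2 ≤ q)
    {v : ℕ → α → ℝ≥0∞} (hv : ∀ k, Measurable (v k)) {a : ℕ → ℝ≥0∞} {D : ℝ≥0∞}
    (h : ∀ k, eLpNorm (v k) q μ ≤ D * a k) :
    eLpNorm (fun t => (∑' k, v k t ^ 2) ^ (1 / 2 : ℝ)) q μ ≤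
      D * (∑' k, a k ^ 2) ^ (1 / 2 : ℝ) := by
  rw [← sqrt_tsum_mul_sq]
  refine le_sqrt_of_sq_le ((eLpNorm_sqrt_tsum_sq_le hq hv).trans (ENNReal.tsum_le_tsum fun k => ?_))
  gcongr
  exact h k

end Summation

/-! ### Estimates on single blocks and their sums -/

section Estimates

variable {n : ℕ} {Φ : Rn n → ℝ} {φ : ℝ → ℝ} {p p' q q' : ℝ≥0∞} {κ : ℝ → ℝ≥0∞}

/-- Minkowski's integral inequality by duality. The integral is taken in `L²`; no integrability with
values in `L^p` is required. -/
theorem lpn_integral_le (p p' : ℝ≥0∞) [p.HolderConjugate p'] {α : Type*} [MeasurableSpace α]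
    {μ : Measure α} {F : α → L2 n} (hF : Integrable F μ) :
    lpn p (∫ s, F s ∂μ) ≤ ∫⁻ s, lpn p (F s) ∂μ := by
  refine lpn_le_of_forall_inner_le p p' _ _ fun g hg => ?_
  rw [← integral_inner hF, mul_comm, ← lintegral_const_mul' _ _ hg]
  exact (enorm_integral_le_lintegral_enorm _).trans
    (lintegral_mono fun s => enorm_inner_le_lpn_mul_lpn p p' g (F s))

/-- Once norms are inside, the interval from `0` to `t` may be enlarged to the line, so the causal
restriction plays no further role. -/
theorem lpn_duhamel_le (p p' : ℝ≥0∞) [p.HolderConjugate p'] (hφ : ContinuousOn φ (Ioi 0))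
    {b : ℝ → L2 n} (hb : StronglyMeasurable b) (hb' : Integrable b) (t : ℝ) :
    lpn p (duhamel φ b t) ≤ ∫⁻ s, lpn p (prop φ (t - s) (b s)) := by
  have hi : Integrable fun s => prop φ (t - s) (b s) :=
    integrable_prop hφ (measurable_const.sub measurable_id) hb hb'
  have h : lpn p (duhamel φ b t) = lpn p (∫ s in uIoc 0 t, prop φ (t - s) (b s)) := by
    rw [duhamel, intervalIntegral.intervalIntegral_eq_integral_uIoc]
    split_ifs
    · rw [one_smul]
    · rw [neg_one_smul, lpn_neg]
  rw [h]
  exact (lpn_integral_le p p' hi.integrableOn).trans (setLIntegral_le_lintegral _ _)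

/-- Against a scalar tester in time, the decay of each `U(t - s)` leaves exactly the positive
bilinear form with kernel `κ`. -/
theorem eLpNorm_lpn_duhamel_le [p.HolderConjugate p'] [q.HolderConjugate q']
    (hφ : ContinuousOn φ (Ioi 0)) {A C : ℝ≥0∞} (hκ : Measurable κ)
    (hC : ∀ f g : ℝ → ℝ≥0∞, Measurable f → Measurable g →
      ∫⁻ t, ∫⁻ s, f s * g t * κ (t - s) ≤ C * eLpNorm f q' volume * eLpNorm g q' volume)
    {b : ℝ → L2 n} (hb : StronglyMeasurable b) (hb' : Integrable b)
    (hA : ∀ t ≠ 0, ∀ s, lpn p (prop φ t (b s)) ≤ A * κ t * lpn p' (b s)) :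
    eLpNorm (fun t => lpn p (duhamel φ b t)) q volume ≤
      A * C * eLpNorm (fun s => lpn p' (b s)) q' volume := by
  have : p'.HolderConjugate p := ENNReal.HolderConjugate.symm
  have hN : Measurable fun s => lpn p' (b s) := measurable_lpn_comp p' p hb
  refine eLpNorm_le_of_forall_lintegral_mul_le q q'
    (measurable_lpn_comp p p' (stronglyMeasurable_duhamel hφ hb hb')) _ fun w hw _ _ => ?_
  have hm : Measurable fun z : ℝ × ℝ => lpn p' (b z.2) * w z.1 * κ (z.1 - z.2) :=
    ((hN.comp measurable_snd).mul (hw.comp measurable_fst)).mul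
      (hκ.comp (measurable_fst.sub measurable_snd))
  calc ∫⁻ t, lpn p (duhamel φ b t) * w t
      ≤ ∫⁻ t, A * ∫⁻ s, lpn p' (b s) * w t * κ (t - s) := by
        refine lintegral_mono fun t => ?_
        have hms : Measurable fun s => lpn p' (b s) * κ (t - s) := by fun_prop
        calc lpn p (duhamel φ b t) * w t
            ≤ (∫⁻ s, A * (lpn p' (b s) * κ (t - s))) * w t := by
              gcongr
              refine (lpn_duhamel_le p p' hφ hb hb' t).trans (lintegral_mono_ae ?_)
              filter_upwards [Measure.ae_ne volume t] with s hs
              refine (hA _ (sub_ne_zero.2 hs.symm) s).trans (le_of_eq ?_)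
              ring
          _ = A * ∫⁻ s, lpn p' (b s) * κ (t - s) * w t := by
              rw [lintegral_const_mul _ hms, mul_assoc, lintegral_mul_const _ hms]
          _ = _ := by
              congr 2 with s
              ring
    _ = A * ∫⁻ t, ∫⁻ s, lpn p' (b s) * w t * κ (t - s) :=
        lintegral_const_mul _ hm.lintegral_prod_right'
    _ ≤ A * (C * eLpNorm (fun s => lpn p' (b s)) q' volume * eLpNorm w q' volume) := by
        gcongr
        exact hC _ _ hN hw
    _ = _ := by ring

/-- The `TT*` bound is applied to the forcing restricted to the interval between `0` and `t`. The
restriction does not increase the majorant, so the bound is uniform in `t`. -/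
theorem enorm_duhamel_sq_le [p.HolderConjugate p']
    (hφ : ContinuousOn φ (Ioi 0)) {A C : ℝ≥0∞} (hκ : Measurable κ)
    (hC : ∀ f g : ℝ → ℝ≥0∞, Measurable f → Measurable g →
      ∫⁻ t, ∫⁻ s, f s * g t * κ (t - s) ≤ C * eLpNorm f q' volume * eLpNorm g q' volume)
    {b : ℝ → L2 n} (hb : StronglyMeasurable b) (hb' : Integrable b)
    (hA : ∀ t ≠ 0, ∀ s, lpn p (prop φ t (b s)) ≤ A * κ t * lpn p' (b s)) (t : ℝ) :
    ‖duhamel φ b t‖ₑ ^ 2 ≤ A * C * eLpNorm (fun s => lpn p' (b s)) q' volume ^ 2 := by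
  have : p'.HolderConjugate p := ENNReal.HolderConjugate.symm
  set F : ℝ → L2 n := (uIoc 0 t).indicator b with hF
  have h1 : ‖duhamel φ b t‖ₑ = ‖∫ s, prop φ (-s) (F s)‖ₑ := by
    have h2 : ∀ s, prop φ (-s) (F s) = (uIoc 0 t).indicator (fun s => prop φ (-s) (b s)) s := by
      intro s
      by_cases hs : s ∈ uIoc 0 t
      · rw [hF, indicator_of_mem hs, indicator_of_mem hs]
      · rw [hF, indicator_of_notMem hs, indicator_of_notMem hs, map_zero]
    simp_rw [h2]
    rw [integral_indicator measurableSet_uIoc, duhamel_eq hφ hb hb', ← ofReal_norm, ← ofReal_norm,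
      norm_prop hφ, intervalIntegral.norm_intervalIntegral_eq]
  rw [h1]
  refine enorm_integral_prop_sq_le hφ hκ hC (hb.indicator measurableSet_uIoc)
    (hb'.indicator measurableSet_uIoc) (measurable_lpn_comp p' p hb) fun t' s hts => ?_
  by_cases ht : t' ∈ uIoc 0 t
  · by_cases hs : s ∈ uIoc 0 t
    · rw [indicator_of_mem ht, indicator_of_mem hs]
      refine (enorm_inner_le_lpn_mul_lpn p p' _ _).trans ?_
      rw [mul_comm]
      gcongr
      exact hA _ (sub_ne_zero.2 hts) s
    · rw [indicator_of_notMem hs]; simp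
  · rw [indicator_of_notMem ht]; simp

/-- Minkowski's inequality in time, by testing and exchanging the integrals: the Duhamel term is
dominated by a superposition of free evolutions started at the times `s`. -/
theorem eLpNorm_lpn_duhamel_le_lintegral [p.HolderConjugate p'] [q.HolderConjugate q']
    (hφ : ContinuousOn φ (Ioi 0)) {b : ℝ → L2 n} (hb : StronglyMeasurable b) (hb' : Integrable b)
    {h : ℝ → ℝ≥0∞} (hh : Measurable h)
    (hbh : ∀ s, eLpNorm (fun t => lpn p (prop φ (t - s) (b s))) q volume ≤ h s) :
    eLpNorm (fun t => lpn p (duhamel φ b t)) q volume ≤ ∫⁻ s, h s := by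
  have hj : Measurable fun z : ℝ × ℝ => lpn p (prop φ (z.1 - z.2) (b z.2)) :=
    measurable_lpn_comp p p' (stronglyMeasurable_prop hφ (measurable_fst.sub measurable_snd)
      (hb.comp_measurable measurable_snd))
  refine eLpNorm_le_of_forall_lintegral_mul_le q q'
    (measurable_lpn_comp p p' (stronglyMeasurable_duhamel hφ hb hb')) _ fun w hw _ _ => ?_
  calc ∫⁻ t, lpn p (duhamel φ b t) * w t
      ≤ ∫⁻ t, ∫⁻ s, lpn p (prop φ (t - s) (b s)) * w t := by
        refine lintegral_mono fun t => ?_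
        have hjt : Measurable fun s => lpn p (prop φ (t - s) (b s)) :=
          measurable_lpn_comp p p' (stronglyMeasurable_prop hφ (measurable_const.sub measurable_id) hb)
        rw [lintegral_mul_const _ hjt]
        gcongr
        exact lpn_duhamel_le p p' hφ hb hb' t
    _ = ∫⁻ s, ∫⁻ t, lpn p (prop φ (t - s) (b s)) * w t :=
        lintegral_lintegral_swap (hj.mul (hw.comp measurable_fst)).aemeasurable
    _ ≤ ∫⁻ s, h s * eLpNorm w q' volume := by
        refine lintegral_mono fun s => ?_
        have hjs : Measurable fun t => lpn p (prop φ (t - s) (b s)) :=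
          measurable_lpn_comp p p' (stronglyMeasurable_prop hφ (measurable_id.sub measurable_const)
            stronglyMeasurable_const)
        refine (lintegral_mul_le_eLpNorm_mul_eLpNorm q q' hjs.aemeasurable hw.aemeasurable).trans ?_
        gcongr
        exact hbh s
    _ = _ := lintegral_mul_const _ hh

/-- The dispersive estimate for the Littlewood-Paley blocks and the convolution inequality for
its decay rate. -/
structure BlockDecay (Φ : Rn n → ℝ) (φ : ℝ → ℝ) (p p' q' : ℝ≥0∞) (α : ℝ) (κ : ℝ → ℝ≥0∞)
    (A B C : ℝ≥0) : Prop where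
  cutoff : IsCutoff Φ
  continuousOn : ContinuousOn φ (Ioi 0)
  measurable : Measurable κ
  convolution : ∀ f g : ℝ → ℝ≥0∞, Measurable f → Measurable g →
    ∫⁻ t, ∫⁻ s, f s * g t * κ (t - s) ≤ C * eLpNorm f q' volume * eLpNorm g q' volume
  bounded : ∀ k x, lpn p' (mulOp (sym Φ k) x) ≤ B * lpn p' x
  decay : ∀ t ≠ 0, ∀ k x, lpn p (prop φ t (mulOp (sym Φ k) x)) ≤
    A * ENNReal.ofReal (2 ^ (-((k : ℝ) * α))) * κ t * lpn p' (mulOp (sym Φ k) x)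

theorem ofReal_two_rpow_mul (x y : ℝ) :
    ENNReal.ofReal (2 ^ x) * ENNReal.ofReal (2 ^ y) = ENNReal.ofReal (2 ^ (x + y)) := by
  rw [← ENNReal.ofReal_mul (by positivity), ← Real.rpow_add two_pos]

/-- The `TT*` bound contains the square root of the block decay `2^{-kα}`; the shift by `α / 2` in
regularity cancels it. -/
theorem ofReal_two_rpow_mul_sqrt (k η α : ℝ) (D : ℝ≥0∞) :
    ENNReal.ofReal (2 ^ (k * (η + α / 2))) * (D * ENNReal.ofReal (2 ^ (-(k * α)))) ^ (1 / 2 : ℝ) =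
      D ^ (1 / 2 : ℝ) * ENNReal.ofReal (2 ^ (k * η)) := by
  rw [ENNReal.mul_rpow_of_nonneg _ _ (by norm_num), ENNReal.ofReal_rpow_of_pos (by positivity),
    ← Real.rpow_mul (by norm_num), mul_left_comm, ofReal_two_rpow_mul]
  congr 3
  ring

/-- The symbols `2^{kη} · blockWt Φ (-η) k` are bounded uniformly in `k` and each is supported on
its block, so almost orthogonality applies. -/
theorem exists_sqrt_tsum_blockWt_le (hΦ : IsCutoff Φ) (η : ℝ) : ∃ W : ℝ≥0, ∀ a : L2 n,
    (∑' k : ℕ, (ENNReal.ofReal (2 ^ ((k : ℝ) * η)) * ‖mulOp (blockWt Φ (-η) k) a‖ₑ) ^ 2)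
      ^ (1 / 2 : ℝ) ≤ W * ‖a‖ₑ := by
  set c : ℝ≥0 := (wtConst (-η)).toNNReal with hc
  have hc0 := wtConst_pos (-η)
  -- The overlap constant `3` is at most `2 ^ 2`.
  refine ⟨2 * c, fun a => ?_⟩
  set m : ℕ → Rn n → ℂ := fun k ξ => ((2 ^ ((k : ℝ) * η) : ℝ) : ℂ) * blockWt Φ (-η) k ξ with hm
  have hms : ∀ k, IsSymbol (m k) := fun k => (IsSymbol.const _).mul (isSymbol_blockWt hΦ (-η) k)
  have hmC : ∀ k ξ, ‖m k ξ‖ₑ ≤ c := fun k ξ => by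
    rw [hc, ← ENNReal.ofReal, ← ofReal_norm, hm, norm_mul, Complex.norm_real,
      Real.norm_of_nonneg (by positivity)]
    refine ENNReal.ofReal_le_ofReal ?_
    calc _ ≤ 2 ^ ((k : ℝ) * η) * (wtConst (-η) * 2 ^ ((k : ℝ) * -η)) := by
          gcongr
          exact norm_blockWt_le hΦ _ _ _
      _ = wtConst (-η) * 2 ^ ((k : ℝ) * η + k * -η) := by
          rw [Real.rpow_add two_pos]; ring
      _ = wtConst (-η) := by
          rw [mul_neg, add_neg_cancel, Real.rpow_zero, mul_one]
  have hme : ∀ k : ℕ, ENNReal.ofReal (2 ^ ((k : ℝ) * η)) * ‖mulOp (blockWt Φ (-η) k) a‖ₑ =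
      ‖mulOp (m k) a‖ₑ := fun k => by
    have : mulOp (m k) a = ((2 ^ ((k : ℝ) * η) : ℝ) : ℂ) • mulOp (blockWt Φ (-η) k) a := by
      apply Lp.ext
      filter_upwards [coeFn_mulOp (hms k) a, coeFn_mulOp (isSymbol_blockWt hΦ (-η) k) a,
        Lp.coeFn_smul ((2 ^ ((k : ℝ) * η) : ℝ) : ℂ) (mulOp (blockWt Φ (-η) k) a)] with ξ e1 e2 e3
      rw [e1, e3, Pi.smul_apply, e2, smul_eq_mul, hm, mul_assoc]
    rw [this, enorm_smul, ← ofReal_norm (((2 ^ ((k : ℝ) * η) : ℝ) : ℂ)), Complex.norm_real,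
      Real.norm_of_nonneg (by positivity)]
  simp_rw [hme]
  have h := tsum_enorm_mulOp_sq_le hΦ hms hmC (fun k ξ h => by simp [hm, blockWt, h]) a
  rw [← sqrt_sq (_ * ‖a‖ₑ)]
  refine ENNReal.rpow_le_rpow (h.trans ?_) (by norm_num)
  rw [ENNReal.coe_mul, mul_pow, mul_pow]
  gcongr
  norm_num

variable {α η : ℝ} {A B C : ℝ≥0}

theorem BlockDecay.eLpNorm_block_le [p.HolderConjugate p'] [q.HolderConjugate q']
    (h : BlockDecay Φ φ p p' q' α κ A B C) (η : ℝ) (k : ℕ) (x : L2 n) :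
    eLpNorm (fun t => ENNReal.ofReal (2 ^ ((k : ℝ) * (η + α / 2))) *
        lpn p (prop φ t (mulOp (sym Φ k) x))) q volume ≤
      (A * B ^ 2 * C : ℝ≥0∞) ^ (1 / 2 : ℝ) * (ENNReal.ofReal (2 ^ ((k : ℝ) * η)) * ‖x‖ₑ) := by
  rw [eLpNorm_ofReal_mul (by positivity), ← mul_assoc, ← ofReal_two_rpow_mul_sqrt, mul_assoc]
  gcongr
  refine (eLpNorm_lpn_prop_le h.continuousOn h.measurable h.convolution
    (isSymbol_sym h.cutoff k) (conj_sym k) (h.bounded k) (fun t ht x => h.decay t ht k x) x).trans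
    (le_of_eq ?_)
  congr 2
  ring

theorem BlockDecay.eLpNorm_besovNorm_prop_le [p.HolderConjugate p'] [q.HolderConjugate q']
    (h : BlockDecay Φ φ p p' q' α κ A B C) (hq : 2 ≤ q) {W : ℝ≥0}
    (hW : ∀ a : L2 n, (∑' k : ℕ, (ENNReal.ofReal (2 ^ ((k : ℝ) * η)) *
      ‖mulOp (blockWt Φ (-η) k) a‖ₑ) ^ 2) ^ (1 / 2 : ℝ) ≤ W * ‖a‖ₑ) (a : L2 n) :
    eLpNorm (fun t => besovNorm Φ (η + α / 2) p (ofL2 n η (prop φ t a))) q volume ≤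
      (A * B ^ 2 * C : ℝ≥0∞) ^ (1 / 2 : ℝ) * W * ‖a‖ₑ := by
  have hp : 1 ≤ p := ENNReal.HolderTriple.le p p' 1
  simp_rw [besovNorm_ofL2_eq h.cutoff _ _ hp]
  rw [mul_assoc]
  refine le_trans (eLpNorm_sqrt_tsum_sq_le_of_forall hq (fun k => measurable_blockTerm _ _ p p' k
    (continuous_prop_apply h.continuousOn a).stronglyMeasurable) fun k => ?_)
    (mul_le_mul_right (hW a) _)
  simp_rw [blockTerm, prop_block h.continuousOn h.cutoff, block_apply]
  exact h.eLpNorm_block_le η k _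

/-- Each block is a superposition of free evolutions. The `ℓ²` sum of the resulting `L¹` norms is
moved under the time integral by Minkowski's inequality, and `hW` is used at each time. -/
theorem BlockDecay.eLpNorm_besovNorm_duhamel_le_one [p.HolderConjugate p']
    [q.HolderConjugate q'] (h : BlockDecay Φ φ p p' q' α κ A B C) (hq : 2 ≤ q) {W : ℝ≥0}
    (hW : ∀ a : L2 n, (∑' k : ℕ, (ENNReal.ofReal (2 ^ ((k : ℝ) * η)) *
      ‖mulOp (blockWt Φ (-η) k) a‖ₑ) ^ 2) ^ (1 / 2 : ℝ) ≤ W * ‖a‖ₑ) {b : ℝ → L2 n}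
    (hb : StronglyMeasurable b) (hb' : Integrable b) :
    eLpNorm (fun t => besovNorm Φ (η + α / 2) p (ofL2 n η (duhamel φ b t))) q volume ≤
      (A * B ^ 2 * C : ℝ≥0∞) ^ (1 / 2 : ℝ) * W * eLpNorm (fun t => ‖b t‖ₑ) 1 volume := by
  have hp : 1 ≤ p := ENNReal.HolderTriple.le p p' 1
  have hφ := h.continuousOn
  have hu : ∀ k : ℕ, Measurable fun s =>
      ENNReal.ofReal (2 ^ ((k : ℝ) * η)) * ‖mulOp (blockWt Φ (-η) k) (b s)‖ₑ := fun k =>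
    (((mulOp (blockWt Φ (-η) k)).continuous.comp_stronglyMeasurable hb).enorm).const_mul _
  simp_rw [besovNorm_ofL2_eq h.cutoff _ _ hp]
  refine (eLpNorm_sqrt_tsum_sq_le_of_forall hq (fun k => measurable_blockTerm _ _ p p' k
    (stronglyMeasurable_duhamel hφ hb hb')) (a := fun k => eLpNorm (fun s =>
      ENNReal.ofReal (2 ^ ((k : ℝ) * η)) * ‖mulOp (blockWt Φ (-η) k) (b s)‖ₑ) 1 volume)
    (D := (A * B ^ 2 * C : ℝ≥0∞) ^ (1 / 2 : ℝ)) fun k => ?_).trans ?_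
  · have hbk : StronglyMeasurable fun s => block Φ η k (b s) :=
      (block Φ η k).continuous.comp_stronglyMeasurable hb
    simp_rw [blockTerm, block_duhamel hφ h.cutoff hb hb']
    rw [eLpNorm_ofReal_mul (by positivity), eLpNorm_one_eq_lintegral_enorm]
    simp only [enorm_eq_self]
    have hm : Measurable fun s => ‖mulOp (blockWt Φ (-η) k) (b s)‖ₑ :=
      ((mulOp (blockWt Φ (-η) k)).continuous.comp_stronglyMeasurable hb).enorm
    set D : ℝ≥0∞ := (A * ENNReal.ofReal (2 ^ (-((k : ℝ) * α))) * B ^ 2 * C) ^ (1 / 2 : ℝ) with hD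
    have h1 := eLpNorm_lpn_duhamel_le_lintegral (p := p) (p' := p') (q := q) (q' := q') hφ hbk
      ((block Φ η k).integrable_comp hb')
      (h := fun s => D * ‖mulOp (blockWt Φ (-η) k) (b s)‖ₑ) (hm.const_mul _) fun s => ?_
    · rw [lintegral_const_mul _ hm] at h1
      refine (mul_le_mul_right h1 _).trans (le_of_eq ?_)
      rw [lintegral_const_mul _ hm, ← mul_assoc, ← mul_assoc, ← ofReal_two_rpow_mul_sqrt]
      congr 3
      rw [hD]
      congr 1
      ring
    -- As `U(t - s) = U(t) U(-s)`, the homogeneous estimate is applied to data moved by `U(-s)`,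
    -- which have the same `L²` norm.
    · have h2 := eLpNorm_lpn_prop_le (q := q) hφ h.measurable h.convolution
        (isSymbol_sym h.cutoff k) (conj_sym k) (h.bounded k) (fun t ht x => h.decay t ht k x)
        (prop φ (-s) (mulOp (blockWt Φ (-η) k) (b s)))
      rw [← ofReal_norm (prop φ (-s) _), norm_prop hφ, ofReal_norm] at h2
      refine le_trans (le_of_eq ?_) h2
      congr 1 with t
      rw [← prop_mulOp hφ _ (isSymbol_sym h.cutoff k), prop_prop hφ, block_apply, sub_eq_add_neg]
  · rw [mul_assoc _ (W : ℝ≥0∞)]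
    refine mul_le_mul_right ((sqrt_tsum_eLpNorm_sq_le le_rfl one_le_two hu).trans ?_) _
    rw [eLpNorm_one_eq_lintegral_enorm, eLpNorm_one_eq_lintegral_enorm,
      ← lintegral_const_mul _ (by simpa using hb.enorm)]
    exact lintegral_mono fun s => hW (b s)

theorem BlockDecay.decay_block (h : BlockDecay Φ φ p p' q' α κ A B C) (σ : ℝ) (k : ℕ)
    (b : ℝ → L2 n) (t : ℝ) (ht : t ≠ 0) (s : ℝ) : lpn p (prop φ t (block Φ σ k (b s))) ≤
      A * ENNReal.ofReal (2 ^ (-((k : ℝ) * α))) * κ t * lpn p' (block Φ σ k (b s)) :=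
  h.decay t ht k _

/-- The weight `2^{k(η+α)}` absorbs the block decay and leaves `2^{kη}`, so the block bounds are
uniform. Minkowski's inequality is used twice: for the solution through `q ≥ 2`, and for the forcing
through `q' ≤ 2`. -/
theorem BlockDecay.eLpNorm_besovNorm_duhamel_le [hpp : p.HolderConjugate p']
    [hqq : q.HolderConjugate q'] (h : BlockDecay Φ φ p p' q' α κ A B C) (hq : 2 ≤ q) (hq' : q' ≤ 2)
    (η σ : ℝ) {b : ℝ → L2 n} (hb : StronglyMeasurable b) (hb' : Integrable b) :
    eLpNorm (fun t => besovNorm Φ (η + α) p (ofL2 n σ (duhamel φ b t))) q volume ≤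
      A * C * eLpNorm (fun t => besovNorm Φ η p' (ofL2 n σ (b t))) q' volume := by
  have hp : 1 ≤ p := ENNReal.HolderTriple.le p p' 1
  have hpp' : p'.HolderConjugate p := ENNReal.HolderConjugate.symm
  have hp' : 1 ≤ p' := ENNReal.HolderTriple.le p' p 1
  have hq1 : 1 ≤ q' := ENNReal.HolderTriple.le q' q 1
  have hφ := h.continuousOn
  simp_rw [besovNorm_ofL2_eq h.cutoff _ _ hp, besovNorm_ofL2_eq h.cutoff _ _ hp']
  refine le_trans (eLpNorm_sqrt_tsum_sq_le_of_forall hq (fun k => measurable_blockTerm _ _ p p' k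
    (stronglyMeasurable_duhamel hφ hb hb')) (a := fun k => eLpNorm (fun s =>
      blockTerm Φ η p' σ k (b s)) q' volume) fun k => ?_)
    (mul_le_mul_right (sqrt_tsum_eLpNorm_sq_le hq1 hq'
      fun k => measurable_blockTerm _ _ p' p k hb) _)
  simp_rw [blockTerm, block_duhamel hφ h.cutoff hb hb']
  rw [eLpNorm_ofReal_mul (by positivity), eLpNorm_ofReal_mul (by positivity)]
  refine (mul_le_mul_right (eLpNorm_lpn_duhamel_le (q := q) hφ h.measurable h.convolution
    ((block Φ σ k).continuous.comp_stronglyMeasurable hb) ((block Φ σ k).integrable_comp hb')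
    (h.decay_block σ k b)) _).trans (le_of_eq ?_)
  have e : ENNReal.ofReal (2 ^ ((k : ℝ) * η)) = ENNReal.ofReal (2 ^ ((k : ℝ) * (η + α))) *
      ENNReal.ofReal (2 ^ (-((k : ℝ) * α))) := by
    rw [ofReal_two_rpow_mul]
    congr 2
    ring
  rw [e]
  ring

/-- The block bounds hold at every time `t`, so Minkowski's inequality is needed only for the
forcing. -/
theorem BlockDecay.besovNorm_duhamel_le [hpp : p.HolderConjugate p'] [hqq : q.HolderConjugate q']
    (h : BlockDecay Φ φ p p' q' α κ A B C) (hq' : q' ≤ 2)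
    (η σ : ℝ) {b : ℝ → L2 n} (hb : StronglyMeasurable b) (hb' : Integrable b) (t : ℝ) :
    besovNorm Φ (η + α / 2) 2 (ofL2 n σ (duhamel φ b t)) ≤ (A * C : ℝ≥0∞) ^ (1 / 2 : ℝ) *
      eLpNorm (fun t => besovNorm Φ η p' (ofL2 n σ (b t))) q' volume := by
  have hpp' : p'.HolderConjugate p := ENNReal.HolderConjugate.symm
  have hp' : 1 ≤ p' := ENNReal.HolderTriple.le p' p 1
  have hq1 : 1 ≤ q' := ENNReal.HolderTriple.le q' q 1
  have hφ := h.continuousOn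
  simp_rw [besovNorm_ofL2_eq h.cutoff _ _ one_le_two, besovNorm_ofL2_eq h.cutoff _ _ hp']
  refine le_trans ?_ (mul_le_mul_right (sqrt_tsum_eLpNorm_sq_le hq1 hq'
      fun k => measurable_blockTerm _ _ p' p k hb) _)
  rw [← sqrt_tsum_mul_sq]
  refine ENNReal.rpow_le_rpow (ENNReal.tsum_le_tsum fun k => ?_) (by norm_num)
  gcongr
  simp_rw [blockTerm, block_duhamel hφ h.cutoff hb hb']
  rw [eLpNorm_ofReal_mul (by positivity), lpn_two, ← mul_assoc, ← ofReal_two_rpow_mul_sqrt,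
    mul_assoc]
  gcongr
  refine (le_sqrt_of_sq_le (enorm_duhamel_sq_le hφ h.measurable h.convolution
    ((block Φ σ k).continuous.comp_stronglyMeasurable hb) ((block Φ σ k).integrable_comp hb')
    (h.decay_block σ k b) t)).trans (le_of_eq ?_)
  rw [ENNReal.mul_rpow_of_nonneg _ _ (by norm_num), sqrt_sq]
  congr 2
  ring

end Estimates

/-! ### The space-time estimates for tempered distributions -/

section Main

variable {n : ℕ} {Φ : Rn n → ℝ} {φ : ℝ → ℝ} {p p' q q' : ℝ≥0∞} {κ : ℝ → ℝ≥0∞} {α η : ℝ}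
  {A B C : ℝ≥0}

theorem BlockDecay.spaceTimeNorm_propagator_le [p.HolderConjugate p'] [q.HolderConjugate q']
    (h : BlockDecay Φ φ p p' q' α κ A B C) (hp : 2 ≤ p) (hq : 2 ≤ q) {W : ℝ≥0}
    (hW : ∀ a : L2 n, (∑' k : ℕ, (ENNReal.ofReal (2 ^ ((k : ℝ) * η)) *
      ‖mulOp (blockWt Φ (-η) k) a‖ₑ) ^ 2) ^ (1 / 2 : ℝ) ≤ W * ‖a‖ₑ) (T : ℝ)
    {f : 𝓢'(Rn n, ℂ)} (hf : sobolevNorm η f < ⊤) :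
    spaceTimeNorm q T (besovNorm Φ (η + α / 2) p) (fun t => propagator φ t f) ≤
      (A * B ^ 2 * C : ℝ≥0∞) ^ (1 / 2 : ℝ) * W * sobolevNorm η f := by
  obtain ⟨a, rfl⟩ := exists_ofL2_of_sobolevNorm_lt_top hf
  simp_rw [propagator_ofL2 h.continuousOn]
  have hD : (A * B ^ 2 * C : ℝ≥0∞) ^ (1 / 2 : ℝ) < ⊤ :=
    (ENNReal.rpow_lt_top_iff_of_pos (by norm_num)).2 (by exact_mod_cast ENNReal.coe_lt_top)
  refine spaceTimeNorm_besov_le h.cutoff p' hp (by positivity)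
    (continuous_prop_apply h.continuousOn a).stronglyMeasurable
    (ENNReal.mul_lt_top (ENNReal.mul_lt_top hD ENNReal.coe_lt_top) hf) ?_
  rw [sobolevNorm_ofL2]
  exact h.eLpNorm_besovNorm_prop_le hq hW a

theorem BlockDecay.exists_isDuhamel_one [p.HolderConjugate p'] [q.HolderConjugate q']
    (h : BlockDecay Φ φ p p' q' α κ A B C) (hp : 2 ≤ p) (hq : 2 ≤ q) {W : ℝ≥0}
    (hW : ∀ a : L2 n, (∑' k : ℕ, (ENNReal.ofReal (2 ^ ((k : ℝ) * η)) *
      ‖mulOp (blockWt Φ (-η) k) a‖ₑ) ^ 2) ^ (1 / 2 : ℝ) ≤ W * ‖a‖ₑ) {T : ℝ} (hT : 0 < T)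
    {f : ℝ → 𝓢'(Rn n, ℂ)} (hf : spaceTimeNorm 1 T (sobolevNorm η) f < ⊤) :
    ∃ u, IsDuhamel φ T f u ∧ spaceTimeNorm q T (besovNorm Φ (η + α / 2) p) u ≤
      (A * B ^ 2 * C : ℝ≥0∞) ^ (1 / 2 : ℝ) * W * spaceTimeNorm 1 T (sobolevNorm η) f := by
  have hN0 : sobolevNorm η (0 : 𝓢'(Rn n, ℂ)) = 0 := by
    rw [← map_zero (ofL2 n η), sobolevNorm_ofL2, enorm_zero]
  obtain ⟨b, hb, hb', hfb, hbe⟩ := exists_representative (σ := η) (C := 1) 1 ⊤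
    (fun g hg => by
      obtain ⟨a, rfl⟩ := exists_ofL2_of_sobolevNorm_lt_top hg
      exact ⟨a, rfl, by rw [sobolevNorm_ofL2, ENNReal.coe_one, one_mul]⟩) hN0
    (fun b hb => by simpa only [sobolevNorm_ofL2] using hb.enorm) hf
  refine ⟨_, isDuhamel_ofL2 h.continuousOn hT hb hb' hfb, ?_⟩
  have hD : (A * B ^ 2 * C : ℝ≥0∞) ^ (1 / 2 : ℝ) < ⊤ :=
    (ENNReal.rpow_lt_top_iff_of_pos (by norm_num)).2 (by exact_mod_cast ENNReal.coe_lt_top)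
  refine spaceTimeNorm_besov_le h.cutoff p' hp (by positivity)
    (stronglyMeasurable_duhamel h.continuousOn hb hb')
    (ENNReal.mul_lt_top (ENNReal.mul_lt_top hD ENNReal.coe_lt_top) hf) ?_
  rw [← hbe]
  simp_rw [sobolevNorm_ofL2]
  exact h.eLpNorm_besovNorm_duhamel_le_one hq hW hb hb'

theorem BlockDecay.exists_isDuhamel [hpp : p.HolderConjugate p'] [hqq : q.HolderConjugate q']
    (h : BlockDecay Φ φ p p' q' α κ A B C) (hp : 2 ≤ p) (hq : 2 ≤ q) {S : ℝ≥0}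
    (hS : ∀ (σ T : ℝ) (b : ℝ → L2 n), StronglyMeasurable b → ∀ M : ℝ≥0∞, M < ⊤ →
      (∀ t, besovNorm Φ (η + α / 2) 2 (ofL2 n σ (b t)) ≤ M) →
        spaceTimeNorm ⊤ T (sobolevNorm (η + α / 2)) (fun t => ofL2 n σ (b t)) ≤ S * M)
    {T : ℝ} (hT : 0 < T) {f : ℝ → 𝓢'(Rn n, ℂ)}
    (hf : spaceTimeNorm q' T (besovNorm Φ η p') f < ⊤) :
    ∃ u, IsDuhamel φ T f u ∧
      spaceTimeNorm q T (besovNorm Φ (η + α) p) u ≤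
        A * C * spaceTimeNorm q' T (besovNorm Φ η p') f ∧
      spaceTimeNorm ⊤ T (sobolevNorm (η + α / 2)) u ≤
        S * ((A * C : ℝ≥0∞) ^ (1 / 2 : ℝ) * spaceTimeNorm q' T (besovNorm Φ η p') f) := by
  have hpp' : p'.HolderConjugate p := ENNReal.HolderConjugate.symm
  have hqq' : q'.HolderConjugate q := ENNReal.HolderConjugate.symm
  have hp' : 1 ≤ p' := ENNReal.HolderTriple.le p' p 1
  have hq' : q' ≤ 2 := by
    have h1 := ENNReal.HolderConjugate.inv_add_inv_eq_one q q'
    rw [← ENNReal.inv_le_inv]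
    have h2 : q⁻¹ ≤ 2⁻¹ := ENNReal.inv_le_inv.2 hq
    rw [← ENNReal.add_le_add_iff_left (a := (2 : ℝ≥0∞)⁻¹) (by simp), ENNReal.inv_two_add_inv_two,
      ← h1]
    gcongr
  obtain ⟨D, hD⟩ := exists_ofL2_of_besovNorm_lt_top h.cutoff p p' hp η
  obtain ⟨b, hb, hb', hfb, hbe⟩ := exists_representative q' q hD (besovNorm_zero h.cutoff η hp')
    (fun b hb => measurable_besovNorm_ofL2 h.cutoff η _ p' p hb) hf
  have hm := stronglyMeasurable_duhamel h.continuousOn hb hb'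
  refine ⟨_, isDuhamel_ofL2 h.continuousOn hT hb hb' hfb, ?_, ?_⟩
  · refine spaceTimeNorm_besov_le h.cutoff p' hp (by positivity) hm
      (ENNReal.mul_lt_top (ENNReal.mul_lt_top ENNReal.coe_lt_top ENNReal.coe_lt_top) hf) ?_
    rw [← hbe]
    exact h.eLpNorm_besovNorm_duhamel_le hq hq' η _ hb hb'
  · have hAC : (A * C : ℝ≥0∞) ^ (1 / 2 : ℝ) < ⊤ :=
      (ENNReal.rpow_lt_top_iff_of_pos (by norm_num)).2 (by exact_mod_cast ENNReal.coe_lt_top)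
    refine hS _ T _ hm _ (ENNReal.mul_lt_top hAC hf) fun t => ?_
    rw [← hbe]
    exact h.besovNorm_duhamel_le (q := q) hq' η _ hb hb' t

end Main

end AbstractStrichartz

end

theorem proposition1 (n : ℕ) (hn : 1 ≤ n)
    (Φ : AbstractStrichartz.Rn n → ℝ) (hΦ : AbstractStrichartz.IsCutoff Φ)
    (p p' : ℝ≥0∞) (hp : 2 ≤ p) (hpp' : p.HolderConjugate p')
    (α θ₁ θ₂ K : ℝ) (hθ : θ₁ ≤ θ₂) (hK : 0 < K)
    (q q' : ℝ≥0∞) (hq : AbstractStrichartz.InE θ₁ θ₂ q) (hqq' : q.HolderConjugate q')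
    (η : ℝ) :
    ∃ C : ℝ, 0 < C ∧
      ∀ φ : ℝ → ℝ, ContDiffOn ℝ ∞ φ (Ioi 0) →
        AbstractStrichartz.DecayEstimate Φ φ p p' α θ₁ θ₂ K →
        ∀ T : ℝ, 0 < T →
          -- the homogeneous estimate
          (∀ h : 𝓢'(AbstractStrichartz.Rn n, ℂ), AbstractStrichartz.sobolevNorm η h < ⊤ →
            AbstractStrichartz.spaceTimeNorm q T
                (AbstractStrichartz.besovNorm Φ (η + α / 2) p)
                (fun t => AbstractStrichartz.propagator φ t h) ≤
              ENNReal.ofReal C * AbstractStrichartz.sobolevNorm η h) ∧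
          -- the two inhomogeneous estimates for a forcing term in the dual space
          (∀ f : ℝ → 𝓢'(AbstractStrichartz.Rn n, ℂ),
            AbstractStrichartz.spaceTimeNorm q' T
                (AbstractStrichartz.besovNorm Φ η p') f < ⊤ →
            ∃ u : ℝ → 𝓢'(AbstractStrichartz.Rn n, ℂ),
              AbstractStrichartz.IsDuhamel φ T f u ∧
              AbstractStrichartz.spaceTimeNorm q T
                  (AbstractStrichartz.besovNorm Φ (η + α) p) u ≤
                ENNReal.ofReal C * AbstractStrichartz.spaceTimeNorm q' T
                  (AbstractStrichartz.besovNorm Φ η p') f ∧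
              AbstractStrichartz.spaceTimeNorm ⊤ T
                  (AbstractStrichartz.sobolevNorm (η + α / 2)) u ≤
                ENNReal.ofReal C * AbstractStrichartz.spaceTimeNorm q' T
                  (AbstractStrichartz.besovNorm Φ η p') f) ∧
          -- the inhomogeneous estimate for a forcing term in `L¹(-T, T; H^η)`
          (∀ f : ℝ → 𝓢'(AbstractStrichartz.Rn n, ℂ),
            AbstractStrichartz.spaceTimeNorm 1 T (AbstractStrichartz.sobolevNorm η) f < ⊤ →
            ∃ u : ℝ → 𝓢'(AbstractStrichartz.Rn n, ℂ),
              AbstractStrichartz.IsDuhamel φ T f u ∧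
              AbstractStrichartz.spaceTimeNorm q T
                  (AbstractStrichartz.besovNorm Φ (η + α / 2) p) u ≤
                ENNReal.ofReal C * AbstractStrichartz.spaceTimeNorm 1 T
                  (AbstractStrichartz.sobolevNorm η) f) := by
  have := hpp'
  have := hqq'
  obtain ⟨A, hA⟩ := AbstractStrichartz.exists_lpn_prop_le hΦ p p' α K hK
  obtain ⟨B, hB⟩ := AbstractStrichartz.exists_lpn_sym_le hΦ
  obtain ⟨C, hC⟩ := AbstractStrichartz.exists_lintegral_decayRate_le hq (q' := q')
  obtain ⟨W, hW⟩ := AbstractStrichartz.exists_sqrt_tsum_blockWt_le hΦ η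
  obtain ⟨S, hS⟩ := AbstractStrichartz.spaceTimeNorm_sobolev_le hΦ (η + α / 2)
  have hq2 := hq.two_le
  have hsqrt : ∀ D : ℝ≥0, ((D : ℝ≥0∞) ^ (1 / 2 : ℝ)) ≠ ⊤ := fun D =>
    ENNReal.rpow_ne_top_of_nonneg (by norm_num) ENNReal.coe_ne_top
  -- `D₁` serves the homogeneous estimate and the forcing in `L¹`, `D₂` the `L^q` bound and `D₃` the
  -- energy bound for the dual forcing. All are fixed before `φ` and `T` are introduced.
  set D₁ : ℝ≥0∞ := (A * B ^ 2 * C : ℝ≥0∞) ^ (1 / 2 : ℝ) * W with hD₁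
  set D₂ : ℝ≥0∞ := A * C with hD₂
  set D₃ : ℝ≥0∞ := S * (A * C : ℝ≥0∞) ^ (1 / 2 : ℝ) with hD₃
  have hsum : D₁ + D₂ + D₃ ≠ ⊤ := by
    refine ENNReal.add_ne_top.2 ⟨ENNReal.add_ne_top.2 ⟨?_, ?_⟩, ?_⟩
    · exact ENNReal.mul_ne_top (by exact_mod_cast hsqrt (A * B ^ (2 : ℕ) * C)) ENNReal.coe_ne_top
    · exact ENNReal.mul_ne_top ENNReal.coe_ne_top ENNReal.coe_ne_top
    · exact ENNReal.mul_ne_top ENNReal.coe_ne_top (by exact_mod_cast hsqrt (A * C))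
  have hle : D₁ + D₂ + D₃ ≤ ENNReal.ofReal ((D₁ + D₂ + D₃).toReal + 1) := by
    rw [← ENNReal.toReal_le_toReal hsum ENNReal.ofReal_ne_top,
      ENNReal.toReal_ofReal (by positivity)]
    linarith
  have h₁ : D₁ ≤ ENNReal.ofReal ((D₁ + D₂ + D₃).toReal + 1) :=
    (le_self_add.trans le_self_add).trans hle
  have h₂ : D₂ ≤ ENNReal.ofReal ((D₁ + D₂ + D₃).toReal + 1) :=
    (le_add_self.trans le_self_add).trans hle
  have h₃ : D₃ ≤ ENNReal.ofReal ((D₁ + D₂ + D₃).toReal + 1) := le_add_self.trans hle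
  -- The summand `1` only makes the constant strictly positive.
  refine ⟨(D₁ + D₂ + D₃).toReal + 1, by positivity, fun φ hφ hdec T hT => ?_⟩
  have hpp'' : p'.HolderConjugate p := ENNReal.HolderConjugate.symm
  have hbd : AbstractStrichartz.BlockDecay Φ φ p p' q' α
      (fun t => ENNReal.ofReal (AbstractStrichartz.decayRate θ₁ θ₂ t)) A B C :=
    { cutoff := hΦ
      continuousOn := hφ.continuousOn
      measurable := (AbstractStrichartz.measurable_decayRate θ₁ θ₂).ennreal_ofReal
      convolution := hC
      -- The projectors act on testers normalized in `L^{p'}`, so their bound is used at the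
      -- conjugate exponent.
      bounded := hB p' p
      decay := hA φ θ₁ θ₂ hφ.continuousOn hdec }
  refine ⟨fun h hh => ?_, fun f hf => ?_, fun f hf => ?_⟩
  · refine (hbd.spaceTimeNorm_propagator_le (q := q) hp hq2 hW T hh).trans ?_
    gcongr
  · obtain ⟨u, hu, hu₁, hu₂⟩ := hbd.exists_isDuhamel (q := q) hp hq2 hS hT hf
    refine ⟨u, hu, hu₁.trans ?_, hu₂.trans ?_⟩
    · gcongr
    · rw [← mul_assoc]
      gcongr
  · obtain ⟨u, hu, hu₁⟩ := hbd.exists_isDuhamel_one (q := q) hp hq2 hW hT hf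
    refine ⟨u, hu, hu₁.trans ?_⟩
    gcongr
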